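/- Let $(G,H,t,m)$ be a Lie crossed module: $G,H$ are (finite-dimensional, real) Lie groups with Lie algebras $\mathfrak g,\mathfrak h$, $t:H\to G$ is a smooth homomorphism and $m$ is a smooth action of $G$ on $H$ by automorphisms, such that $t(m(a)(A))=a\,t(A)\,a^{-1}$ and $m(t(A))(A')=AA'A^{-1}$ for $a\in G$, $A,A'\in H$. Let $\dot t:\mathfrak h\to\mathfrak g$ and $\dot m(a):\mathfrak h\to\mathfrak h$ be the differentials of $t$ and of $m(a)$ at $1_H$. All maps and forms are smooth. A $(G,H)$-cocycle is a triple of maps $f:\mathbb R^2\times\mathbb R\to G$, $g:\mathbb R\times\mathbb R^2\to G$, $W:\mathbb R^2\times\mathbb R^2\to H$ such that, for all real $x,x',x'',y,y',y''$, $$t(W(x',x;y',y))=g(x;y',y)^{-1}f(x',x;y')^{-1}g(x';y',y)f(x',x;y),$$ $$f(x'',x;y)=f(x'',x';y)f(x',x;y),\qquad g(x;y'',y)=g(x;y'',y')g(x;y',y),$$ $$W(x'',x;y',y)=W(x',x;y',y)\,m(f(x',x;y)^{-1})(W(x'',x';y',y)),$$ $$W(x',x;y'',y)=m(g(x;y',y)^{-1})(W(x',x;y'',y'))\,W(x',x;y',y).$$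 A $(G,H)$-connection doublet is a pair $(a,B)\in\Omega^1(\mathbb R^2,\mathfrak g)\times\Omega^2(\mathbb R^2,\mathfrak h)$ with $da+\tfrac12[a,a]-\dot t(B)=0$, where $[a,a](v,w)=[a(v),a(w)]-[a(w),a(v)]$; write $a=a_x\,dx+a_y\,dy$ and $B=B_{xy}\,dx\wedge dy$. Then there is a bijection between the set of $(G,H)$-cocycles and the set of $(G,H)$-connection doublets with the following properties. (1) The doublet $(a,B)$ corresponding to a cocycle $(f,g,W)$ is given by $$a_x(x,y)=-\partial_{x'}f(x',x;y)f(x',x;y)^{-1}\big|_{x'=x},\qquad a_y(x,y)=-\partial_{y'}g(x;y',y)g(x;y',y)^{-1}\big|_{y'=y},$$ $$B_{xy}(x,y)=-\partial_{x'}\big(\partial_{y'}W(x',x;y',y)W(x',x;y',y)^{-1}\big)\big|_{x'=x,y'=y}=-\partial_{y'}\big(W(x',x;y',y)^{-1}\partial_{x'}W(x',x;y',y)\big)\big|_{x'=x,y'=y}.$$ (2) The cocycle $(f,g,W)$ corresponding to a doublet $(a,B)$ is given by $f(x,x_0;y)=u_{|y,x_0}(x)$, $g(x;y,y_0)=v_{|x,y_0}(y)$,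 $W(x,x_0;y,y_0)=E_{|x_0,y_0}(x,y)$, where, for all $x_0,y_0\in\mathbb R$, the smooth maps $(y,x)\mapsto u_{|y,x_0}(x)\in G$, $(x,y)\mapsto v_{|x,y_0}(y)\in G$ and $(x,y)\mapsto E_{|x_0,y_0}(x,y)\in H$ are the unique smooth solutions of $$\partial_xu_{|y,x_0}(x)u_{|y,x_0}(x)^{-1}=-a_x(x,y),\quad u_{|y,x_0}(x_0)=1_G,$$ $$\partial_yv_{|x,y_0}(y)v_{|x,y_0}(y)^{-1}=-a_y(x,y),\quad v_{|x,y_0}(y_0)=1_G,$$ and of either of the two problems $$\partial_x\big(\partial_yE_{|x_0,y_0}(x,y)E_{|x_0,y_0}(x,y)^{-1}\big)=-\dot m\big(v_{|x_0,y_0}(y)^{-1}u_{|y,x_0}(x)^{-1}\big)(B_{xy}(x,y)),$$ $$\partial_y\big(E_{|x_0,y_0}(x,y)^{-1}\partial_xE_{|x_0,y_0}(x,y)\big)=-\dot m\big(u_{|y_0,x_0}(x)^{-1}v_{|x,y_0}(y)^{-1}\big)(B_{xy}(x,y)),$$ each with the initial conditions $E_{|x_0,y_0}(x_0,y)=E_{|x_0,y_0}(x,y_0)=1_H$.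 These last two problems are equivalent: any solution of one is a solution of the other. -/

import Mathlib

open scoped Manifold ContDiff

noncomputable section

/-- The Lie algebra `T₁G` of a group modelled on `V` is `V` itself as a normed space, through the
preferred chart at `1`. This is the identity map `V = T₁G`, used to regard `V`-valued forms as
`T₁G`-valued forms. -/
def toLieAlgebra {V : Type*} [NormedAddCommGroup V] [NormedSpace ℝ V]
    (G : Type*) [TopologicalSpace G] [ChartedSpace V G] [Group G] (Z : V) :
    GroupLieAlgebra 𝓘(ℝ, V) G :=
  Z

/-- The velocity `c'(s)` of a curve `c` at time `s`, right translated to the identity: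
`∂ₛ c(s) c(s)⁻¹`, an element of the Lie algebra `T₁G`. -/
def rightLogDeriv {V : Type*} [NormedAddCommGroup V] [NormedSpace ℝ V]
    {G : Type*} [TopologicalSpace G] [ChartedSpace V G] [Group G]
    (c : ℝ → G) (s : ℝ) : GroupLieAlgebra 𝓘(ℝ, V) G :=
  mfderiv 𝓘(ℝ, V) 𝓘(ℝ, V) (fun k : G => k * (c s)⁻¹) (c s) (mfderiv 𝓘(ℝ, ℝ) 𝓘(ℝ, V) c s (1 : ℝ))

/-- The velocity `c'(s)` of a curve `c` at time `s`, left translated to the identity: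
`c(s)⁻¹ ∂ₛ c(s)`, an element of the Lie algebra `T₁G`. -/
def leftLogDeriv {V : Type*} [NormedAddCommGroup V] [NormedSpace ℝ V]
    {G : Type*} [TopologicalSpace G] [ChartedSpace V G] [Group G]
    (c : ℝ → G) (s : ℝ) : GroupLieAlgebra 𝓘(ℝ, V) G :=
  mfderiv 𝓘(ℝ, V) 𝓘(ℝ, V) (fun k : G => (c s)⁻¹ * k) (c s) (mfderiv 𝓘(ℝ, ℝ) 𝓘(ℝ, V) c s (1 : ℝ))

/-- A Lie crossed module `(G, H, t, m)`: a smooth homomorphism `t : H → G` and a smooth action `m`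
of `G` on `H` by automorphisms, such that `t` is equivariant for conjugation on `G` and the
Peiffer identity holds. -/
structure LieCrossedModule (V U : Type*)
    [NormedAddCommGroup V] [NormedSpace ℝ V] [NormedAddCommGroup U] [NormedSpace ℝ U]
    (G H : Type*) [TopologicalSpace G] [ChartedSpace V G] [Group G] [LieGroup 𝓘(ℝ, V) ∞ G]
    [TopologicalSpace H] [ChartedSpace U H] [Group H] [LieGroup 𝓘(ℝ, U) ∞ H] where
  t : H →* G
  m : G →* MulAut H
  contMDiff_t : ContMDiff 𝓘(ℝ, U) 𝓘(ℝ, V) ∞ t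
  contMDiff_m : ContMDiff (𝓘(ℝ, V).prod 𝓘(ℝ, U)) 𝓘(ℝ, U) ∞ (fun p : G × H => m p.1 p.2)
  t_m : ∀ (a : G) (A : H), t (m a A) = a * t A * a⁻¹
  peiffer : ∀ A A' : H, m (t A) A' = A * A' * A⁻¹

namespace LieCrossedModule

variable {V U : Type*}
  [NormedAddCommGroup V] [NormedSpace ℝ V] [NormedAddCommGroup U] [NormedSpace ℝ U]
  {G H : Type*} [TopologicalSpace G] [ChartedSpace V G] [Group G] [LieGroup 𝓘(ℝ, V) ∞ G]
  [TopologicalSpace H] [ChartedSpace U H] [Group H] [LieGroup 𝓘(ℝ, U) ∞ H]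

/-- `ṫ : 𝔥 → 𝔤`, the differential of `t` at the identity. -/
def tDot (X : LieCrossedModule V U G H) (Z : GroupLieAlgebra 𝓘(ℝ, U) H) :
    GroupLieAlgebra 𝓘(ℝ, V) G :=
  mfderiv 𝓘(ℝ, U) 𝓘(ℝ, V) X.t (1 : H) Z

/-- `ṁ(a) : 𝔥 → 𝔥`, the differential of `m(a)` at the identity. -/
def mDot (X : LieCrossedModule V U G H) (a : G) (Z : GroupLieAlgebra 𝓘(ℝ, U) H) :
    GroupLieAlgebra 𝓘(ℝ, U) H :=
  mfderiv 𝓘(ℝ, U) 𝓘(ℝ, U) (X.m a) (1 : H) Z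

/-- A `(G, H)`-cocycle. The arguments are ordered as in `f(x', x; y)`, `g(x; y', y)` and
`W(x', x; y', y)`. -/
@[ext]
structure Cocycle (X : LieCrossedModule V U G H) where
  f : ℝ → ℝ → ℝ → G
  g : ℝ → ℝ → ℝ → G
  W : ℝ → ℝ → ℝ → ℝ → H
  contMDiff_f : ContMDiff 𝓘(ℝ, ℝ × ℝ × ℝ) 𝓘(ℝ, V) ∞ (fun p : ℝ × ℝ × ℝ => f p.1 p.2.1 p.2.2)
  contMDiff_g : ContMDiff 𝓘(ℝ, ℝ × ℝ × ℝ) 𝓘(ℝ, V) ∞ (fun p : ℝ × ℝ × ℝ => g p.1 p.2.1 p.2.2)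
  contMDiff_W : ContMDiff 𝓘(ℝ, ℝ × ℝ × ℝ × ℝ) 𝓘(ℝ, U) ∞
    (fun p : ℝ × ℝ × ℝ × ℝ => W p.1 p.2.1 p.2.2.1 p.2.2.2)
  target : ∀ x' x y' y,
    X.t (W x' x y' y) = (g x y' y)⁻¹ * (f x' x y')⁻¹ * g x' y' y * f x' x y
  f_comp : ∀ x'' x' x y, f x'' x y = f x'' x' y * f x' x y
  g_comp : ∀ x y'' y' y, g x y'' y = g x y'' y' * g x y' y
  W_comp_x : ∀ x'' x' x y' y,
    W x'' x y' y = W x' x y' y * X.m (f x' x y)⁻¹ (W x'' x' y' y)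
  W_comp_y : ∀ x' x y'' y' y,
    W x' x y'' y = X.m (g x y' y)⁻¹ (W x' x y'' y') * W x' x y' y

/-- A `(G, H)`-connection doublet: a smooth `𝔤`-valued `1`-form `a` and a smooth `𝔥`-valued `2`-form
`B` on `ℝ²` with `da + ½[a, a] - ṫ(B) = 0`, where `[a, a](v, w) = [a(v), a(w)] - [a(w), a(v)]`.
Here `𝔤 = T₁G` and `𝔥 = T₁H` are the model spaces `V` and `U` as normed spaces. -/
@[ext]
structure ConnectionDoublet (X : LieCrossedModule V U G H) where
  a : ℝ × ℝ → (ℝ × ℝ) [⋀^Fin 1]→L[ℝ] V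
  B : ℝ × ℝ → (ℝ × ℝ) [⋀^Fin 2]→L[ℝ] U
  contDiff_a : ContDiff ℝ ∞ a
  contDiff_B : ContDiff ℝ ∞ B
  fake_flat : ∀ p v w : ℝ × ℝ,
    toLieAlgebra G (extDeriv a p ![v, w])
      + (1 / 2 : ℝ) • (⁅toLieAlgebra G (a p ![v]), toLieAlgebra G (a p ![w])⁆
        - ⁅toLieAlgebra G (a p ![w]), toLieAlgebra G (a p ![v])⁆)
      - X.tDot (toLieAlgebra H (B p ![v, w])) = 0

namespace ConnectionDoublet

variable {X : LieCrossedModule V U G H}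

/-- The component `a_x(x, y)`. -/
def ax (D : X.ConnectionDoublet) (x y : ℝ) : GroupLieAlgebra 𝓘(ℝ, V) G :=
  toLieAlgebra G (D.a (x, y) ![(1, 0)])

/-- The component `a_y(x, y)`. -/
def ay (D : X.ConnectionDoublet) (x y : ℝ) : GroupLieAlgebra 𝓘(ℝ, V) G :=
  toLieAlgebra G (D.a (x, y) ![(0, 1)])

/-- The component `B_{xy}(x, y)`. -/
def Bxy (D : X.ConnectionDoublet) (x y : ℝ) : GroupLieAlgebra 𝓘(ℝ, U) H :=
  toLieAlgebra H (D.B (x, y) ![(1, 0), (0, 1)])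

/-- `u y x = u_{|y,x₀}(x)` is a smooth solution of
`∂ₓu_{|y,x₀}(x) u_{|y,x₀}(x)⁻¹ = -a_x(x, y)`, `u_{|y,x₀}(x₀) = 1`. -/
structure IsSolutionU (D : X.ConnectionDoublet) (x₀ : ℝ) (u : ℝ → ℝ → G) : Prop where
  smooth : ContMDiff 𝓘(ℝ, ℝ × ℝ) 𝓘(ℝ, V) ∞ (fun p : ℝ × ℝ => u p.1 p.2)
  ode : ∀ y x, rightLogDeriv (V := V) (u y) x = -D.ax x y
  init : ∀ y, u y x₀ = 1

/-- `v x y = v_{|x,y₀}(y)` is a smooth solution of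
`∂_y v_{|x,y₀}(y) v_{|x,y₀}(y)⁻¹ = -a_y(x, y)`, `v_{|x,y₀}(y₀) = 1`. -/
structure IsSolutionV (D : X.ConnectionDoublet) (y₀ : ℝ) (v : ℝ → ℝ → G) : Prop where
  smooth : ContMDiff 𝓘(ℝ, ℝ × ℝ) 𝓘(ℝ, V) ∞ (fun p : ℝ × ℝ => v p.1 p.2)
  ode : ∀ x y, rightLogDeriv (V := V) (v x) y = -D.ay x y
  init : ∀ x, v x y₀ = 1

/-- `E` is a smooth solution of the first form of the second order problem:
`∂ₓ(∂_y E(x,y) E(x,y)⁻¹) = -ṁ(v_{|x₀,y₀}(y)⁻¹ u_{|y,x₀}(x)⁻¹)(B_{xy}(x,y))`,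
`E(x₀,y) = E(x,y₀) = 1`. -/
structure IsSolutionE₁ (D : X.ConnectionDoublet) (x₀ y₀ : ℝ) (u v : ℝ → ℝ → G)
    (E : ℝ → ℝ → H) : Prop where
  smooth : ContMDiff 𝓘(ℝ, ℝ × ℝ) 𝓘(ℝ, U) ∞ (fun p : ℝ × ℝ => E p.1 p.2)
  ode : ∀ x y, deriv (fun ξ => rightLogDeriv (V := U) (fun η => E ξ η) y) x
    = -X.mDot ((v x₀ y)⁻¹ * (u y x)⁻¹) (D.Bxy x y)
  init_x : ∀ y, E x₀ y = 1
  init_y : ∀ x, E x y₀ = 1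

/-- `E` is a smooth solution of the second form of the second order problem:
`∂_y(E(x,y)⁻¹ ∂ₓE(x,y)) = -ṁ(u_{|y₀,x₀}(x)⁻¹ v_{|x,y₀}(y)⁻¹)(B_{xy}(x,y))`,
`E(x₀,y) = E(x,y₀) = 1`. -/
structure IsSolutionE₂ (D : X.ConnectionDoublet) (x₀ y₀ : ℝ) (u v : ℝ → ℝ → G)
    (E : ℝ → ℝ → H) : Prop where
  smooth : ContMDiff 𝓘(ℝ, ℝ × ℝ) 𝓘(ℝ, U) ∞ (fun p : ℝ × ℝ => E p.1 p.2)
  ode : ∀ x y, deriv (fun η => leftLogDeriv (V := U) (fun ξ => E ξ η) x) y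
    = -X.mDot ((u y₀ x)⁻¹ * (v x y)⁻¹) (D.Bxy x y)
  init_x : ∀ y, E x₀ y = 1
  init_y : ∀ x, E x y₀ = 1

end ConnectionDoublet

end LieCrossedModule

end

/-!
Write `rlog c` for the right logarithmic derivative `c' c⁻¹` of a curve in a Lie group, computed in
the preferred chart at the identity. A curve is determined by its logarithmic derivative and one
value, and every smooth family of Lie algebra valued functions is the family of logarithmic
derivatives of a smooth family of curves: locally this is the parametrized Picard theorem, and
translation by group elements makes the local solutions long and lets them be glued. Hence the
Goursat problem `∂ₓ(∂_y E E⁻¹) = β` with data on two crossing lines has exactly one smooth solution: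
integrate `β` in `x`, then solve for `E` in `y`.

The cocycle laws say that the values of a cocycle on large rectangles are determined by its values
on infinitesimal ones, and so turn a cocycle into a solution of the differential problems for its
own doublet. By uniqueness the doublet determines the cocycle. Conversely, transports along lines
through the axes and the solution `E` of the Goursat problem produce a cocycle; the only condition
that is not formal is that `t(E)` is the holonomy around a rectangle. Both solve one Goursat
problem: the mixed derivative of the holonomy around an infinitesimal rectangle is minus the
curvature `da + ½[a, a]`, which fake flatness identifies with `ṫ(B)`.
-/

noncomputable section

open Set Filter Topology

/-! ### Smooth flows -/

universe u v

section SpacesOfContinuousMaps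

variable {K : Type*} [TopologicalSpace K] [CompactSpace K]

/-- Pointwise application `(A, z) ↦ (k ↦ A k (z k))` of a continuous family of continuous linear
maps to a continuous map on a compact space, as a bounded bilinear map for the sup norms. -/
def pointwiseApply (K : Type*) [TopologicalSpace K] [CompactSpace K]
    (E F : Type*) [NormedAddCommGroup E] [NormedSpace ℝ E]
    [NormedAddCommGroup F] [NormedSpace ℝ F] : C(K, E →L[ℝ] F) →L[ℝ] C(K, E) →L[ℝ] C(K, F) :=
  LinearMap.mkContinuous₂
    (LinearMap.mk₂ ℝ (fun (A : C(K, E →L[ℝ] F)) (z : C(K, E)) =>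
      (⟨fun k => A k (z k), A.continuous.clm_apply z.continuous⟩ : C(K, F)))
      (fun _ _ _ => by ext; simp) (fun _ _ _ => by ext; simp)
      (fun _ _ _ => by ext; simp) (fun _ _ _ => by ext; simp)) 1
    (fun A z => by
      rw [ContinuousMap.norm_le _ (by positivity), one_mul]
      intro k
      refine ((A k).le_opNorm (z k)).trans ?_
      gcongr
      · exact A.norm_coe_le_norm k
      · exact z.norm_coe_le_norm k)

/-- The primitive vanishing at `0` of a continuous function on `[0, 1]`, as a bounded operator for
the sup norm. -/
def primitive (E : Type*) [NormedAddCommGroup E] [NormedSpace ℝ E] :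
    C(unitInterval, E) →L[ℝ] C(unitInterval, E) :=
  LinearMap.mkContinuous
    { toFun := fun z => ⟨fun s => ∫ τ in (0 : ℝ)..s, IccExtend zero_le_one z τ,
        (intervalIntegral.continuous_primitive
          (fun _ _ => (z.continuous.Icc_extend').intervalIntegrable _ _) 0).comp
          continuous_subtype_val⟩
      map_add' := fun z w => by
        ext s
        exact intervalIntegral.integral_add ((z.continuous.Icc_extend').intervalIntegrable _ _)
          ((w.continuous.Icc_extend').intervalIntegrable _ _)
      map_smul' := fun c z => by
        ext s
        exact intervalIntegral.integral_smul c _ } 1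
    (fun z => by
      rw [ContinuousMap.norm_le _ (by positivity)]
      intro s
      refine (intervalIntegral.norm_integral_le_of_norm_le_const (C := ‖z‖)
        (fun τ _ => z.norm_coe_le_norm _)).trans ?_
      rw [one_mul, sub_zero, abs_of_nonneg s.2.1]
      exact mul_le_of_le_one_right (norm_nonneg _) s.2.2)

lemma primitive_apply_eq_integral {E : Type*} [NormedAddCommGroup E] [NormedSpace ℝ E]
    {z : C(unitInterval, E)} {w : ℝ → E} (h : ∀ τ : unitInterval, z τ = w τ) (s : unitInterval) :
    primitive E z s = ∫ τ in (0 : ℝ)..s, w τ := by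
  refine intervalIntegral.integral_congr fun τ hτ => ?_
  rw [uIcc_of_le s.2.1] at hτ
  have hτ' : τ ∈ Icc (0 : ℝ) 1 := ⟨hτ.1, hτ.2.trans s.2.2⟩
  rw [IccExtend_of_mem zero_le_one _ hτ', h]

lemma hasFDerivAt_postcomp {E F : Type*} [NormedAddCommGroup E] [NormedSpace ℝ E]
    [NormedAddCommGroup F] [NormedSpace ℝ F] {f : C(E, F)} {f' : C(E, E →L[ℝ] F)}
    (hf : ∀ x, HasFDerivAt f (f' x) x) (z : C(K, E)) :
    HasFDerivAt (fun w : C(K, E) => f.comp w) (pointwiseApply K E F (f'.comp z)) z := by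
  rw [hasFDerivAt_iff_isLittleO_nhds_zero, Asymptotics.isLittleO_iff]
  intro ε hε
  obtain ⟨δ, hδ, hball⟩ := (Metric.continuousAt_iff (α := C(K, E)) (β := C(K, E →L[ℝ] F))).1
    (ContinuousMap.continuous_postcomp f').continuousAt ε hε
  -- Translating `z` by constants makes `f'` uniformly `ε`-close to `f' (z k)` on `ball (z k) δ`.
  have hf'_close : ∀ k, ∀ w ∈ Metric.ball (z k) δ, ‖f' w - f' (z k)‖ ≤ ε := fun k w hw => by
    have hdist : dist (z + ContinuousMap.const K (w - z k)) z < δ := by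
      rw [dist_eq_norm, add_sub_cancel_left]
      rw [mem_ball_iff_norm] at hw
      exact ((ContinuousMap.norm_le _ (norm_nonneg _)).2 (fun _ => le_rfl)).trans_lt hw
    simpa [dist_eq_norm] using (ContinuousMap.dist_apply_le_dist k).trans (hball hdist).le
  filter_upwards [Metric.ball_mem_nhds (0 : C(K, E)) hδ] with h hh
  rw [mem_ball_zero_iff] at hh
  rw [ContinuousMap.norm_le _ (by positivity)]
  intro k
  have hk : ‖h k‖ < δ := (h.norm_coe_le_norm k).trans_lt hh
  have mean_value : ‖f (z k + h k) - f (z k) - f' (z k) (h k)‖ ≤ ε * ‖h k‖ := by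
    simpa only [add_sub_cancel_left] using
      (convex_ball (z k) δ).norm_image_sub_le_of_norm_hasFDerivWithin_le'
        (fun w _ => (hf w).hasFDerivWithinAt) (hf'_close k) (Metric.mem_ball_self hδ)
        (y := z k + h k) (by simpa using hk)
  exact mean_value.trans (mul_le_mul_of_nonneg_left (h.norm_coe_le_norm k) hε.le)

lemma contDiff_postcomp {E : Type u} {F : Type (max u v)} [NormedAddCommGroup E] [NormedSpace ℝ E]
    [NormedAddCommGroup F] [NormedSpace ℝ F] (f : C(E, F)) (hf : ContDiff ℝ ∞ f) :
    ContDiff ℝ ∞ (fun w : C(K, E) => f.comp w) := by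
  rw [contDiff_infty]
  intro n
  induction n generalizing F with
  | zero => exact contDiff_zero.2 (ContinuousMap.continuous_postcomp f)
  | succ n ih =>
    have hf' : ContDiff ℝ ∞ (fderiv ℝ f) := hf.fderiv_right (by simp)
    let f' : C(E, E →L[ℝ] F) := ⟨fderiv ℝ f, hf'.continuous⟩
    have hasFDerivAt_f : ∀ x, HasFDerivAt f (f' x) x := fun x =>
      (hf.differentiable (by simp) x).hasFDerivAt
    refine (contDiff_succ_iff_hasFDerivAt (n := n)).2
      ⟨fun z => pointwiseApply K E F (f'.comp z), ?_, hasFDerivAt_postcomp hasFDerivAt_f⟩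
    exact (pointwiseApply K E F).contDiff.comp (ih f' hf')

lemma contDiff_eval {E : Type*} [NormedAddCommGroup E] [NormedSpace ℝ E] (k : K) :
    ContDiff ℝ ∞ (fun z : C(K, E) => z k) :=
  (ContinuousMap.evalCLM ℝ k : C(K, E) →L[ℝ] E).contDiff

end SpacesOfContinuousMaps

lemma contDiff_integral_of_contDiff {F : Type u} [NormedAddCommGroup F] [NormedSpace ℝ F]
    {β : ℝ × ℝ → F} (hβ : ContDiff ℝ ∞ β) :
    ContDiff ℝ ∞ (fun p : ℝ × ℝ => ∫ ξ in (0 : ℝ)..p.1, β (ξ, p.2)) := by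
  let b : C(ℝ × ℝ, F) := ⟨β, hβ.continuous⟩
  let e₁ : C(unitInterval, ℝ × ℝ) := ⟨fun s => (s, 0), by fun_prop⟩
  let e₂ : C(unitInterval, ℝ × ℝ) := ContinuousMap.const _ (0, 1)
  let segment : ℝ × ℝ → C(unitInterval, ℝ × ℝ) := fun p => p.1 • e₁ + p.2 • e₂
  have hsegment : ContDiff ℝ ∞ segment := by fun_prop
  have h : ContDiff ℝ ∞ (fun p : ℝ × ℝ => p.1 • primitive F (b.comp (segment p)) 1) :=
    contDiff_fst.smul ((contDiff_eval (1 : unitInterval)).comp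
      ((primitive F).contDiff.comp ((contDiff_postcomp.{0, u} b hβ).comp hsegment)))
  convert h using 2 with p
  rw [primitive_apply_eq_integral (w := fun τ => β (p.1 * τ, p.2))
    (fun τ => by simp [b, segment, e₁, e₂])]
  simpa using (intervalIntegral.smul_integral_comp_mul_left (a := 0) (b := 1)
    (fun ξ => β (ξ, p.2)) p.1).symm

lemma eventually_contDiffAt_implicitFunction {E₁ E₂ F : Type*}
    [NormedAddCommGroup E₁] [NormedSpace ℝ E₁] [CompleteSpace E₁]
    [NormedAddCommGroup E₂] [NormedSpace ℝ E₂] [CompleteSpace E₂]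
    [NormedAddCommGroup F] [NormedSpace ℝ F] [CompleteSpace F]
    {f : E₁ × E₂ → F} {u : E₁ × E₂} (hf : ContDiff ℝ ∞ f)
    (hu : (fderiv ℝ f u ∘L .inr ℝ E₁ E₂).IsInvertible) :
    ∀ᶠ p in 𝓝 u.1, ContDiffAt ℝ ∞
      ((hf.contDiffAt (x := u)).implicitFunction (by simp) hu) p := by
  have hfu := hf.contDiffAt (x := u)
  set ψ := hfu.implicitFunction (by simp) hu
  have hψ_continuous : ∀ᶠ p in 𝓝 u.1, ContinuousAt ψ p :=
    (((hfu.contDiffAt_implicitFunction (by simp) hu).of_le (by simp)).eventually (n := 1)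
      (by simp)).mono fun _ h => h.continuousAt
  have hψ_solves : ∀ᶠ p in 𝓝 u.1, f (p, ψ p) = f u :=
    hfu.eventually_apply_implicitFunction (by simp) hu
  have hψ_invertible : ∀ᶠ p in 𝓝 u.1, (fderiv ℝ f (p, ψ p) ∘L .inr ℝ E₁ E₂).IsInvertible := by
    have hc : ContinuousAt (fun p => fderiv ℝ f (p, ψ p) ∘L .inr ℝ E₁ E₂) u.1 :=
      (ContinuousAt.comp (f := fun p => (p, ψ p)) (hf.continuous_fderiv (by simp)).continuousAt
        (continuousAt_id.prodMk hψ_continuous.self_of_nhds)).clm_comp continuousAt_const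
    have hψu : ψ u.1 = u.2 := hfu.implicitFunction_apply_self (by simp) hu
    obtain ⟨e, he⟩ := hu
    refine hc.eventually (p := fun A => A.IsInvertible) ?_
    beta_reduce
    rw [hψu, Prod.mk.eta, ← he]
    exact e.nhds
  filter_upwards [hψ_continuous, hψ_solves.eventually_nhds, hψ_invertible]
    with p hp hp_solves hp_inv
  -- Near `p`, the function `ψ` is the implicit function at the point `(p, ψ p)`.
  have hfp := hf.contDiffAt (x := (p, ψ p))
  refine (hfp.contDiffAt_implicitFunction (by simp) hp_inv).congr_of_eventuallyEq ?_
  have hgraph : Tendsto (fun q => (q, ψ q)) (𝓝 p) (𝓝 (p, ψ p)) := continuousAt_id.prodMk hp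
  filter_upwards [hgraph.eventually (hfp.eventually_apply_eq_iff_implicitFunction (by simp) hp_inv),
    hp_solves] with q hq hq_solves
  exact (hq.1 (hq_solves.trans hp_solves.self_of_nhds.symm)).symm

section Flow

variable {E : Type u} [NormedAddCommGroup E] [NormedSpace ℝ E] {F : E → E}

/-- The Picard equation `z = x + ε ∫ F(z)` on `[0, 1]`, as the vanishing of a map of
`((ε, x), z)`. Its solutions are the integral curves of `F` starting at `x`, run for the time `ε`
at speed `ε`. Rescaling time to `[0, 1]` turns the time of a flow into a parameter. -/
def picardDefect (F : C(E, E)) (q : (ℝ × E) × C(unitInterval, E)) : C(unitInterval, E) :=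
  q.2 - ContinuousMap.const _ q.1.2 - q.1.1 • primitive E (F.comp q.2)

lemma picardDefect_eq_zero_iff {F : C(E, E)} {ε : ℝ} {x : E} {z : C(unitInterval, E)} {w : ℝ → E}
    (hw : ∀ τ : unitInterval, z τ = w τ) :
    picardDefect F ((ε, x), z) = 0 ↔
      ∀ s : unitInterval, z s = x + ε • ∫ τ in (0 : ℝ)..s, F (w τ) := by
  rw [ContinuousMap.ext_iff]
  refine forall_congr' fun s => ?_
  rw [← primitive_apply_eq_integral (z := F.comp z) (w := fun τ => F (w τ)) (by simp [hw]),
    ContinuousMap.zero_apply, ← sub_eq_zero (a := z s), ← sub_sub]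
  rfl

lemma contDiff_picardDefect {F : C(E, E)} (hF : ContDiff ℝ ∞ F) :
    ContDiff ℝ ∞ (picardDefect F) := by
  have hconst : ContDiff ℝ ∞ (fun x : E => ContinuousMap.const unitInterval x) :=
    (ContinuousLinearMap.const ℝ unitInterval : E →L[ℝ] C(unitInterval, E)).contDiff
  have hprim : ContDiff ℝ ∞ (fun z => primitive E (F.comp z)) :=
    (primitive E).contDiff.comp (contDiff_postcomp.{u, u} F hF)
  exact (contDiff_snd.sub (hconst.comp contDiff_fst.snd)).sub
    (contDiff_fst.fst.smul (hprim.comp contDiff_snd))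

lemma picardDefect_rescale {F : C(E, E)} {ε : ℝ} {x : E} {z : C(unitInterval, E)}
    (h : picardDefect F ((ε, x), z) = 0) (s : unitInterval) :
    picardDefect F ((ε * s, x), z.comp ⟨fun τ => s * τ, by fun_prop⟩) = 0 := by
  have hz : ∀ τ : unitInterval, z τ = IccExtend zero_le_one z τ := fun τ => by simp
  rw [picardDefect_eq_zero_iff hz] at h
  refine (picardDefect_eq_zero_iff (w := fun τ => IccExtend zero_le_one z (s * τ))
    fun τ => hz (s * τ)).2 fun τ => ?_
  have h_subst := intervalIntegral.smul_integral_comp_mul_left (a := 0) (b := (τ : ℝ))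
    (fun r => F (IccExtend zero_le_one z r)) (s : ℝ)
  rw [mul_zero] at h_subst
  rw [mul_smul, h_subst]
  exact h (s * τ)

variable [CompleteSpace E]

lemma exists_picardDefect_eq_zero {F : C(E, E)} (hF : ContDiff ℝ ∞ F) (x₀ : E) :
    ∃ ψ : ℝ × E → C(unitInterval, E), ψ (0, x₀) = ContinuousMap.const _ x₀ ∧
      (∀ᶠ p in 𝓝 (0, x₀), ContDiffAt ℝ ∞ ψ p ∧ picardDefect F (p, ψ p) = 0) ∧
      ∀ᶠ q in 𝓝 ((0, x₀), ContinuousMap.const _ x₀), picardDefect F q = 0 → ψ q.1 = q.2 := by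
  set u : (ℝ × E) × C(unitInterval, E) := ((0, x₀), ContinuousMap.const _ x₀)
  have hu : picardDefect F u = 0 := by simp [picardDefect, u]
  have hsmooth := contDiff_picardDefect hF
  have hpartial : fderiv ℝ (picardDefect F) u ∘L .inr ℝ (ℝ × E) C(unitInterval, E) = .id ℝ _ := by
    have hinr := ((hsmooth.differentiable (by simp) u).hasFDerivAt).comp u.2
      (hasFDerivAt_prodMk_right u.1 u.2)
    refine hinr.unique (((hasFDerivAt_id u.2).sub_const u.2).congr_of_eventuallyEq ?_)
    exact .of_forall fun z => by simp [picardDefect, u]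
  have hinv : (fderiv ℝ (picardDefect F) u ∘L .inr ℝ (ℝ × E) C(unitInterval, E)).IsInvertible :=
    ⟨.refl ℝ _, hpartial.symm⟩
  have hFu := hsmooth.contDiffAt (x := u)
  refine ⟨hFu.implicitFunction (by simp) hinv, hFu.implicitFunction_apply_self (by simp) hinv,
    (eventually_contDiffAt_implicitFunction hsmooth hinv).and ?_, ?_⟩
  · exact (hFu.eventually_apply_implicitFunction (by simp) hinv).mono fun p hp => hp.trans hu
  · exact (hFu.eventually_apply_eq_iff_implicitFunction (by simp) hinv).mono
      fun q hq hq_zero => hq.1 (hq_zero.trans hu.symm)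

lemma exists_smooth_integral_equation {F : C(E, E)} (hF : ContDiff ℝ ∞ F) (x₀ : E) :
    ∃ φ : ℝ × E → E, ∀ᶠ p in 𝓝 (0, x₀),
      ContDiffAt ℝ ∞ φ p ∧ φ p = p.2 + ∫ t in (0 : ℝ)..p.1, F (φ (t, p.2)) := by
  obtain ⟨ψ, hψ₀, hψ_solves, hψ_unique⟩ := exists_picardDefect_eq_zero hF x₀
  have hψ_continuous : ContinuousAt ψ (0, x₀) := hψ_solves.self_of_nhds.1.continuousAt
  let scale : C(unitInterval, C(unitInterval, unitInterval)) :=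
    ContinuousMap.curry ⟨fun p => p.1 * p.2, by fun_prop⟩
  have h_rescale : ∀ᶠ p in 𝓝 (0, x₀), ∀ s ∈ (univ : Set unitInterval),
      picardDefect F ((p.1 * s, p.2), (ψ p).comp (scale s)) = 0 →
        ψ (p.1 * s, p.2) = (ψ p).comp (scale s) := by
    refine isCompact_univ.eventually_forall_of_forall_eventually fun s _ => ?_
    have h_tendsto : ContinuousAt (fun q : (ℝ × E) × unitInterval =>
        (((q.1.1 * q.2, q.1.2), (ψ q.1).comp (scale q.2)) : (ℝ × E) × C(unitInterval, E)))
        ((0, x₀), s) := by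
      refine ContinuousAt.prodMk (by fun_prop) ?_
      exact ContinuousAt.compCM
        (ContinuousAt.comp (f := fun q : (ℝ × E) × unitInterval => q.1) hψ_continuous
          continuousAt_fst)
        (scale.continuous.continuousAt.comp continuousAt_snd)
    refine h_tendsto.eventually (p := fun q => picardDefect F q = 0 → ψ q.1 = q.2) ?_
    simpa [hψ₀] using hψ_unique
  refine ⟨fun p => ψ p 1, ?_⟩
  filter_upwards [hψ_solves, h_rescale] with ⟨ε, x⟩ hp hp_rescale
  have hψ_eq : ∀ s : unitInterval, ψ (ε, x) s = ψ (ε * s, x) 1 := fun s => by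
    rw [hp_rescale s (mem_univ s) (picardDefect_rescale hp.2 s)]
    simp [scale]
  refine ⟨(contDiff_eval 1).contDiffAt.comp _ hp.1, ?_⟩
  rw [(picardDefect_eq_zero_iff (w := fun τ => ψ (ε * τ, x) 1) hψ_eq).1 hp.2 1]
  simpa using intervalIntegral.smul_integral_comp_mul_left (a := 0) (b := 1)
    (fun t => F (ψ (t, x) 1)) ε

lemma exists_smooth_local_flow (hF : ContDiff ℝ ∞ F) (x₀ : E) :
    ∃ φ : ℝ × E → E, ∀ᶠ p in 𝓝 (0, x₀), φ (0, p.2) = p.2 ∧ ContDiffAt ℝ ∞ φ p ∧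
      HasDerivAt (fun t => φ (t, p.2)) (F (φ p)) p.1 := by
  obtain ⟨φ, hφ⟩ := exists_smooth_integral_equation (F := ⟨F, hF.continuous⟩) hF x₀
  refine ⟨φ, ?_⟩
  obtain ⟨r, hr, hball⟩ := Metric.eventually_nhds_iff_ball.1 hφ
  filter_upwards [Metric.ball_mem_nhds _ hr] with ⟨ε, x⟩ hp
  rw [← ball_prod_same, mem_prod, Real.ball_eq_Ioo, zero_sub, zero_add] at hp
  have hgood : ∀ t ∈ Ioo (-r) r,
      ContDiffAt ℝ ∞ φ (t, x) ∧ φ (t, x) = x + ∫ τ in (0 : ℝ)..t, F (φ (τ, x)) := fun t ht =>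
    hball (t, x) (by
      rw [← ball_prod_same, mem_prod, Real.ball_eq_Ioo, zero_sub, zero_add]
      exact ⟨ht, hp.2⟩)
  have hcontinuous : ∀ t ∈ Ioo (-r) r, ContinuousAt (fun t => F (φ (t, x))) t := fun t ht =>
    hF.continuous.continuousAt.comp
      (ContinuousAt.comp (f := fun t => (t, x)) (hgood t ht).1.continuousAt (by fun_prop))
  have hzero : (0 : ℝ) ∈ Ioo (-r) r := ⟨neg_lt_zero.2 hr, hr⟩
  refine ⟨by simpa using (hgood 0 hzero).2, (hgood ε hp.1).1, ?_⟩
  have hintegrable : IntervalIntegrable (fun t => F (φ (t, x))) MeasureTheory.volume 0 ε :=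
    ContinuousOn.intervalIntegrable fun t ht =>
      (hcontinuous t (ordConnected_Ioo.uIcc_subset hzero hp.1 ht)).continuousWithinAt
  have hmeasurable := ContinuousAt.stronglyMeasurableAtFilter (μ := MeasureTheory.volume)
    isOpen_Ioo hcontinuous ε hp.1
  refine ((intervalIntegral.integral_hasDerivAt_right hintegrable hmeasurable
    (hcontinuous ε hp.1)).const_add x).congr_of_eventuallyEq ?_
  filter_upwards [isOpen_Ioo.mem_nhds hp.1] with t ht using (hgood t ht).2

lemma exists_smooth_local_solution {F : E × ℝ × ℝ → E} (hF : ContDiff ℝ ∞ F) (z₀ : E)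
    (x₀ y₀ : ℝ) :
    ∃ ζ : ℝ × ℝ → E, ζ (x₀, y₀) = z₀ ∧ ∀ᶠ p in 𝓝 (x₀, y₀), ContDiffAt ℝ ∞ ζ p ∧
      HasDerivAt (fun x => ζ (x, p.2)) (F (ζ p, p)) p.1 := by
  -- Time and parameter become components of the state, moving with velocities `1` and `0`.
  obtain ⟨φ, hφ⟩ := exists_smooth_local_flow (F := fun q : E × ℝ × ℝ => (F q, (1 : ℝ), (0 : ℝ)))
    (hF.prodMk contDiff_const) (z₀, x₀, y₀)
  let start : ℝ × ℝ → ℝ × E × ℝ × ℝ := fun p => (p.1 - x₀, z₀, x₀, p.2)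
  have hstart : ContinuousAt start (x₀, y₀) := by fun_prop
  have hstart₀ : start (x₀, y₀) = (0, z₀, x₀, y₀) := by simp [start]
  refine ⟨fun p => (φ (start p)).1, by simp only [hstart₀, hφ.self_of_nhds.1], ?_⟩
  rw [← hstart₀] at hφ
  obtain ⟨r, hr, hball⟩ := Metric.eventually_nhds_iff_ball.1 (hstart.eventually hφ)
  filter_upwards [Metric.ball_mem_nhds _ hr] with ⟨x, y⟩ hp
  rw [← ball_prod_same, mem_prod] at hp
  have hflow : ∀ t ∈ Metric.ball x₀ r,
      HasDerivAt (fun t => φ (start (t, y))) (F (φ (start (t, y))), 1, 0) t := fun t ht => by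
    have h := (hball (t, y) (by rw [← ball_prod_same]; exact ⟨ht, hp.2⟩)).2.2
    exact HasDerivAt.comp_sub_const (𝕜 := ℝ) t x₀ h
  have hclock : EqOn (fun t => (φ (start (t, y))).2) (fun t => (t, y)) (Metric.ball x₀ r) := by
    have hvelocity : ∀ t ∈ Metric.ball x₀ r,
        HasDerivAt (fun t => (φ (start (t, y))).2) (1, 0) t := fun t ht =>
      (ContinuousLinearMap.snd ℝ E (ℝ × ℝ)).hasFDerivAt.comp_hasDerivAt t (hflow t ht)
    have hderiv : ∀ t, HasDerivAt (fun t : ℝ => (t, y)) ((1 : ℝ), (0 : ℝ)) t := fun t =>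
      (hasDerivAt_id t).prodMk (hasDerivAt_const t y)
    refine Metric.isOpen_ball.eqOn_of_deriv_eq (convex_ball _ _).isPreconnected
      (fun t ht => (hvelocity t ht).differentiableAt.differentiableWithinAt)
      (fun t _ => (hderiv t).differentiableAt.differentiableWithinAt)
      (fun t ht => (hvelocity t ht).deriv.trans (hderiv t).deriv.symm)
      (Metric.mem_ball_self hr) ?_
    simpa [start] using congrArg Prod.snd
      (hball (x₀, y) (by rw [← ball_prod_same]; exact ⟨Metric.mem_ball_self hr, hp.2⟩)).1
  refine ⟨contDiffAt_fst.comp _ ((hball (x, y) ?_).2.1.comp _ (by fun_prop)), ?_⟩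
  · rw [← ball_prod_same]
    exact hp
  · have hx : φ (start (x, y)) = ((φ (start (x, y))).1, (x, y)) := Prod.ext rfl (hclock hp.1)
    have h := (ContinuousLinearMap.fst ℝ E (ℝ × ℝ)).hasFDerivAt.comp_hasDerivAt x (hflow x hp.1)
    rw [hx] at h
    exact h

end Flow

/-! ### Lie groups in the chart at the identity -/

section Chart

variable {V : Type*} [NormedAddCommGroup V] [NormedSpace ℝ V]
  {G : Type*} [TopologicalSpace G] [ChartedSpace V G]

lemma contMDiffAt_slice_left {E : Type*} [NormedAddCommGroup E] [NormedSpace ℝ E]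
    {w : ℝ × E → G} {x : ℝ} {y : E} (h : ContMDiffAt 𝓘(ℝ, ℝ × E) 𝓘(ℝ, V) ∞ w (x, y)) :
    ContMDiffAt 𝓘(ℝ, ℝ) 𝓘(ℝ, V) ∞ (fun ξ => w (ξ, y)) x :=
  ContMDiffAt.comp x (f := fun ξ : ℝ => (ξ, y)) h
    (by fun_prop : ContDiffAt ℝ ∞ (fun ξ : ℝ => (ξ, y)) x).contMDiffAt

lemma contMDiffAt_slice_right {w : ℝ × ℝ → G} {x y : ℝ}
    (h : ContMDiffAt 𝓘(ℝ, ℝ × ℝ) 𝓘(ℝ, V) ∞ w (x, y)) :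
    ContMDiffAt 𝓘(ℝ, ℝ) 𝓘(ℝ, V) ∞ (fun η => w (x, η)) y :=
  ContMDiffAt.comp y (f := fun η : ℝ => (x, η)) h
    (by fun_prop : ContDiffAt ℝ ∞ (fun η : ℝ => (x, η)) y).contMDiffAt

section One

variable (V G) [One G]

/-- The preferred chart of a Lie group at the identity. The tangent space at `1` is read in it. -/
def oneChart : PartialEquiv G V :=
  extChartAt 𝓘(ℝ, V) (1 : G)

lemma one_mem_oneChart_source : (1 : G) ∈ (oneChart V G).source :=
  mem_extChartAt_source (I := 𝓘(ℝ, V)) (1 : G)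

lemma oneChart_source_mem_nhds : (oneChart V G).source ∈ 𝓝 (1 : G) :=
  extChartAt_source_mem_nhds (I := 𝓘(ℝ, V)) (1 : G)

lemma oneChart_target_mem_nhds : (oneChart V G).target ∈ 𝓝 (oneChart V G 1) :=
  extChartAt_target_mem_nhds (I := 𝓘(ℝ, V)) (1 : G)

lemma oneChart_one_mem_target : oneChart V G 1 ∈ (oneChart V G).target :=
  mem_of_mem_nhds (oneChart_target_mem_nhds V G)

@[simp]
lemma oneChart_symm_one : (oneChart V G).symm (oneChart V G 1) = 1 :=
  (oneChart V G).left_inv (one_mem_oneChart_source V G)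

lemma isOpen_oneChart_source : IsOpen (oneChart V G).source :=
  isOpen_extChartAt_source (I := 𝓘(ℝ, V)) (1 : G)

lemma isOpen_oneChart_target : IsOpen (oneChart V G).target :=
  isOpen_extChartAt_target (I := 𝓘(ℝ, V)) (1 : G)

end One

variable [One G] {E : Type*} [NormedAddCommGroup E] [NormedSpace ℝ E]

/-- The velocity, in the preferred chart at `1`, of a curve. It is used for curves passing through
`1` at time `s`, and is then an element of the Lie algebra. -/
def velocity (c : ℝ → G) (s : ℝ) : V :=
  deriv (fun τ => oneChart V G (c τ)) s

lemma mfderiv_eq_fderiv_oneChart {c : E → G} {p : E}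
    (hc : MDifferentiableAt 𝓘(ℝ, E) 𝓘(ℝ, V) c p) (hp : c p = 1) (v : E) :
    (mfderiv 𝓘(ℝ, E) 𝓘(ℝ, V) c p v : V) = fderiv ℝ (fun q => oneChart V G (c q)) p v := by
  rw [hc.mfderiv]
  simp [writtenInExtChartAt, hp, oneChart, Function.comp_def]
  rfl

variable [IsManifold 𝓘(ℝ, V) ∞ G]

lemma contMDiffAt_oneChart {k : G} (hk : k ∈ (oneChart V G).source) :
    ContMDiffAt 𝓘(ℝ, V) 𝓘(ℝ, V) ∞ (oneChart V G) k :=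
  contMDiffAt_extChartAt' (by rwa [oneChart, extChartAt_source] at hk)

lemma contMDiffAt_oneChart_symm {z : V} (hz : z ∈ (oneChart V G).target) :
    ContMDiffAt 𝓘(ℝ, V) 𝓘(ℝ, V) ∞ (oneChart V G).symm z :=
  (contMDiffOn_extChartAt_symm (I := 𝓘(ℝ, V)) (1 : G)).contMDiffAt
    ((isOpen_oneChart_target V G).mem_nhds hz)

lemma contDiffAt_oneChart_comp {c : E → G} {p : E}
    (hc : ContMDiffAt 𝓘(ℝ, E) 𝓘(ℝ, V) ∞ c p) (hp : c p ∈ (oneChart V G).source) :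
    ContDiffAt ℝ ∞ (fun q => oneChart V G (c q)) p :=
  contMDiffAt_iff_contDiffAt.1 ((contMDiffAt_oneChart hp).comp p hc)

end Chart

section LogDerivInChart

variable {V : Type*} [NormedAddCommGroup V] [NormedSpace ℝ V]
  {G : Type*} [TopologicalSpace G] [ChartedSpace V G]
  {U : Type*} [NormedAddCommGroup U] [NormedSpace ℝ U]
  {H : Type*} [TopologicalSpace H] [ChartedSpace U H] [One H]

lemma velocity_comp_eq_mfderiv {ψ : G → H} {c : ℝ → G} {s : ℝ}
    (hψ : MDifferentiableAt 𝓘(ℝ, V) 𝓘(ℝ, U) ψ (c s))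
    (hc : MDifferentiableAt 𝓘(ℝ, ℝ) 𝓘(ℝ, V) c s) (h_one : ψ (c s) = 1) :
    velocity (V := U) (fun τ => ψ (c τ)) s =
      (mfderiv 𝓘(ℝ, V) 𝓘(ℝ, U) ψ (c s) (mfderiv 𝓘(ℝ, ℝ) 𝓘(ℝ, V) c s (1 : ℝ)) : U) := by
  have h_chain := mfderiv_comp s hψ hc
  exact (mfderiv_eq_fderiv_oneChart (hψ.comp s hc) h_one 1).symm.trans
    (congrArg (fun A => (A (1 : ℝ) : U)) h_chain)

lemma velocity_comp [One G] {ψ : G → H} (hψ : MDifferentiableAt 𝓘(ℝ, V) 𝓘(ℝ, U) ψ 1)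
    (hψ_one : ψ 1 = 1) {c : ℝ → G} {s : ℝ}
    (hc : MDifferentiableAt 𝓘(ℝ, ℝ) 𝓘(ℝ, V) c s) (hs : c s = 1) :
    velocity (V := U) (fun τ => ψ (c τ)) s =
      (mfderiv 𝓘(ℝ, V) 𝓘(ℝ, U) ψ 1 (velocity (V := V) c s) : U) := by
  have h := velocity_comp_eq_mfderiv (ψ := ψ) (by rwa [hs]) hc (by rw [hs, hψ_one])
  have hc_velocity : (mfderiv 𝓘(ℝ, ℝ) 𝓘(ℝ, V) c s (1 : ℝ) : V) = velocity (V := V) c s :=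
    mfderiv_eq_fderiv_oneChart hc hs 1
  have h_base : ∀ k : G, k = 1 → ∀ w : V,
      (mfderiv 𝓘(ℝ, V) 𝓘(ℝ, U) ψ k w : U) = (mfderiv 𝓘(ℝ, V) 𝓘(ℝ, U) ψ 1 w : U) := by
    rintro _ rfl w
    rfl
  rw [hc_velocity] at h
  exact h.trans (h_base _ hs _)

variable [Group G] [LieGroup 𝓘(ℝ, V) ∞ G]

lemma rightLogDeriv_eq_velocity {c : ℝ → G} {s : ℝ}
    (hc : MDifferentiableAt 𝓘(ℝ, ℝ) 𝓘(ℝ, V) c s) :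
    (rightLogDeriv (V := V) c s : V) = velocity (V := V) (fun τ => c τ * (c s)⁻¹) s :=
  (velocity_comp_eq_mfderiv (ψ := (· * (c s)⁻¹))
    ((contMDiff_mul_right.mdifferentiable (n := ∞) (by simp)) _) hc (mul_inv_cancel _)).symm

lemma leftLogDeriv_eq_velocity {c : ℝ → G} {s : ℝ}
    (hc : MDifferentiableAt 𝓘(ℝ, ℝ) 𝓘(ℝ, V) c s) :
    (leftLogDeriv (V := V) c s : V) = velocity (V := V) (fun τ => (c s)⁻¹ * c τ) s :=
  (velocity_comp_eq_mfderiv (ψ := ((c s)⁻¹ * ·))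
    ((contMDiff_mul_left.mdifferentiable (n := ∞) (by simp)) _) hc (inv_mul_cancel _)).symm

end LogDerivInChart

/-! ### Mixed partial derivatives -/

section MixedPartial

variable {E F : Type*} [NormedAddCommGroup E] [NormedSpace ℝ E]
  [NormedAddCommGroup F] [NormedSpace ℝ F]

/-- The mixed second partial derivative `∂ₓ∂_y` of a function of two real variables. -/
def mixedPartial (K : ℝ × ℝ → F) (p : ℝ × ℝ) : F :=
  fderiv ℝ (fderiv ℝ K) p (1, 0) (0, 1)

lemma minSmoothness_two_le_infty : minSmoothness ℝ 2 ≤ (∞ : WithTop ℕ∞) := by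
  rw [minSmoothness_of_isRCLikeNormedField]
  exact WithTop.coe_le_coe.2 (le_top : (2 : ℕ∞) ≤ ⊤)

lemma hasFDerivAt_fderiv {K : E → F} {p : E} (hK : ContDiffAt ℝ ∞ K p) :
    HasFDerivAt (fderiv ℝ K) (fderiv ℝ (fderiv ℝ K) p) p :=
  ((hK.fderiv_right (m := ∞) (by simp)).differentiableAt (by simp)).hasFDerivAt

lemma hasFDerivAt_fderiv_comp_apply {D : Type*} [NormedAddCommGroup D] [NormedSpace ℝ D]
    {K : E → F} {κ : D → E} {κ' : D →L[ℝ] E} {p : D} (hK : ContDiffAt ℝ ∞ K (κ p))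
    (hκ : HasFDerivAt κ κ' p) (v : E) :
    HasFDerivAt (fun q => fderiv ℝ K (κ q) v)
      ((ContinuousLinearMap.apply ℝ F v).comp ((fderiv ℝ (fderiv ℝ K) (κ p)).comp κ')) p :=
  (ContinuousLinearMap.apply ℝ F v).hasFDerivAt.comp p ((hasFDerivAt_fderiv hK).comp p hκ)

lemma eventually_differentiableAt {K : E → F} {p : E} (hK : ContDiffAt ℝ ∞ K p) :
    ∀ᶠ q in 𝓝 p, DifferentiableAt ℝ K q :=
  ((hK.of_le (n := ∞) (m := 1) (by simp)).eventually (by simp)).mono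
    fun _ hq => hq.differentiableAt (by simp)

lemma hasDerivAt_mk_left (x y : ℝ) : HasDerivAt (fun ξ : ℝ => (ξ, y)) ((1 : ℝ), (0 : ℝ)) x :=
  (hasDerivAt_id x).prodMk (hasDerivAt_const x y)

lemma hasDerivAt_mk_right (x y : ℝ) : HasDerivAt (fun η : ℝ => (x, η)) ((0 : ℝ), (1 : ℝ)) y :=
  (hasDerivAt_const y x).prodMk (hasDerivAt_id y)

lemma hasDerivAt_partial_left {K : ℝ × ℝ → F} {x y : ℝ} (hK : DifferentiableAt ℝ K (x, y)) :
    HasDerivAt (fun ξ => K (ξ, y)) (fderiv ℝ K (x, y) (1, 0)) x :=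
  hK.hasFDerivAt.comp_hasDerivAt x (hasDerivAt_mk_left x y)

lemma hasDerivAt_partial_right {K : ℝ × ℝ → F} {x y : ℝ} (hK : DifferentiableAt ℝ K (x, y)) :
    HasDerivAt (fun η => K (x, η)) (fderiv ℝ K (x, y) (0, 1)) y :=
  hK.hasFDerivAt.comp_hasDerivAt y (hasDerivAt_mk_right x y)

lemma hasDerivAt_deriv_partial_right {K : ℝ × ℝ → F} {x y : ℝ} (hK : ContDiffAt ℝ ∞ K (x, y)) :
    HasDerivAt (fun ξ => deriv (fun η => K (ξ, η)) y) (mixedPartial K (x, y)) x := by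
  have h : HasDerivAt (fun ξ => fderiv ℝ K (ξ, y) (0, 1)) (mixedPartial K (x, y)) x :=
    (ContinuousLinearMap.apply ℝ F ((0 : ℝ), (1 : ℝ))).hasFDerivAt.comp_hasDerivAt x
      ((hasFDerivAt_fderiv hK).comp_hasDerivAt x (hasDerivAt_mk_left x y))
  refine h.congr_of_eventuallyEq ?_
  filter_upwards [(hasDerivAt_mk_left x y).continuousAt.eventually (eventually_differentiableAt hK)]
    with ξ hξ using (hasDerivAt_partial_right hξ).deriv

lemma hasDerivAt_deriv_partial_left {K : ℝ × ℝ → F} {x y : ℝ} (hK : ContDiffAt ℝ ∞ K (x, y)) :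
    HasDerivAt (fun η => deriv (fun ξ => K (ξ, η)) x) (mixedPartial K (x, y)) y := by
  have hsymm : mixedPartial K (x, y) = fderiv ℝ (fderiv ℝ K) (x, y) (0, 1) (1, 0) :=
    (hK.isSymmSndFDerivAt minSmoothness_two_le_infty).eq _ _
  have h : HasDerivAt (fun η => fderiv ℝ K (x, η) (1, 0)) (mixedPartial K (x, y)) y := by
    rw [hsymm]
    exact (ContinuousLinearMap.apply ℝ F ((1 : ℝ), (0 : ℝ))).hasFDerivAt.comp_hasDerivAt y
      ((hasFDerivAt_fderiv hK).comp_hasDerivAt y (hasDerivAt_mk_right x y))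
  refine h.congr_of_eventuallyEq ?_
  filter_upwards [(hasDerivAt_mk_right x y).continuousAt.eventually
    (eventually_differentiableAt hK)] with η hη using (hasDerivAt_partial_left hη).deriv

lemma mixedPartial_congr {K L : ℝ × ℝ → F} {p : ℝ × ℝ} (h : K =ᶠ[𝓝 p] L) :
    mixedPartial K p = mixedPartial L p := by
  rw [mixedPartial, mixedPartial, h.fderiv.fderiv_eq]

lemma mixedPartial_comp {μ : E → F} {κ : ℝ × ℝ → E} {p : ℝ × ℝ}
    (hμ : ContDiffAt ℝ ∞ μ (κ p)) (hκ : ContDiffAt ℝ ∞ κ p) :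
    mixedPartial (fun q => μ (κ q)) p =
      fderiv ℝ (fderiv ℝ μ) (κ p) (fderiv ℝ κ p (1, 0)) (fderiv ℝ κ p (0, 1)) +
        fderiv ℝ μ (κ p) (mixedPartial κ p) := by
  have h_fderiv : fderiv ℝ (fun q => μ (κ q)) =ᶠ[𝓝 p]
      fun q => (fderiv ℝ μ (κ q)).comp (fderiv ℝ κ q) := by
    filter_upwards [hκ.continuousAt.eventually (eventually_differentiableAt hμ),
      eventually_differentiableAt hκ] with q hμq hκq using fderiv_comp q hμq hκq
  have h_product : HasFDerivAt (fun q => (fderiv ℝ μ (κ q)).comp (fderiv ℝ κ q)) _ p :=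
    ((hasFDerivAt_fderiv hμ).comp p (hκ.differentiableAt (by simp)).hasFDerivAt).clm_comp
      (hasFDerivAt_fderiv hκ)
  rw [mixedPartial, h_fderiv.fderiv_eq, h_product.fderiv]
  simp [mixedPartial, add_comm]

lemma mixedPartial_clm_comp (L : E →L[ℝ] F) {κ : ℝ × ℝ → E} {p : ℝ × ℝ}
    (hκ : ContDiffAt ℝ ∞ κ p) :
    mixedPartial (fun q => L (κ q)) p = L (mixedPartial κ p) := by
  have hL : fderiv ℝ L = fun _ => L := funext fun _ => L.fderiv
  rw [mixedPartial_comp L.contDiff.contDiffAt hκ]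
  simp [hL]

lemma mixedPartial_prodMk {K : ℝ × ℝ → E} {L : ℝ × ℝ → F} {p : ℝ × ℝ}
    (hK : ContDiffAt ℝ ∞ K p) (hL : ContDiffAt ℝ ∞ L p) :
    mixedPartial (fun q => (K q, L q)) p = (mixedPartial K p, mixedPartial L p) :=
  Prod.ext (mixedPartial_clm_comp (ContinuousLinearMap.fst ℝ E F) (hK.prodMk hL)).symm
    (mixedPartial_clm_comp (ContinuousLinearMap.snd ℝ E F) (hK.prodMk hL)).symm

end MixedPartial

/-! ### The multiplication of a Lie group to second order -/

section ChartMul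

variable {V : Type*} [NormedAddCommGroup V] [NormedSpace ℝ V]
  {G : Type*} [TopologicalSpace G] [ChartedSpace V G] [Group G]

variable (V G) in
/-- The multiplication of a Lie group read in the preferred chart at `1`. -/
def chartMul (q : V × V) : V :=
  oneChart V G ((oneChart V G).symm q.1 * (oneChart V G).symm q.2)

variable (V G) in
/-- The bilinear part of the multiplication of a Lie group at the identity, in the preferred chart
at `1`. -/
def chartMulBilin : V →L[ℝ] V →L[ℝ] V :=
  (fderiv ℝ (fderiv ℝ (chartMul V G)) (oneChart V G 1, oneChart V G 1)).bilinearComp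
    (.inl ℝ V V) (.inr ℝ V V)

variable (V G) in
/-- The Lie bracket of `T₁G`, as a continuous bilinear map on the model space `V = T₁G`. -/
def bracketCLM : V →L[ℝ] V →L[ℝ] V :=
  chartMulBilin V G - (chartMulBilin V G).flip

lemma bracketCLM_swap (A B : V) : bracketCLM V G B A = -bracketCLM V G A B := by
  simp [bracketCLM]

lemma chartMul_one_left {w : V} (hw : w ∈ (oneChart V G).target) :
    chartMul V G (oneChart V G 1, w) = w := by
  simp [chartMul, (oneChart V G).right_inv hw]

lemma chartMul_one_right {z : V} (hz : z ∈ (oneChart V G).target) :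
    chartMul V G (z, oneChart V G 1) = z := by
  simp [chartMul, (oneChart V G).right_inv hz]

lemma oneChart_mul_eq_chartMul {k l : G} (hk : k ∈ (oneChart V G).source)
    (hl : l ∈ (oneChart V G).source) :
    oneChart V G (k * l) = chartMul V G (oneChart V G k, oneChart V G l) := by
  simp only [chartMul, (oneChart V G).left_inv hk, (oneChart V G).left_inv hl]

variable [LieGroup 𝓘(ℝ, V) ∞ G]

lemma contDiffAt_chartMul {q : V × V} (h₁ : q.1 ∈ (oneChart V G).target)
    (h₂ : q.2 ∈ (oneChart V G).target)
    (h : (oneChart V G).symm q.1 * (oneChart V G).symm q.2 ∈ (oneChart V G).source) :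
    ContDiffAt ℝ ∞ (chartMul V G) q :=
  contDiffAt_oneChart_comp (c := fun q : V × V => (oneChart V G).symm q.1 * (oneChart V G).symm q.2)
    (((contMDiffAt_oneChart_symm h₁).comp q contDiffAt_fst.contMDiffAt).mul
      ((contMDiffAt_oneChart_symm h₂).comp q contDiffAt_snd.contMDiffAt)) h

lemma contDiffAt_chartMul_left {z : V} (hz : z ∈ (oneChart V G).target) :
    ContDiffAt ℝ ∞ (chartMul V G) (z, oneChart V G 1) :=
  contDiffAt_chartMul hz (oneChart_one_mem_target V G) (by simpa using (oneChart V G).map_target hz)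

lemma contDiffAt_chartMul_right {w : V} (hw : w ∈ (oneChart V G).target) :
    ContDiffAt ℝ ∞ (chartMul V G) (oneChart V G 1, w) :=
  contDiffAt_chartMul (oneChart_one_mem_target V G) hw (by simpa using (oneChart V G).map_target hw)

variable (V G) in
lemma contDiffAt_chartMul_one :
    ContDiffAt ℝ ∞ (chartMul V G) (oneChart V G 1, oneChart V G 1) :=
  contDiffAt_chartMul_left (oneChart_one_mem_target V G)

lemma fderiv_chartMul_left {z : V} (hz : z ∈ (oneChart V G).target) (A : V) :
    fderiv ℝ (chartMul V G) (z, oneChart V G 1) (A, 0) = A := by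
  have h_chain : HasFDerivAt (fun w => chartMul V G (w, oneChart V G 1))
      ((fderiv ℝ (chartMul V G) (z, oneChart V G 1)).comp (.inl ℝ V V)) z :=
    ((contDiffAt_chartMul_left hz).differentiableAt (by simp)).hasFDerivAt.comp z
      (f := fun w => (w, oneChart V G 1)) (hasFDerivAt_prodMk_left z _)
  have h_id : (fun w => chartMul V G (w, oneChart V G 1)) =ᶠ[𝓝 z] id := by
    filter_upwards [(isOpen_oneChart_target V G).mem_nhds hz] with w hw using chartMul_one_right hw
  simpa using congrArg (· A) (h_chain.unique ((hasFDerivAt_id z).congr_of_eventuallyEq h_id))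

lemma fderiv_chartMul_right {w : V} (hw : w ∈ (oneChart V G).target) (B : V) :
    fderiv ℝ (chartMul V G) (oneChart V G 1, w) (0, B) = B := by
  have h_chain : HasFDerivAt (fun z => chartMul V G (oneChart V G 1, z))
      ((fderiv ℝ (chartMul V G) (oneChart V G 1, w)).comp (.inr ℝ V V)) w :=
    ((contDiffAt_chartMul_right hw).differentiableAt (by simp)).hasFDerivAt.comp w
      (hasFDerivAt_prodMk_right _ w)
  have h_id : (fun z => chartMul V G (oneChart V G 1, z)) =ᶠ[𝓝 w] id := by
    filter_upwards [(isOpen_oneChart_target V G).mem_nhds hw] with z hz using chartMul_one_left hz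
  simpa using congrArg (· B) (h_chain.unique ((hasFDerivAt_id w).congr_of_eventuallyEq h_id))

lemma fderiv_chartMul_one (A B : V) :
    fderiv ℝ (chartMul V G) (oneChart V G 1, oneChart V G 1) (A, B) = A + B := by
  have h_split : (A, B) = (A, (0 : V)) + ((0 : V), B) := by simp
  rw [h_split, map_add, fderiv_chartMul_left (oneChart_one_mem_target V G),
    fderiv_chartMul_right (oneChart_one_mem_target V G)]

lemma fderiv_fderiv_chartMul_left (A B : V) :
    fderiv ℝ (fderiv ℝ (chartMul V G)) (oneChart V G 1, oneChart V G 1) (A, 0) (B, 0) = 0 := by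
  have h_chain := hasFDerivAt_fderiv_comp_apply (κ := fun z => (z, oneChart V G 1))
    (contDiffAt_chartMul_one V G) (hasFDerivAt_prodMk_left (𝕜 := ℝ) _ _) (B, 0)
  have h_const : (fun z => fderiv ℝ (chartMul V G) (z, oneChart V G 1) (B, 0))
      =ᶠ[𝓝 (oneChart V G 1)] fun _ => B := by
    filter_upwards [oneChart_target_mem_nhds V G] with z hz using fderiv_chartMul_left hz B
  simpa using congrArg (· A)
    (h_chain.unique ((hasFDerivAt_const B _).congr_of_eventuallyEq h_const))

lemma fderiv_fderiv_chartMul_right (A B : V) :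
    fderiv ℝ (fderiv ℝ (chartMul V G)) (oneChart V G 1, oneChart V G 1) (0, A) (0, B) = 0 := by
  have h_chain := hasFDerivAt_fderiv_comp_apply (κ := fun z => (oneChart V G 1, z))
    (contDiffAt_chartMul_one V G) (hasFDerivAt_prodMk_right (𝕜 := ℝ) _ _) (0, B)
  have h_const : (fun z => fderiv ℝ (chartMul V G) (oneChart V G 1, z) (0, B))
      =ᶠ[𝓝 (oneChart V G 1)] fun _ => B := by
    filter_upwards [oneChart_target_mem_nhds V G] with z hz using fderiv_chartMul_right hz B
  simpa using congrArg (· A)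
    (h_chain.unique ((hasFDerivAt_const B _).congr_of_eventuallyEq h_const))

lemma fderiv_fderiv_chartMul (A A' B B' : V) :
    fderiv ℝ (fderiv ℝ (chartMul V G)) (oneChart V G 1, oneChart V G 1) (A, A') (B, B') =
      chartMulBilin V G A B' + chartMulBilin V G B A' := by
  have hsymm : fderiv ℝ (fderiv ℝ (chartMul V G)) (oneChart V G 1, oneChart V G 1) (0, A') (B, 0)
      = chartMulBilin V G B A' :=
    ((contDiffAt_chartMul_one V G).isSymmSndFDerivAt minSmoothness_two_le_infty).eq _ _
  have hA : (A, A') = (A, (0 : V)) + ((0 : V), A') := by simp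
  have hB : (B, B') = (B, (0 : V)) + ((0 : V), B') := by simp
  rw [hA, hB]
  simp only [map_add, add_apply, fderiv_fderiv_chartMul_left,
    fderiv_fderiv_chartMul_right, hsymm, zero_add, add_zero]
  exact add_comm _ _

lemma mixedPartial_oneChart_mul {K L : ℝ × ℝ → G} {p : ℝ × ℝ}
    (hK : ContMDiffAt 𝓘(ℝ, ℝ × ℝ) 𝓘(ℝ, V) ∞ K p) (hL : ContMDiffAt 𝓘(ℝ, ℝ × ℝ) 𝓘(ℝ, V) ∞ L p)
    (hKp : K p = 1) (hLp : L p = 1) :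
    mixedPartial (fun q => oneChart V G (K q * L q)) p =
      mixedPartial (fun q => oneChart V G (K q)) p + mixedPartial (fun q => oneChart V G (L q)) p
        + (chartMulBilin V G (fderiv ℝ (fun q => oneChart V G (K q)) p (1, 0))
            (fderiv ℝ (fun q => oneChart V G (L q)) p (0, 1))
          + chartMulBilin V G (fderiv ℝ (fun q => oneChart V G (K q)) p (0, 1))
            (fderiv ℝ (fun q => oneChart V G (L q)) p (1, 0))) := by
  set k := fun q => oneChart V G (K q)
  set l := fun q => oneChart V G (L q)
  have hk : ContDiffAt ℝ ∞ k p :=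
    contDiffAt_oneChart_comp hK (by rw [hKp]; exact one_mem_oneChart_source V G)
  have hl : ContDiffAt ℝ ∞ l p :=
    contDiffAt_oneChart_comp hL (by rw [hLp]; exact one_mem_oneChart_source V G)
  have h_chart : (fun q => oneChart V G (K q * L q)) =ᶠ[𝓝 p] fun q => chartMul V G (k q, l q) := by
    have h_source := oneChart_source_mem_nhds V G
    filter_upwards [hK.continuousAt.preimage_mem_nhds (by rwa [hKp]),
      hL.continuousAt.preimage_mem_nhds (by rwa [hLp])] with q hKq hLq
    exact oneChart_mul_eq_chartMul hKq hLq
  have hp : (k p, l p) = (oneChart V G 1, oneChart V G 1) := by simp only [k, l, hKp, hLp]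
  have h_fderiv : ∀ v, fderiv ℝ (fun q => (k q, l q)) p v = (fderiv ℝ k p v, fderiv ℝ l p v) :=
    fun v => by
      rw [(hk.differentiableAt (by simp)).fderiv_prodMk (hl.differentiableAt (by simp))]
      rfl
  rw [mixedPartial_congr h_chart,
    mixedPartial_comp (by rw [hp]; exact contDiffAt_chartMul_one V G) (hk.prodMk hl), hp,
    h_fderiv, h_fderiv, mixedPartial_prodMk hk hl, fderiv_fderiv_chartMul, fderiv_chartMul_one,
    add_comm]

end ChartMul

section Bracket

variable {V : Type*} [NormedAddCommGroup V] [NormedSpace ℝ V]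
  {G : Type*} [TopologicalSpace G] [ChartedSpace V G] [Group G] [LieGroup 𝓘(ℝ, V) ∞ G]

lemma mfderiv_oneChart_mulInvariantVectorField {z : V} (hz : z ∈ (oneChart V G).target)
    (A : GroupLieAlgebra 𝓘(ℝ, V) G) :
    (mfderiv 𝓘(ℝ, V) 𝓘(ℝ, V) (oneChart V G) ((oneChart V G).symm z)
        (mulInvariantVectorField A ((oneChart V G).symm z)) : V) =
      fderiv ℝ (chartMul V G) (z, oneChart V G 1) ((0 : V), (A : V)) := by
  set g : G := (oneChart V G).symm z
  have hg : g * 1 ∈ (oneChart V G).source := by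
    rw [mul_one]
    exact (oneChart V G).map_target hz
  have hmul : MDifferentiableAt 𝓘(ℝ, V) 𝓘(ℝ, V) (g * ·) (1 : G) :=
    contMDiff_mul_left.mdifferentiable (n := ∞) (by simp) 1
  have hchart : MDifferentiableAt 𝓘(ℝ, V) 𝓘(ℝ, V) (oneChart V G) (g * 1) :=
    (contMDiffAt_oneChart hg).mdifferentiableAt (by simp)
  have h_written : (mfderiv 𝓘(ℝ, V) 𝓘(ℝ, V) (fun k => oneChart V G (g * k)) (1 : G) A : V) =
      fderiv ℝ (fun w => chartMul V G (z, w)) (oneChart V G 1) A := by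
    have h : MDifferentiableAt 𝓘(ℝ, V) 𝓘(ℝ, V) (fun k => oneChart V G (g * k)) (1 : G) :=
      hchart.comp (1 : G) hmul
    rw [h.mfderiv]
    simp [writtenInExtChartAt, Function.comp_def]
    rfl
  have h_partial : HasFDerivAt (fun w => chartMul V G (z, w))
      ((fderiv ℝ (chartMul V G) (z, oneChart V G 1)).comp (.inr ℝ V V)) (oneChart V G 1) :=
    ((contDiffAt_chartMul_left hz).differentiableAt (by simp)).hasFDerivAt.comp _
      (f := fun w => (z, w)) (hasFDerivAt_prodMk_right z _)
  have h_base : ∀ k : G, k = g → ∀ w : V, (mfderiv 𝓘(ℝ, V) 𝓘(ℝ, V) (oneChart V G) g w : V) =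
      (mfderiv 𝓘(ℝ, V) 𝓘(ℝ, V) (oneChart V G) k w : V) := by
    rintro _ rfl w
    rfl
  rw [h_partial.fderiv] at h_written
  refine (h_base (g * 1) (mul_one g) _).trans (Eq.trans ?_ h_written)
  exact congrArg (fun L => (L A : V)) (mfderiv_comp (1 : G) hchart hmul).symm

lemma mpullbackWithin_mulInvariantVectorField {z : V} (hz : z ∈ (oneChart V G).target)
    (A : GroupLieAlgebra 𝓘(ℝ, V) G) :
    (VectorField.mpullbackWithin 𝓘(ℝ, V) 𝓘(ℝ, V) (oneChart V G).symm
      (mulInvariantVectorField A) (range 𝓘(ℝ, V)) z : V) =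
      fderiv ℝ (chartMul V G) (z, oneChart V G 1) ((0 : V), (A : V)) := by
  have : IsManifold 𝓘(ℝ, V) 1 G := IsManifold.of_le (n := ∞) (by simp)
  have h_inverse : (mfderivWithin 𝓘(ℝ, V) 𝓘(ℝ, V) (extChartAt 𝓘(ℝ, V) (1 : G)).symm
      (range 𝓘(ℝ, V)) z).inverse = mfderiv 𝓘(ℝ, V) 𝓘(ℝ, V) (extChartAt 𝓘(ℝ, V) (1 : G))
        ((extChartAt 𝓘(ℝ, V) (1 : G)).symm z) :=
    ContinuousLinearMap.inverse_eq
      (mfderivWithin_extChartAt_symm_comp_mfderiv_extChartAt hz)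
      (mfderiv_extChartAt_comp_mfderivWithin_extChartAt_symm hz)
  rw [← mfderiv_oneChart_mulInvariantVectorField hz A]
  exact congrArg (fun L : V →L[ℝ] V => L (mulInvariantVectorField A ((oneChart V G).symm z)))
    h_inverse

lemma lieBracketWithin_eq_bracketCLM {A B : V} {X Y : V → V}
    (hX : X =ᶠ[𝓝 (oneChart V G 1)]
      fun z => fderiv ℝ (chartMul V G) (z, oneChart V G 1) ((0 : V), A))
    (hY : Y =ᶠ[𝓝 (oneChart V G 1)]
      fun z => fderiv ℝ (chartMul V G) (z, oneChart V G 1) ((0 : V), B)) :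
    VectorField.lieBracketWithin ℝ X Y univ (oneChart V G 1) =
      bracketCLM V G A B := by
  have h_fderiv : ∀ C D : V, fderiv ℝ (fun z => fderiv ℝ (chartMul V G) (z, oneChart V G 1) (0, C))
      (oneChart V G 1) D = chartMulBilin V G D C := fun C D => by
    rw [(hasFDerivAt_fderiv_comp_apply (κ := fun z => (z, oneChart V G 1))
      (contDiffAt_chartMul_one V G) (hasFDerivAt_prodMk_left (𝕜 := ℝ) _ _) (0, C)).fderiv]
    rfl
  have h_one : ∀ C : V, fderiv ℝ (chartMul V G) (oneChart V G 1, oneChart V G 1) (0, C) = C :=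
    fderiv_chartMul_right (oneChart_one_mem_target V G)
  rw [VectorField.lieBracketWithin_univ, VectorField.lieBracket, hX.fderiv_eq, hY.fderiv_eq,
    hX.eq_of_nhds, hY.eq_of_nhds, h_fderiv, h_fderiv, h_one, h_one]
  rfl

theorem bracket_eq_bracketCLM (A B : GroupLieAlgebra 𝓘(ℝ, V) G) :
    (⁅A, B⁆ : GroupLieAlgebra 𝓘(ℝ, V) G) =
      (bracketCLM V G A B : V) := by
  have : IsManifold 𝓘(ℝ, V) 1 G := IsManifold.of_le (n := ∞) (by simp)
  have h_field : ∀ C : GroupLieAlgebra 𝓘(ℝ, V) G,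
      (VectorField.mpullbackWithin 𝓘(ℝ, V) 𝓘(ℝ, V) (extChartAt 𝓘(ℝ, V) (1 : G)).symm
        (mulInvariantVectorField C) (range 𝓘(ℝ, V)) : V → V) =ᶠ[𝓝 (oneChart V G 1)]
        fun z => fderiv ℝ (chartMul V G) (z, oneChart V G 1) ((0 : V), (C : V)) := fun C => by
    filter_upwards [oneChart_target_mem_nhds V G] with z hz
    exact mpullbackWithin_mulInvariantVectorField hz C
  have h_inverse : ∀ w : V, (mfderiv 𝓘(ℝ, V) 𝓘(ℝ, V) (extChartAt 𝓘(ℝ, V) (1 : G)) 1 :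
      V →L[ℝ] V).inverse w = w := fun w => by
    have h : (mfderiv 𝓘(ℝ, V) 𝓘(ℝ, V) (extChartAt 𝓘(ℝ, V) (1 : G)) 1 : V →L[ℝ] V) =
      ContinuousLinearMap.id ℝ V := mfderiv_extChartAt_self
    exact (congrArg (fun L : V →L[ℝ] V => L.inverse w) h).trans (by simp)
  have h_univ : (extChartAt 𝓘(ℝ, V) (1 : G)).symm ⁻¹' univ ∩ range 𝓘(ℝ, V) = univ := by simp
  rw [GroupLieAlgebra.bracket_def, VectorField.mlieBracket, VectorField.mlieBracketWithin_apply,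
    h_univ]
  exact (h_inverse _).trans
    (lieBracketWithin_eq_bracketCLM (V := V) (G := G) (h_field A) (h_field B))

end Bracket

section Velocity

variable {V : Type*} [NormedAddCommGroup V] [NormedSpace ℝ V]
  {G : Type*} [TopologicalSpace G] [ChartedSpace V G] [Group G]

lemma velocity_congr {c d : ℝ → G} {s : ℝ} (h : c =ᶠ[𝓝 s] d) :
    velocity (V := V) c s = velocity (V := V) d s :=
  (h.fun_comp (oneChart V G)).deriv_eq

lemma velocity_const (k : G) (s : ℝ) : velocity (V := V) (fun _ => k) s = 0 := by
  simp [velocity]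

variable (V) in
/-- The right logarithmic derivative `c' c⁻¹` of a curve in a Lie group, as a vector of the model
space `V` rather than of the Lie algebra. -/
def rlog (c : ℝ → G) (s : ℝ) : V :=
  velocity (V := V) (fun τ => c τ * (c s)⁻¹) s

variable (V) in
/-- The left logarithmic derivative `c⁻¹ c'` of a curve in a Lie group, as a vector of the model
space `V` rather than of the Lie algebra. -/
def llog (c : ℝ → G) (s : ℝ) : V :=
  velocity (V := V) (fun τ => (c s)⁻¹ * c τ) s

lemma rlog_of_eq_one {c : ℝ → G} {s : ℝ} (h : c s = 1) : rlog V c s = velocity (V := V) c s := by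
  simp [rlog, h]

lemma rlog_const (k : G) (s : ℝ) : rlog V (fun _ => k) s = 0 :=
  velocity_const _ _

lemma rlog_mul_const (c : ℝ → G) (k : G) (s : ℝ) : rlog V (fun τ => c τ * k) s = rlog V c s := by
  simp [rlog, mul_assoc]

lemma rlog_congr {c d : ℝ → G} {s : ℝ} (h : c =ᶠ[𝓝 s] d) : rlog V c s = rlog V d s := by
  refine velocity_congr ?_
  rw [h.eq_of_nhds]
  filter_upwards [h] with τ hτ
  rw [hτ]

variable [LieGroup 𝓘(ℝ, V) ∞ G]

lemma hasDerivAt_oneChart_velocity {c : ℝ → G} {s : ℝ}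
    (hc : ContMDiffAt 𝓘(ℝ, ℝ) 𝓘(ℝ, V) ∞ c s) (hs : c s = 1) :
    HasDerivAt (fun τ => oneChart V G (c τ)) (velocity (V := V) c s) s :=
  ((contDiffAt_oneChart_comp hc (hs ▸ one_mem_oneChart_source V G)).differentiableAt
    (by simp)).hasDerivAt

lemma velocity_mul {c d : ℝ → G} {s : ℝ} (hc : ContMDiffAt 𝓘(ℝ, ℝ) 𝓘(ℝ, V) ∞ c s)
    (hd : ContMDiffAt 𝓘(ℝ, ℝ) 𝓘(ℝ, V) ∞ d s) (hcs : c s = 1) (hds : d s = 1) :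
    velocity (V := V) (fun τ => c τ * d τ) s =
      velocity (V := V) c s + velocity (V := V) d s := by
  have h_chartMul : HasFDerivAt (chartMul V G)
      (fderiv ℝ (chartMul V G) (oneChart V G 1, oneChart V G 1))
      (oneChart V G (c s), oneChart V G (d s)) := by
    rw [hcs, hds]
    exact ((contDiffAt_chartMul_one V G).differentiableAt (by simp)).hasFDerivAt
  have h_chain := h_chartMul.comp_hasDerivAt s
    ((hasDerivAt_oneChart_velocity hc hcs).prodMk (hasDerivAt_oneChart_velocity hd hds))
  rw [fderiv_chartMul_one] at h_chain
  refine (h_chain.congr_of_eventuallyEq ?_).deriv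
  have h_source := oneChart_source_mem_nhds V G
  filter_upwards [hc.continuousAt.preimage_mem_nhds (by rwa [hcs]),
    hd.continuousAt.preimage_mem_nhds (by rwa [hds])] with τ hcτ hdτ
  exact oneChart_mul_eq_chartMul hcτ hdτ

lemma velocity_inv {c : ℝ → G} {s : ℝ} (hc : ContMDiffAt 𝓘(ℝ, ℝ) 𝓘(ℝ, V) ∞ c s)
    (hcs : c s = 1) : velocity (V := V) (fun τ => (c τ)⁻¹) s = -velocity (V := V) c s := by
  have h := velocity_mul hc hc.inv hcs (by simp [hcs])
  simp only [mul_inv_cancel, velocity_const] at h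
  exact (neg_eq_of_add_eq_zero_right h.symm).symm

variable (V) in
/-- The adjoint action of `k : G`, as an endomorphism of the model space. -/
def adjoint (k : G) : V →L[ℝ] V :=
  mfderiv 𝓘(ℝ, V) 𝓘(ℝ, V) (fun l : G => k * l * k⁻¹) 1

lemma contMDiff_conj (k : G) :
    ContMDiff 𝓘(ℝ, V) 𝓘(ℝ, V) ∞ (fun l : G => k * l * k⁻¹) :=
  (contMDiff_const.mul contMDiff_id).mul contMDiff_const

lemma velocity_conj (k : G) {c : ℝ → G} {s : ℝ} (hc : ContMDiffAt 𝓘(ℝ, ℝ) 𝓘(ℝ, V) ∞ c s)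
    (hcs : c s = 1) :
    velocity (V := V) (fun τ => k * c τ * k⁻¹) s = adjoint V k (velocity (V := V) c s) :=
  velocity_comp ((contMDiff_conj k).mdifferentiable (by simp) 1) (by simp)
    (hc.mdifferentiableAt (by simp)) hcs

lemma exists_contMDiffAt_velocity_eq {E : Type*} [NormedAddCommGroup E] [NormedSpace ℝ E]
    {Z : E → V} (hZ : ContDiff ℝ ∞ Z) :
    ∃ C : ℝ × E → G, ∀ q, ContMDiffAt 𝓘(ℝ, ℝ × E) 𝓘(ℝ, V) ∞ C (0, q) ∧ C (0, q) = 1 ∧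
      velocity (V := V) (fun τ => C (τ, q)) 0 = Z q := by
  let γ : ℝ × E → V := fun r => oneChart V G 1 + r.1 • Z r.2
  have hγ : ContDiff ℝ ∞ γ := by fun_prop
  have hγ_zero (q : E) : γ (0, q) = oneChart V G 1 := by simp [γ]
  have hγ_deriv (q : E) : HasDerivAt (fun τ => γ (τ, q)) (Z q) 0 := by
    have h := ((hasDerivAt_id (0 : ℝ)).smul_const (Z q)).const_add (oneChart V G 1)
    rwa [one_smul] at h
  have hγ_slice (q : E) : ContinuousAt (fun τ => γ (τ, q)) 0 := (hγ_deriv q).continuousAt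
  refine ⟨fun r => (oneChart V G).symm (γ r), fun q => ⟨?_, by simp [hγ_zero], ?_⟩⟩
  · exact ContMDiffAt.comp (0, q)
      (contMDiffAt_oneChart_symm (hγ_zero q ▸ oneChart_one_mem_target V G))
      hγ.contDiffAt.contMDiffAt
  · refine ((hγ_deriv q).congr_of_eventuallyEq ?_).deriv
    filter_upwards [(hγ_slice q).preimage_mem_nhds
      (by rw [hγ_zero]; exact oneChart_target_mem_nhds V G)] with τ hτ
    exact (oneChart V G).right_inv hτ

lemma exists_velocity_eq (A : V) : ∃ c : ℝ → G,
    ContMDiffAt 𝓘(ℝ, ℝ) 𝓘(ℝ, V) ∞ c 0 ∧ c 0 = 1 ∧ velocity (V := V) c 0 = A := by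
  obtain ⟨C, hC⟩ := exists_contMDiffAt_velocity_eq (G := G) (contDiff_const (c := A) (E := ℝ))
  exact ⟨fun τ => C (τ, 0), contMDiffAt_slice_left (hC 0).1, (hC 0).2⟩

lemma adjoint_mul (k l : G) (A : V) : adjoint V (k * l) A = adjoint V k (adjoint V l A) := by
  obtain ⟨c, hc, hc0, rfl⟩ := exists_velocity_eq (G := G) A
  have h_conj : ContMDiffAt 𝓘(ℝ, ℝ) 𝓘(ℝ, V) ∞ (fun τ => l * c τ * l⁻¹) 0 :=
    (contMDiffAt_const.mul hc).mul contMDiffAt_const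
  rw [← velocity_conj _ hc hc0, ← velocity_conj _ hc hc0,
    ← velocity_conj _ h_conj (by simp [hc0])]
  simp [mul_assoc]

@[simp]
lemma adjoint_one (A : V) : adjoint V (1 : G) A = A := by
  obtain ⟨c, hc, hc0, rfl⟩ := exists_velocity_eq (G := G) A
  rw [← velocity_conj _ hc hc0]
  simp

lemma adjoint_injective (k : G) : Function.Injective (adjoint V k) :=
  Function.LeftInverse.injective (g := adjoint V k⁻¹) fun A => by
    rw [← adjoint_mul, inv_mul_cancel, adjoint_one]

lemma rlog_mul {c d : ℝ → G} {s : ℝ} (hc : ContMDiffAt 𝓘(ℝ, ℝ) 𝓘(ℝ, V) ∞ c s)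
    (hd : ContMDiffAt 𝓘(ℝ, ℝ) 𝓘(ℝ, V) ∞ d s) :
    rlog V (fun τ => c τ * d τ) s = rlog V c s + adjoint V (c s) (rlog V d s) := by
  have hc' : ContMDiffAt 𝓘(ℝ, ℝ) 𝓘(ℝ, V) ∞ (fun τ => c τ * (c s)⁻¹) s := hc.mul contMDiffAt_const
  have hd' : ContMDiffAt 𝓘(ℝ, ℝ) 𝓘(ℝ, V) ∞ (fun τ => d τ * (d s)⁻¹) s := hd.mul contMDiffAt_const
  have h_conj : ContMDiffAt 𝓘(ℝ, ℝ) 𝓘(ℝ, V) ∞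
      (fun τ => c s * (d τ * (d s)⁻¹) * (c s)⁻¹) s :=
    (contMDiffAt_const.mul hd').mul contMDiffAt_const
  rw [rlog, rlog, rlog, ← velocity_conj _ hd' (by simp),
    ← velocity_mul hc' h_conj (by simp) (by simp)]
  congr 1
  ext τ
  group

lemma rlog_inv {c : ℝ → G} {s : ℝ} (hc : ContMDiffAt 𝓘(ℝ, ℝ) 𝓘(ℝ, V) ∞ c s) :
    rlog V (fun τ => (c τ)⁻¹) s = -llog V c s := by
  have h_translate : ContMDiffAt 𝓘(ℝ, ℝ) 𝓘(ℝ, V) ∞ (fun τ => (c s)⁻¹ * c τ) s :=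
    contMDiffAt_const.mul hc
  rw [llog, ← velocity_inv h_translate (by simp), rlog]
  congr 1
  ext τ
  group

variable (V G) in
/-- The derivative at `1` of the right translation by the point with coordinate `z`, in the
preferred chart at `1`; it turns right logarithmic derivatives into derivatives of coordinates. -/
def rightTranslationDeriv (z : V) : V →L[ℝ] V :=
  (fderiv ℝ (chartMul V G) (oneChart V G 1, z)).comp (.inl ℝ V V)

lemma contDiffAt_rightTranslationDeriv {z : V} (hz : z ∈ (oneChart V G).target) :
    ContDiffAt ℝ ∞ (rightTranslationDeriv V G) z :=
  ContDiffAt.clm_comp (ContDiffAt.comp z (f := fun z : V => (oneChart V G 1, z))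
    ((contDiffAt_chartMul_right hz).fderiv_right (m := ∞) (by simp)) (by fun_prop))
    contDiffAt_const

lemma hasFDerivAt_chartMul_one_left {z : V} (hz : z ∈ (oneChart V G).target) :
    HasFDerivAt (fun w => chartMul V G (w, z)) (rightTranslationDeriv V G z) (oneChart V G 1) :=
  ((contDiffAt_chartMul_right hz).differentiableAt (by simp)).hasFDerivAt.comp _
    (f := fun w => (w, z)) (hasFDerivAt_prodMk_left _ _)

lemma hasDerivAt_oneChart_rlog {c : ℝ → G} {s : ℝ} (hc : ContMDiffAt 𝓘(ℝ, ℝ) 𝓘(ℝ, V) ∞ c s)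
    (hs : c s ∈ (oneChart V G).source) :
    HasDerivAt (fun τ => oneChart V G (c τ))
      (rightTranslationDeriv V G (oneChart V G (c s)) (rlog V c s)) s := by
  have h_translate : ContMDiffAt 𝓘(ℝ, ℝ) 𝓘(ℝ, V) ∞ (fun τ => c τ * (c s)⁻¹) s :=
    hc.mul contMDiffAt_const
  have h_chartMul := hasFDerivAt_chartMul_one_left ((oneChart V G).map_source hs)
  rw [← mul_inv_cancel (c s)] at h_chartMul
  refine (h_chartMul.comp_hasDerivAt s
    (hasDerivAt_oneChart_velocity h_translate (by simp))).congr_of_eventuallyEq ?_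
  have h_source : (oneChart V G).source ∈ 𝓝 (c s * (c s)⁻¹) :=
    mul_inv_cancel (c s) ▸ oneChart_source_mem_nhds V G
  filter_upwards [h_translate.continuousAt.preimage_mem_nhds h_source] with τ hτ
  change oneChart V G (c τ) = chartMul V G (oneChart V G (c τ * (c s)⁻¹), oneChart V G (c s))
  rw [← oneChart_mul_eq_chartMul hτ hs, inv_mul_cancel_right]

lemma rightTranslationDeriv_injective {z : V} (hz : z ∈ (oneChart V G).target) :
    Function.Injective (rightTranslationDeriv V G z) := by
  let k : G := (oneChart V G).symm z
  -- `w ↦ chartMul (w, z)` is right translation by `k`; `ν` is right translation by `k⁻¹`.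
  let ν : V → V := fun w => oneChart V G ((oneChart V G).symm w * k⁻¹)
  have hν : DifferentiableAt ℝ ν z :=
    (contDiffAt_oneChart_comp ((contMDiffAt_oneChart_symm hz).mul contMDiffAt_const)
      (by simpa [k] using one_mem_oneChart_source V G)).differentiableAt (by simp)
  have h_comp : HasFDerivAt (fun w => ν (chartMul V G (w, z)))
      ((fderiv ℝ ν z).comp (rightTranslationDeriv V G z)) (oneChart V G 1) :=
    HasFDerivAt.comp (g := ν) _ (by rw [chartMul_one_left hz]; exact hν.hasFDerivAt)
      (hasFDerivAt_chartMul_one_left hz)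
  have h_undo : (fun w => ν (chartMul V G (w, z))) =ᶠ[𝓝 (oneChart V G 1)] id := by
    have h_cont : ContinuousAt (fun w => (oneChart V G).symm w * k) (oneChart V G 1) :=
      ((contMDiffAt_oneChart_symm (oneChart_one_mem_target V G)).mul
        contMDiffAt_const).continuousAt
    filter_upwards [oneChart_target_mem_nhds V G, h_cont.preimage_mem_nhds
      ((isOpen_oneChart_source V G).mem_nhds
        (by simpa [k] using (oneChart V G).map_target hz))] with w hw hwk
    change oneChart V G ((oneChart V G).symm
      (oneChart V G ((oneChart V G).symm w * (oneChart V G).symm z)) * k⁻¹) = w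
    rw [(oneChart V G).left_inv hwk, mul_inv_cancel_right, (oneChart V G).right_inv hw]
  have h_id := h_comp.unique ((hasFDerivAt_id _).congr_of_eventuallyEq h_undo)
  exact Function.LeftInverse.injective (g := fderiv ℝ ν z) fun A =>
    congrArg (fun L : V →L[ℝ] V => L A) h_id

lemma eventually_eq_of_rlog_eq_zero {c : ℝ → G} {s : ℝ}
    (hc : ∀ᶠ τ in 𝓝 s, ContMDiffAt 𝓘(ℝ, ℝ) 𝓘(ℝ, V) ∞ c τ) (h0 : ∀ᶠ τ in 𝓝 s, rlog V c τ = 0) :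
    ∀ᶠ τ in 𝓝 s, c τ = c s := by
  let d : ℝ → G := fun τ => c τ * (c s)⁻¹
  have hds : d s = 1 := mul_inv_cancel _
  have hd : ∀ᶠ τ in 𝓝 s, ContMDiffAt 𝓘(ℝ, ℝ) 𝓘(ℝ, V) ∞ d τ :=
    hc.mono fun τ hτ => hτ.mul contMDiffAt_const
  have h_source : ∀ᶠ τ in 𝓝 s, d τ ∈ (oneChart V G).source :=
    hd.self_of_nhds.continuousAt.preimage_mem_nhds (hds ▸ oneChart_source_mem_nhds V G)
  obtain ⟨ε, hε, h_ball⟩ := Metric.eventually_nhds_iff_ball.1 (hd.and (h0.and h_source))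
  have h_deriv : ∀ τ ∈ Metric.ball s ε, HasDerivAt (fun σ => oneChart V G (d σ)) 0 τ := by
    intro τ hτ
    obtain ⟨hdτ, hcτ, hτ_source⟩ := h_ball τ hτ
    have h := hasDerivAt_oneChart_rlog hdτ hτ_source
    rwa [(rlog_mul_const c _ τ).trans hcτ, map_zero] at h
  have hs := Metric.mem_ball_self (x := s) hε
  filter_upwards [Metric.ball_mem_nhds s hε] with τ hτ
  have h_const : oneChart V G (d τ) = oneChart V G (d s) :=
    Metric.isOpen_ball.is_const_of_deriv_eq_zero (convex_ball s ε).isPreconnected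
      (fun σ hσ => (h_deriv σ hσ).differentiableAt.differentiableWithinAt)
      (fun σ hσ => (h_deriv σ hσ).deriv) hτ hs
  exact mul_inv_eq_one.1
    (((oneChart V G).injOn (h_ball τ hτ).2.2 (h_ball s hs).2.2 h_const).trans hds)

theorem eqOn_of_rlog_eq {c d : ℝ → G} {S : Set ℝ} (hS : IsOpen S) (hS' : IsPreconnected S)
    (hc : ∀ s ∈ S, ContMDiffAt 𝓘(ℝ, ℝ) 𝓘(ℝ, V) ∞ c s)
    (hd : ∀ s ∈ S, ContMDiffAt 𝓘(ℝ, ℝ) 𝓘(ℝ, V) ∞ d s)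
    (h : ∀ s ∈ S, rlog V c s = rlog V d s) {s₀ : ℝ} (hs₀ : s₀ ∈ S) (h₀ : c s₀ = d s₀) :
    EqOn c d S := by
  let w : ℝ → G := fun s => (c s)⁻¹ * d s
  have hw : ∀ s ∈ S, ContMDiffAt 𝓘(ℝ, ℝ) 𝓘(ℝ, V) ∞ w s := fun s hs => (hc s hs).inv.mul (hd s hs)
  have h_rlog : ∀ s ∈ S, rlog V w s = 0 := by
    intro s hs
    have h_mul := rlog_mul (hc s hs) (hw s hs)
    have h_cancel : (fun τ => c τ * w τ) = d := by ext τ; simp [w]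
    rw [h_cancel, ← h s hs, left_eq_add] at h_mul
    exact adjoint_injective (c s) (h_mul.trans (map_zero _).symm)
  have h_locallyConst : ∀ s ∈ S, ∀ᶠ τ in 𝓝 s, w s = w τ := fun s hs =>
    (eventually_eq_of_rlog_eq_zero (V := V) (eventually_of_mem (hS.mem_nhds hs) hw)
      (eventually_of_mem (hS.mem_nhds hs) h_rlog)).mono fun _ => Eq.symm
  intro s hs
  have h_const : w s₀ = w s := hS'.induction₂ (fun σ τ => w σ = w τ)
    (fun σ hσ => nhdsWithin_le_nhds (h_locallyConst σ hσ)) (fun _ _ _ _ _ _ => Eq.trans)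
    (fun _ _ _ _ => Eq.symm) hs₀ hs
  exact inv_mul_eq_one.1 (h_const.symm.trans (inv_mul_eq_one.2 h₀))

theorem eq_of_rlog_eq {c d : ℝ → G} (hc : ContMDiff 𝓘(ℝ, ℝ) 𝓘(ℝ, V) ∞ c)
    (hd : ContMDiff 𝓘(ℝ, ℝ) 𝓘(ℝ, V) ∞ d) (h : ∀ s, rlog V c s = rlog V d s) {s₀ : ℝ}
    (h₀ : c s₀ = d s₀) : c = d :=
  funext fun s => eqOn_of_rlog_eq isOpen_univ isPreconnected_univ (fun s _ => hc s)
    (fun s _ => hd s) (fun s _ => h s) (mem_univ s₀) h₀ (mem_univ s)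

theorem eq_of_llog_eq {c d : ℝ → G} (hc : ContMDiff 𝓘(ℝ, ℝ) 𝓘(ℝ, V) ∞ c)
    (hd : ContMDiff 𝓘(ℝ, ℝ) 𝓘(ℝ, V) ∞ d) (h : ∀ s, llog V c s = llog V d s) {s₀ : ℝ}
    (h₀ : c s₀ = d s₀) : c = d :=
  inv_injective <| eq_of_rlog_eq hc.inv hd.inv
    (fun s => (rlog_inv (hc s)).trans ((congrArg Neg.neg (h s)).trans (rlog_inv (hd s)).symm))
    (s₀ := s₀) (congrArg Inv.inv h₀)

lemma contDiffAt_velocity {E : Type*} [NormedAddCommGroup E] [NormedSpace ℝ E] {C : ℝ × E → G}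
    {σ : E → ℝ} {p : E} (hC : ContMDiffAt 𝓘(ℝ, ℝ × E) 𝓘(ℝ, V) ∞ C (σ p, p))
    (hσ : ContDiffAt ℝ ∞ σ p) (h_one : C (σ p, p) = 1) :
    ContDiffAt ℝ ∞ (fun q => velocity (V := V) (fun τ => C (τ, q)) (σ q)) p := by
  have h_chart : ContDiffAt ℝ ∞ (fun r => oneChart V G (C r)) (σ p, p) :=
    contDiffAt_oneChart_comp hC (h_one ▸ one_mem_oneChart_source V G)
  have h_graph : ContDiffAt ℝ ∞ (fun q => (σ q, q)) p := hσ.prodMk contDiffAt_id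
  have h_fderiv : ContDiffAt ℝ ∞
      (fun q => fderiv ℝ (fun r => oneChart V G (C r)) (σ q, q) (1, 0)) p :=
    (ContDiffAt.comp p (f := fun q => (σ q, q)) (h_chart.fderiv_right (m := ∞) (by simp))
      h_graph).clm_apply contDiffAt_const
  refine h_fderiv.congr_of_eventuallyEq ?_
  filter_upwards [h_graph.continuousAt.eventually (eventually_differentiableAt h_chart)] with q hq
  exact (hq.hasFDerivAt.comp_hasDerivAt (σ q)
    ((hasDerivAt_id (σ q)).prodMk (hasDerivAt_const (σ q) q))).deriv

end Velocity

/-! ### Existence of curves with prescribed logarithmic derivative -/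

lemma exists_contDiff_eventuallyEq {E F : Type*} [NormedAddCommGroup E] [NormedSpace ℝ E]
    [FiniteDimensional ℝ E] [NormedAddCommGroup F] [NormedSpace ℝ F] {A : E → F} {z₀ : E}
    (hA : ∀ᶠ z in 𝓝 z₀, ContDiffAt ℝ ∞ A z) :
    ∃ A' : E → F, ContDiff ℝ ∞ A' ∧ A' =ᶠ[𝓝 z₀] A := by
  obtain ⟨r, hr, h_ball⟩ := Metric.nhds_basis_closedBall.mem_iff.1 hA
  let χ : ContDiffBump z₀ := ⟨r / 2, r, half_pos hr, half_lt_self hr⟩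
  refine ⟨fun z => χ z • A z, contDiff_iff_contDiffAt.2 fun z => ?_, ?_⟩
  · by_cases hz : z ∈ tsupport χ
    · rw [χ.tsupport_eq] at hz
      exact χ.contDiff.contDiffAt.smul (h_ball hz)
    · refine contDiffAt_const (c := 0) |>.congr_of_eventuallyEq ?_
      filter_upwards [notMem_tsupport_iff_eventuallyEq.1 hz] with w hw
      simp [hw]
  · filter_upwards [χ.eventuallyEq_one] with z hz
    simp [hz]

section Existence

variable {V : Type*} [NormedAddCommGroup V] [NormedSpace ℝ V]
  {G : Type*} [TopologicalSpace G] [ChartedSpace V G]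

variable [Group G]

/-- The family of curves `w (·, y)` solves `∂ₓw w⁻¹ = α` at `p`, and depends smoothly on the
parameter `y` there. -/
structure HasRlogAt (α : ℝ × ℝ → V) (w : ℝ × ℝ → G) (p : ℝ × ℝ) : Prop where
  contMDiffAt : ContMDiffAt 𝓘(ℝ, ℝ × ℝ) 𝓘(ℝ, V) ∞ w p
  rlog_eq : rlog V (fun x => w (x, p.2)) p.1 = α p

lemma HasRlogAt.congr {α : ℝ × ℝ → V} {w w' : ℝ × ℝ → G} {p : ℝ × ℝ}
    (hw : HasRlogAt α w p) (h : w' =ᶠ[𝓝 p] w) : HasRlogAt α w' p where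
  contMDiffAt := hw.contMDiffAt.congr_of_eventuallyEq h
  rlog_eq := by
    have h_slice : ContinuousAt (fun x : ℝ => (x, p.2)) p.1 := by fun_prop
    have h_line : (fun x => w' (x, p.2)) =ᶠ[𝓝 p.1] fun x => w (x, p.2) := h_slice.eventually h
    exact (rlog_congr h_line).trans hw.rlog_eq

variable [LieGroup 𝓘(ℝ, V) ∞ G]

lemma HasRlogAt.mul_right {α : ℝ × ℝ → V} {w : ℝ × ℝ → G} {p : ℝ × ℝ} (hw : HasRlogAt α w p)
    {k : ℝ → G} (hk : ContMDiffAt 𝓘(ℝ, ℝ) 𝓘(ℝ, V) ∞ k p.2) :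
    HasRlogAt α (fun q => w q * k q.2) p where
  contMDiffAt := hw.contMDiffAt.mul (hk.comp p contDiff_snd.contMDiff.contMDiffAt)
  rlog_eq := (rlog_mul_const (fun x => w (x, p.2)) (k p.2) p.1).trans hw.rlog_eq

lemma eq_of_hasRlogAt {α : ℝ × ℝ → V} {w w' : ℝ × ℝ → G} {I I' J J' : Set ℝ}
    (hI : IsOpen I) (hI_conn : I.OrdConnected) (hI' : IsOpen I') (hI'_conn : I'.OrdConnected)
    (hw : ∀ p ∈ I ×ˢ J, HasRlogAt α w p) (hw' : ∀ p ∈ I' ×ˢ J', HasRlogAt α w' p)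
    {x₀ x y : ℝ} (hx₀ : x₀ ∈ I ∩ I') (hx : x ∈ I ∩ I') (hy : y ∈ J ∩ J')
    (h : w (x₀, y) = w' (x₀, y)) : w (x, y) = w' (x, y) := by
  have h_line : ∀ s ∈ I ∩ I', HasRlogAt α w (s, y) ∧ HasRlogAt α w' (s, y) := fun s hs =>
    ⟨hw _ ⟨hs.1, hy.1⟩, hw' _ ⟨hs.2, hy.2⟩⟩
  exact eqOn_of_rlog_eq (V := V) (c := fun x => w (x, y)) (d := fun x => w' (x, y))
    (hI.inter hI') (hI_conn.inter hI'_conn).isPreconnected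
    (fun s hs => contMDiffAt_slice_left (h_line s hs).1.contMDiffAt)
    (fun s hs => contMDiffAt_slice_left (h_line s hs).2.contMDiffAt)
    (fun s hs => (h_line s hs).1.rlog_eq.trans (h_line s hs).2.rlog_eq.symm) hx₀ h hx

lemma hasRlogAt_oneChart_symm {α ζ : ℝ × ℝ → V} {p : ℝ × ℝ} (hζ : ContDiffAt ℝ ∞ ζ p)
    (hp : ζ p ∈ (oneChart V G).target)
    (h_deriv : HasDerivAt (fun x => ζ (x, p.2)) (rightTranslationDeriv V G (ζ p) (α p)) p.1) :
    HasRlogAt α (fun q => (oneChart V G).symm (ζ q)) p := by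
  have h_smooth : ContMDiffAt 𝓘(ℝ, ℝ × ℝ) 𝓘(ℝ, V) ∞ (fun q => (oneChart V G).symm (ζ q)) p :=
    ContMDiffAt.comp p (contMDiffAt_oneChart_symm hp) hζ.contMDiffAt
  refine ⟨h_smooth, rightTranslationDeriv_injective hp ?_⟩
  have h_chart := hasDerivAt_oneChart_rlog (V := V)
    (c := fun x => (oneChart V G).symm (ζ (x, p.2))) (s := p.1)
    (contMDiffAt_slice_left (w := fun q => (oneChart V G).symm (ζ q)) h_smooth)
    ((oneChart V G).map_target hp)
  rw [Prod.mk.eta, (oneChart V G).right_inv hp] at h_chart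
  have h_slice : (fun x => oneChart V G ((oneChart V G).symm (ζ (x, p.2)))) =ᶠ[𝓝 p.1]
      fun x => ζ (x, p.2) := by
    filter_upwards [h_deriv.continuousAt.preimage_mem_nhds
      ((isOpen_oneChart_target V G).mem_nhds hp)] with x hx
    exact (oneChart V G).right_inv hx
  exact h_chart.unique (h_deriv.congr_of_eventuallyEq h_slice)

lemma exists_eventually_hasRlogAt [FiniteDimensional ℝ V] {α : ℝ × ℝ → V} (hα : ContDiff ℝ ∞ α)
    (p₀ : ℝ × ℝ) : ∃ w : ℝ × ℝ → G, ∀ᶠ p in 𝓝 p₀, HasRlogAt α w p := by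
  have : CompleteSpace V := FiniteDimensional.complete ℝ V
  have h_target := oneChart_target_mem_nhds V G
  obtain ⟨A, hA, hA_eq⟩ := exists_contDiff_eventuallyEq
    (eventually_of_mem h_target fun z => contDiffAt_rightTranslationDeriv (G := G))
  have hF : ContDiff ℝ ∞ (fun q : V × ℝ × ℝ => A q.1 (α q.2)) :=
    (hA.comp contDiff_fst).clm_apply (hα.comp contDiff_snd)
  obtain ⟨ζ, hζ0, hζ⟩ := exists_smooth_local_solution hF (oneChart V G 1) p₀.1 p₀.2
  rw [Prod.mk.eta] at hζ0 hζ
  have h_near := hζ.self_of_nhds.1.continuousAt.eventually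
    (hζ0 ▸ hA_eq.and h_target : ∀ᶠ z in 𝓝 (ζ p₀), _ ∧ z ∈ (oneChart V G).target)
  refine ⟨fun p => (oneChart V G).symm (ζ p), ?_⟩
  filter_upwards [hζ, h_near] with p hζp hp
  exact hasRlogAt_oneChart_symm hζp.1 hp.2 (hp.1 ▸ hζp.2)

lemma exists_hasRlogAt_glue {α : ℝ × ℝ → V} {w₁ w₂ : ℝ × ℝ → G} {a b c d x₀ : ℝ} {J : Set ℝ}
    (h₁ : ∀ p ∈ Ioo a b ×ˢ J, HasRlogAt α w₁ p) (h₂ : ∀ p ∈ Ioo c d ×ˢ J, HasRlogAt α w₂ p)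
    (hJ : IsOpen J) (hab : x₀ ∈ Ioo a b) (hcd : x₀ ∈ Ioo c d) :
    ∃ w : ℝ × ℝ → G, ∀ p ∈ Ioo a d ×ˢ J, HasRlogAt α w p := by
  -- Right multiplication by a function of `y` alone makes `w₂` agree with `w₁` on `x = x₀`.
  let w₃ : ℝ × ℝ → G := fun p => w₂ p * ((w₂ (x₀, p.2))⁻¹ * w₁ (x₀, p.2))
  have h₃ : ∀ p ∈ Ioo c d ×ˢ J, HasRlogAt α w₃ p := fun p hp =>
    (h₂ p hp).mul_right (k := fun y => (w₂ (x₀, y))⁻¹ * w₁ (x₀, y))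
      ((contMDiffAt_slice_right (h₂ (x₀, p.2) ⟨hcd, hp.2⟩).contMDiffAt).inv.mul
        (contMDiffAt_slice_right (h₁ (x₀, p.2) ⟨hab, hp.2⟩).contMDiffAt))
  have h_agree : ∀ x ∈ Ioo a b ∩ Ioo c d, ∀ y ∈ J, w₃ (x, y) = w₁ (x, y) := fun x hx y hy =>
    (eq_of_hasRlogAt isOpen_Ioo ordConnected_Ioo isOpen_Ioo ordConnected_Ioo h₁ h₃
      ⟨hab, hcd⟩ hx ⟨hy, hy⟩ (by simp [w₃])).symm
  refine ⟨fun p => if p.1 < x₀ then w₁ p else w₃ p, ?_⟩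
  rintro ⟨x, y⟩ ⟨⟨hax, hxd⟩, hy⟩
  rcases lt_or_ge x b with hxb | hbx
  · refine (h₁ _ ⟨⟨hax, hxb⟩, hy⟩).congr ?_
    filter_upwards [((isOpen_Iio.inter isOpen_Iio).prod hJ).mem_nhds
      (show (x, y) ∈ (Iio b ∩ Iio d) ×ˢ J from ⟨⟨hxb, hxd⟩, hy⟩)]
    rintro ⟨x', y'⟩ ⟨⟨hb, hd⟩, hy'⟩
    change (if x' < x₀ then w₁ (x', y') else w₃ (x', y')) = w₁ (x', y')
    split_ifs with hx'
    · rfl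
    · have hx₀ := not_lt.1 hx'
      exact h_agree x' ⟨⟨hab.1.trans_le hx₀, hb⟩, ⟨hcd.1.trans_le hx₀, hd⟩⟩ y' hy'
  · have hx₀ : x₀ < x := hab.2.trans_le hbx
    refine (h₃ _ ⟨⟨hcd.1.trans hx₀, hxd⟩, hy⟩).congr ?_
    filter_upwards [continuous_fst.continuousAt.eventually (Ioi_mem_nhds hx₀)] with q hq
    exact if_neg (not_lt.2 (le_of_lt hq))

lemma exists_hasRlogAt_of_uniform_radius {α : ℝ × ℝ → V} {J : Set ℝ} (hJ : IsOpen J)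
    {a b δ : ℝ} (hδ : 0 < δ)
    (h_loc : ∀ x ∈ Icc a b, ∃ w : ℝ × ℝ → G, ∀ p ∈ Ioo (x - δ) (x + δ) ×ˢ J, HasRlogAt α w p)
    (hab : a ≤ b) : ∃ w : ℝ × ℝ → G, ∀ p ∈ Ioo (a - δ) (b + δ) ×ˢ J, HasRlogAt α w p := by
  have h_steps : ∀ n : ℕ, ∀ x ∈ Icc a b, x ≤ a + n * (δ / 2) →
      ∃ w : ℝ × ℝ → G, ∀ p ∈ Ioo (a - δ) (x + δ) ×ˢ J, HasRlogAt α w p := by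
    intro n
    induction n with
    | zero =>
      intro x hx hxn
      obtain rfl : x = a := le_antisymm (by simpa using hxn) hx.1
      exact h_loc x hx
    | succ n ih =>
      intro x hx hxn
      push_cast at hxn
      obtain ⟨w₁, h₁⟩ := ih (max a (x - δ / 2))
        ⟨le_max_left _ _, max_le hab (by linarith [hx.2])⟩
        (max_le (by nlinarith [n.cast_nonneg (α := ℝ)]) (by linarith))
      obtain ⟨w₂, h₂⟩ := h_loc x hx
      exact exists_hasRlogAt_glue h₁ h₂ hJ
        ⟨by linarith [hx.1], by linarith [le_max_right a (x - δ / 2)]⟩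
        ⟨by linarith, by linarith⟩
  obtain ⟨n, hn⟩ := exists_nat_ge ((b - a) / (δ / 2))
  rw [div_le_iff₀ (half_pos hδ)] at hn
  exact h_steps n b ⟨hab, le_rfl⟩ (by linarith)

lemma exists_hasRlogAt_strip [FiniteDimensional ℝ V] {α : ℝ × ℝ → V} (hα : ContDiff ℝ ∞ α)
    (y₀ : ℝ) {R : ℝ} (hR : 0 < R) :
    ∃ (w : ℝ × ℝ → G) (J : Set ℝ), IsOpen J ∧ y₀ ∈ J ∧ ∀ p ∈ Ioo (-R) R ×ˢ J, HasRlogAt α w p := by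
  choose w hw using exists_eventually_hasRlogAt (G := G) hα
  obtain ⟨δ, hδ, h_lebesgue⟩ := lebesgue_number_lemma_of_metric
    (isCompact_Icc.prod isCompact_singleton : IsCompact (Icc (-R) R ×ˢ {y₀}))
    (fun p₀ => isOpen_interior (s := {p | HasRlogAt α (w p₀) p}))
    (fun p _ => mem_iUnion.2 ⟨p, mem_interior_iff_mem_nhds.2 (hw p)⟩)
  have h_loc : ∀ x ∈ Icc (-R) R, ∃ w : ℝ × ℝ → G,
      ∀ p ∈ Ioo (x - δ) (x + δ) ×ˢ Metric.ball y₀ δ, HasRlogAt α w p := by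
    intro x hx
    obtain ⟨p₀, hp₀⟩ := h_lebesgue (x, y₀) ⟨hx, rfl⟩
    refine ⟨w p₀, fun p hp => interior_subset (hp₀ ?_)⟩
    rwa [← ball_prod_same, Real.ball_eq_Ioo]
  obtain ⟨w', hw'⟩ := exists_hasRlogAt_of_uniform_radius Metric.isOpen_ball hδ h_loc (by linarith)
  exact ⟨w', _, Metric.isOpen_ball, Metric.mem_ball_self hδ, fun p hp =>
    hw' p ⟨Ioo_subset_Ioo (by linarith) (by linarith) hp.1, hp.2⟩⟩

lemma exists_hasRlogAt_strip_eq_one [FiniteDimensional ℝ V] {α : ℝ × ℝ → V}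
    (hα : ContDiff ℝ ∞ α) (y₀ : ℝ) {R : ℝ} (hR : 0 < R) :
    ∃ (w : ℝ × ℝ → G) (J : Set ℝ), IsOpen J ∧ y₀ ∈ J ∧
      (∀ p ∈ Ioo (-R) R ×ˢ J, HasRlogAt α w p) ∧ ∀ y, w (0, y) = 1 := by
  obtain ⟨w, J, hJ, hy₀, hw⟩ := exists_hasRlogAt_strip (G := G) hα y₀ hR
  refine ⟨fun p => w p * (w (0, p.2))⁻¹, J, hJ, hy₀, fun p hp => ?_, fun y => mul_inv_cancel _⟩
  exact (hw p hp).mul_right (k := fun y => (w (0, y))⁻¹)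
    (contMDiffAt_slice_right (hw (0, p.2) ⟨⟨neg_lt_zero.2 hR, hR⟩, hp.2⟩).contMDiffAt).inv

theorem exists_contMDiff_rlog_eq [FiniteDimensional ℝ V] {α : ℝ × ℝ → V} (hα : ContDiff ℝ ∞ α) :
    ∃ u : ℝ × ℝ → G, ContMDiff 𝓘(ℝ, ℝ × ℝ) 𝓘(ℝ, V) ∞ u ∧
      (∀ x y, rlog V (fun ξ => u (ξ, y)) x = α (x, y)) ∧ ∀ y, u (0, y) = 1 := by
  have h_pos : ∀ x : ℝ, 0 < |x| + 1 := fun x => by positivity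
  have h_mem : ∀ x : ℝ, x ∈ Ioo (-(|x| + 1)) (|x| + 1) := fun x => abs_lt.1 (lt_add_one _)
  have h_zero : ∀ x : ℝ, (0 : ℝ) ∈ Ioo (-(|x| + 1)) (|x| + 1) := fun x =>
    ⟨neg_lt_zero.2 (h_pos x), h_pos x⟩
  choose w J hJ hyJ hw hw_one using fun p : ℝ × ℝ =>
    exists_hasRlogAt_strip_eq_one (G := G) hα p.2 (h_pos p.1)
  -- The strip solutions agree wherever they overlap, so their diagonal is a global solution.
  let u : ℝ × ℝ → G := fun p => w p p
  have h_agree : ∀ p, ∀ q ∈ Ioo (-(|p.1| + 1)) (|p.1| + 1) ×ˢ J p, u q = w p q := fun p q hq =>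
    eq_of_hasRlogAt isOpen_Ioo ordConnected_Ioo isOpen_Ioo ordConnected_Ioo (hw q) (hw p)
      ⟨h_zero q.1, h_zero p.1⟩ ⟨h_mem q.1, hq.1⟩ ⟨hyJ q, hq.2⟩
      ((hw_one q q.2).trans (hw_one p q.2).symm)
  have h_sol : ∀ p, HasRlogAt α u p := fun p => by
    have hp : p ∈ Ioo (-(|p.1| + 1)) (|p.1| + 1) ×ˢ J p := ⟨h_mem p.1, hyJ p⟩
    exact (hw p p hp).congr (eventually_of_mem ((isOpen_Ioo.prod (hJ p)).mem_nhds hp) (h_agree p))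
  exact ⟨u, fun p => (h_sol p).contMDiffAt, fun x y => (h_sol (x, y)).rlog_eq,
    fun y => hw_one (0, y) y⟩

end Existence

/-! ### Differential forms on the plane -/

section Forms

variable {F : Type*} [NormedAddCommGroup F] [NormedSpace ℝ F]

lemma contDiff_alternatingMap_smulRight {D E : Type*} [NormedAddCommGroup D] [NormedSpace ℝ D]
    [NormedAddCommGroup E] [NormedSpace ℝ E] {n : ℕ} (θ : E [⋀^Fin n]→L[ℝ] ℝ) {Z : D → F}
    (hZ : ContDiff ℝ ∞ Z) : ContDiff ℝ ∞ fun p => θ.smulRight (Z p) := by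
  let L : F →L[ℝ] E [⋀^Fin n]→L[ℝ] F :=
    (ContinuousLinearMap.compContinuousAlternatingMapCLM ℝ E ℝ F (Fin n)).flip θ ∘L
      (ContinuousLinearMap.toSpanSingletonCLE (𝕜 := ℝ) (E := F)).toContinuousLinearMap
  exact L.contDiff.comp hZ

/-- The area form `dx ∧ dy` on `ℝ²`. -/
def areaForm : (ℝ × ℝ) [⋀^Fin 2]→L[ℝ] ℝ where
  toFun v := (v 0).1 * (v 1).2 - (v 0).2 * (v 1).1
  map_update_add' v i z w := by
    fin_cases i <;> simp <;> ring
  map_update_smul' v i r z := by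
    fin_cases i <;> simp <;> ring
  map_eq_zero_of_eq' v i j h hij := by
    fin_cases i <;> fin_cases j <;> simp_all <;> ring
  cont := by fun_prop

lemma areaForm_apply (v w : ℝ × ℝ) : areaForm ![v, w] = v.1 * w.2 - v.2 * w.1 :=
  rfl

lemma prod_eq_smul_add_smul (v : ℝ × ℝ) :
    v = v.1 • ((1 : ℝ), (0 : ℝ)) + v.2 • ((0 : ℝ), (1 : ℝ)) := by
  ext <;> simp

lemma oneForm_apply (a : (ℝ × ℝ) [⋀^Fin 1]→L[ℝ] F) (v : ℝ × ℝ) :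
    a ![v] = v.1 • a ![(1, 0)] + v.2 • a ![(0, 1)] := by
  conv_lhs => rw [prod_eq_smul_add_smul v]
  rw [a.vecCons_add, a.vecCons_smul, a.vecCons_smul]

lemma twoForm_self (B : (ℝ × ℝ) [⋀^Fin 2]→L[ℝ] F) (v : ℝ × ℝ) : B ![v, v] = 0 :=
  B.map_eq_zero_of_eq ![v, v] (i := 0) (j := 1) rfl (by simp)

lemma twoForm_swap (B : (ℝ × ℝ) [⋀^Fin 2]→L[ℝ] F) (v w : ℝ × ℝ) :
    B ![v, w] = -B ![w, v] := by
  have h_swap : ![w, v] ∘ Equiv.swap (0 : Fin 2) 1 = ![v, w] := by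
    ext i <;> fin_cases i <;> simp
  rw [← h_swap]
  exact B.map_swap ![w, v] (by simp)

lemma twoForm_apply (B : (ℝ × ℝ) [⋀^Fin 2]→L[ℝ] F) (v w : ℝ × ℝ) :
    B ![v, w] = (v.1 * w.2 - v.2 * w.1) • B ![(1, 0), (0, 1)] := by
  have h_left : ∀ v w : ℝ × ℝ, B ![v, w] = v.1 • B ![(1, 0), w] + v.2 • B ![(0, 1), w] := by
    intro v w
    conv_lhs => rw [prod_eq_smul_add_smul v]
    rw [B.vecCons_add, B.vecCons_smul, B.vecCons_smul]
  rw [h_left v w, twoForm_swap B (1, 0) w, twoForm_swap B (0, 1) w, h_left w (1, 0),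
    h_left w (0, 1), twoForm_self, twoForm_self, twoForm_swap B (0, 1) (1, 0)]
  module

lemma oneForm_ext {a a' : (ℝ × ℝ) [⋀^Fin 1]→L[ℝ] F} (hx : a ![(1, 0)] = a' ![(1, 0)])
    (hy : a ![(0, 1)] = a' ![(0, 1)]) : a = a' := by
  ext v
  have hv : v = ![v 0] := by ext i <;> fin_cases i <;> rfl
  rw [hv, oneForm_apply, oneForm_apply a', hx, hy]

lemma twoForm_ext {B B' : (ℝ × ℝ) [⋀^Fin 2]→L[ℝ] F}
    (h : B ![(1, 0), (0, 1)] = B' ![(1, 0), (0, 1)]) : B = B' := by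
  ext v
  have hv : v = ![v 0, v 1] := by ext i <;> fin_cases i <;> rfl
  rw [hv, twoForm_apply, twoForm_apply B', h]

lemma fderiv_form_apply {E : Type*} [NormedAddCommGroup E] [NormedSpace ℝ E] {n : ℕ}
    {a : E → E [⋀^Fin n]→L[ℝ] F} {p : E} (ha : DifferentiableAt ℝ a p) (w : Fin n → E) (v : E) :
    fderiv ℝ a p v w = fderiv ℝ (fun q => a q w) p v := by
  have h : HasFDerivAt (fun q => a q w)
      ((ContinuousAlternatingMap.apply ℝ E F w).comp (fderiv ℝ a p)) p :=
    (ContinuousAlternatingMap.apply ℝ E F w).hasFDerivAt.comp p ha.hasFDerivAt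
  rw [h.fderiv]
  rfl

lemma extDeriv_oneForm_apply {E : Type*} [NormedAddCommGroup E] [NormedSpace ℝ E]
    {a : E → E [⋀^Fin 1]→L[ℝ] F} {p : E} (ha : DifferentiableAt ℝ a p) (v w : E) :
    extDeriv a p ![v, w] =
      fderiv ℝ (fun q => a q ![w]) p v - fderiv ℝ (fun q => a q ![v]) p w := by
  rw [extDeriv, ContinuousAlternatingMap.alternatizeUncurryFin_apply, Fin.sum_univ_two]
  have h_remove_zero : Fin.removeNth (0 : Fin 2) ![v, w] = ![w] := by
    ext i; fin_cases i; rfl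
  have h_remove_one : Fin.removeNth (1 : Fin 2) ![v, w] = ![v] := by
    ext i; fin_cases i; rfl
  rw [h_remove_zero, h_remove_one, fderiv_form_apply ha, fderiv_form_apply ha]
  simp [sub_eq_add_neg]

end Forms

/-! ### The holonomy of an infinitesimal rectangle -/

section Holonomy

variable {V : Type*} [NormedAddCommGroup V] [NormedSpace ℝ V]
  {G : Type*} [TopologicalSpace G] [ChartedSpace V G] [Group G] [LieGroup 𝓘(ℝ, V) ∞ G]
  {K L : ℝ × ℝ → G} {x y : ℝ}

lemma contDiffAt_oneChart_comp_of_eq_one (hL : ContMDiffAt 𝓘(ℝ, ℝ × ℝ) 𝓘(ℝ, V) ∞ L (x, y))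
    (hL_one : L (x, y) = 1) : ContDiffAt ℝ ∞ (fun q => oneChart V G (L q)) (x, y) :=
  contDiffAt_oneChart_comp hL (hL_one ▸ one_mem_oneChart_source V G)

lemma fderiv_oneChart_left (hL : ContMDiffAt 𝓘(ℝ, ℝ × ℝ) 𝓘(ℝ, V) ∞ L (x, y))
    (hL_one : L (x, y) = 1) :
    fderiv ℝ (fun q => oneChart V G (L q)) (x, y) (1, 0) =
      velocity (V := V) (fun ξ => L (ξ, y)) x :=
  (hasDerivAt_partial_left ((contDiffAt_oneChart_comp_of_eq_one hL hL_one).differentiableAt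
    (by simp))).deriv.symm

lemma fderiv_oneChart_right (hL : ContMDiffAt 𝓘(ℝ, ℝ × ℝ) 𝓘(ℝ, V) ∞ L (x, y))
    (hL_one : L (x, y) = 1) :
    fderiv ℝ (fun q => oneChart V G (L q)) (x, y) (0, 1) =
      velocity (V := V) (fun η => L (x, η)) y :=
  (hasDerivAt_partial_right ((contDiffAt_oneChart_comp_of_eq_one hL hL_one).differentiableAt
    (by simp))).deriv.symm

lemma hasDerivAt_velocity_right (hL : ContMDiffAt 𝓘(ℝ, ℝ × ℝ) 𝓘(ℝ, V) ∞ L (x, y))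
    (hL_one : L (x, y) = 1) :
    HasDerivAt (fun ξ => velocity (V := V) (fun η => L (ξ, η)) y)
      (mixedPartial (fun q => oneChart V G (L q)) (x, y)) x :=
  hasDerivAt_deriv_partial_right (contDiffAt_oneChart_comp_of_eq_one hL hL_one)

lemma hasDerivAt_velocity_left (hL : ContMDiffAt 𝓘(ℝ, ℝ × ℝ) 𝓘(ℝ, V) ∞ L (x, y))
    (hL_one : L (x, y) = 1) :
    HasDerivAt (fun η => velocity (V := V) (fun ξ => L (ξ, η)) x)
      (mixedPartial (fun q => oneChart V G (L q)) (x, y)) y :=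
  hasDerivAt_deriv_partial_left (contDiffAt_oneChart_comp_of_eq_one hL hL_one)

lemma mixedPartial_oneChart_mul_velocity (hK : ContMDiffAt 𝓘(ℝ, ℝ × ℝ) 𝓘(ℝ, V) ∞ K (x, y))
    (hL : ContMDiffAt 𝓘(ℝ, ℝ × ℝ) 𝓘(ℝ, V) ∞ L (x, y)) (hK_one : K (x, y) = 1)
    (hL_one : L (x, y) = 1) :
    mixedPartial (fun q => oneChart V G (K q * L q)) (x, y) =
      mixedPartial (fun q => oneChart V G (K q)) (x, y) +
        mixedPartial (fun q => oneChart V G (L q)) (x, y) +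
        (chartMulBilin V G (velocity (V := V) (fun ξ => K (ξ, y)) x)
            (velocity (V := V) (fun η => L (x, η)) y) +
          chartMulBilin V G (velocity (V := V) (fun η => K (x, η)) y)
            (velocity (V := V) (fun ξ => L (ξ, y)) x)) := by
  rw [mixedPartial_oneChart_mul hK hL hK_one hL_one, fderiv_oneChart_left hK hK_one,
    fderiv_oneChart_right hK hK_one, fderiv_oneChart_left hL hL_one,
    fderiv_oneChart_right hL hL_one]

/-- The holonomy around the rectangle with corners `(x, y)` and `q`, where `F q` is the transport
along the horizontal side at height `q.2` and `K q` is the transport along the vertical side at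
abscissa `q.1`. -/
def rectangleHolonomy {G : Type*} [Group G] (F K : ℝ × ℝ → G) (x y : ℝ) (q : ℝ × ℝ) : G :=
  (K (x, q.2))⁻¹ * (F q)⁻¹ * K q * F (q.1, y)

variable {F : ℝ × ℝ → G}

lemma rectangleHolonomy_left {G : Type*} [Group G] {F K : ℝ × ℝ → G} {x y η : ℝ}
    (hFη : F (x, η) = 1) (hFy : F (x, y) = 1) : rectangleHolonomy F K x y (x, η) = 1 := by
  simp [rectangleHolonomy, hFη, hFy]

lemma rectangleHolonomy_bottom {G : Type*} [Group G] {F K : ℝ × ℝ → G} {x y ξ : ℝ}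
    (hKx : K (x, y) = 1) (hKξ : K (ξ, y) = 1) : rectangleHolonomy F K x y (ξ, y) = 1 := by
  simp [rectangleHolonomy, hKx, hKξ]

lemma contMDiff_rectangleHolonomy (hF : ContMDiff 𝓘(ℝ, ℝ × ℝ) 𝓘(ℝ, V) ∞ F)
    (hK : ContMDiff 𝓘(ℝ, ℝ × ℝ) 𝓘(ℝ, V) ∞ K) (x y : ℝ) :
    ContMDiff 𝓘(ℝ, ℝ × ℝ) 𝓘(ℝ, V) ∞ (rectangleHolonomy F K x y) := by
  have hF_bottom : ContMDiff 𝓘(ℝ, ℝ × ℝ) 𝓘(ℝ, V) ∞ fun q : ℝ × ℝ => F (q.1, y) :=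
    hF.comp (by fun_prop : ContDiff ℝ ∞ fun q : ℝ × ℝ => (q.1, y)).contMDiff
  have hK_left : ContMDiff 𝓘(ℝ, ℝ × ℝ) 𝓘(ℝ, V) ∞ fun q : ℝ × ℝ => K (x, q.2) :=
    hK.comp (by fun_prop : ContDiff ℝ ∞ fun q : ℝ × ℝ => (x, q.2)).contMDiff
  exact ((hK_left.inv.mul hF.inv).mul hK).mul hF_bottom

theorem mixedPartial_rectangleHolonomy (hF : ContMDiff 𝓘(ℝ, ℝ × ℝ) 𝓘(ℝ, V) ∞ F)
    (hK : ContMDiff 𝓘(ℝ, ℝ × ℝ) 𝓘(ℝ, V) ∞ K) (hF_one : ∀ η, F (x, η) = 1)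
    (hK_one : ∀ ξ, K (ξ, y) = 1) :
    mixedPartial (fun q => oneChart V G (rectangleHolonomy F K x y q)) (x, y) =
      mixedPartial (fun q => oneChart V G (K q)) (x, y) -
        mixedPartial (fun q => oneChart V G (F q)) (x, y) +
        bracketCLM V G (velocity (V := V) (fun η => K (x, η)) y)
          (velocity (V := V) (fun ξ => F (ξ, y)) x) := by
  let S : ℝ × ℝ → G := rectangleHolonomy F K x y
  let F₁ : ℝ × ℝ → G := fun q => F (q.1, y)
  let K₁ : ℝ × ℝ → G := fun q => K (x, q.2)
  have hF₁ : ContMDiff 𝓘(ℝ, ℝ × ℝ) 𝓘(ℝ, V) ∞ F₁ :=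
    hF.comp (by fun_prop : ContDiff ℝ ∞ fun q : ℝ × ℝ => (q.1, y)).contMDiff
  have hK₁ : ContMDiff 𝓘(ℝ, ℝ × ℝ) 𝓘(ℝ, V) ∞ K₁ :=
    hK.comp (by fun_prop : ContDiff ℝ ∞ fun q : ℝ × ℝ => (x, q.2)).contMDiff
  have hS : ContMDiff 𝓘(ℝ, ℝ × ℝ) 𝓘(ℝ, V) ∞ S := contMDiff_rectangleHolonomy hF hK x y
  have hS_left : ∀ η, S (x, η) = 1 := fun η => rectangleHolonomy_left (hF_one η) (hF_one y)
  have hS_bottom : ∀ ξ, S (ξ, y) = 1 := fun ξ => rectangleHolonomy_bottom (hK_one x) (hK_one ξ)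
  have h_mixed_F₁ : mixedPartial (fun q => oneChart V G (F₁ q)) (x, y) = 0 := by
    rw [← (hasDerivAt_velocity_right (hF₁ (x, y)) (hF_one y)).deriv]
    simp [F₁, velocity_const]
  have h_mixed_K₁ : mixedPartial (fun q => oneChart V G (K₁ q)) (x, y) = 0 := by
    rw [← (hasDerivAt_velocity_right (hK₁ (x, y)) (hK_one x)).deriv]
    simp [K₁]
  have h_K₁S : mixedPartial (fun q => oneChart V G (K₁ q * S q)) (x, y) =
      mixedPartial (fun q => oneChart V G (S q)) (x, y) := by
    have h := mixedPartial_oneChart_mul_velocity (hK₁ (x, y)) (hS (x, y)) (hK_one x) (hS_left y)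
    simpa only [h_mixed_K₁, hS_left, hS_bottom, velocity_const, map_zero, zero_add,
      add_zero] using h
  have h_FK₁S := mixedPartial_oneChart_mul_velocity (L := fun q => K₁ q * S q) (hF (x, y))
    ((hK₁.mul hS) (x, y)) (hF_one y) (by simp [K₁, hK_one, hS_left])
  have h_KF₁ := mixedPartial_oneChart_mul_velocity (hK (x, y)) (hF₁ (x, y)) (hK_one x) (hF_one y)
  have h_holonomy : ∀ q, F q * (K₁ q * S q) = K q * F₁ q := fun q => by
    simp only [K₁, S, F₁, rectangleHolonomy]
    group
  simp only [h_holonomy, h_KF₁, h_K₁S, h_mixed_F₁, F₁, K₁, hF_one, hK_one, hS_left, velocity_const,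
    mul_one, map_zero, zero_apply, zero_add, add_zero] at h_FK₁S
  change mixedPartial (fun q => oneChart V G (S q)) (x, y) = _
  rw [bracketCLM, sub_apply, sub_apply, ContinuousLinearMap.flip_apply]
  linear_combination (norm := module) -h_FK₁S

section Transport

variable {u v : ℝ × ℝ → G} {α γ : ℝ × ℝ → V}

variable (G) in
/-- The coefficient of `dx ∧ dy` in the curvature `da + ½[a, a]` of the `1`-form
`a = α dx + γ dy` on the plane with values in the Lie algebra of `G`. -/
def curvature (α γ : ℝ × ℝ → V) (p : ℝ × ℝ) : V :=
  fderiv ℝ γ p (1, 0) - fderiv ℝ α p (0, 1) + bracketCLM V G (α p) (γ p)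

lemma hasDerivAt_velocity_rectangleHolonomy (hu : ContMDiff 𝓘(ℝ, ℝ × ℝ) 𝓘(ℝ, V) ∞ u)
    (hv : ContMDiff 𝓘(ℝ, ℝ × ℝ) 𝓘(ℝ, V) ∞ v) (hα : Differentiable ℝ α) (hγ : Differentiable ℝ γ)
    (hu_rlog : ∀ x y, rlog V (fun ξ => u (ξ, y)) x = -α (x, y))
    (hv_rlog : ∀ x y, rlog V (fun η => v (x, η)) y = -γ (x, y)) (x y : ℝ) :
    HasDerivAt (fun ξ => velocity (V := V) (fun η => rectangleHolonomy
        (fun q => u q * (u (x, q.2))⁻¹) (fun q => v q * (v (q.1, y))⁻¹) x y (ξ, η)) y)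
      (-curvature G α γ (x, y)) x := by
  let F : ℝ × ℝ → G := fun q => u q * (u (x, q.2))⁻¹
  let K : ℝ × ℝ → G := fun q => v q * (v (q.1, y))⁻¹
  have hF : ContMDiff 𝓘(ℝ, ℝ × ℝ) 𝓘(ℝ, V) ∞ F :=
    hu.mul (hu.comp (by fun_prop : ContDiff ℝ ∞ fun q : ℝ × ℝ => (x, q.2)).contMDiff).inv
  have hK : ContMDiff 𝓘(ℝ, ℝ × ℝ) 𝓘(ℝ, V) ∞ K :=
    hv.mul (hv.comp (by fun_prop : ContDiff ℝ ∞ fun q : ℝ × ℝ => (q.1, y)).contMDiff).inv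
  have hF_one : ∀ η, F (x, η) = 1 := fun η => mul_inv_cancel _
  have hK_one : ∀ ξ, K (ξ, y) = 1 := fun ξ => mul_inv_cancel _
  have h_mixed_K : mixedPartial (fun q => oneChart V G (K q)) (x, y) =
      -fderiv ℝ γ (x, y) (1, 0) :=
    (hasDerivAt_velocity_right (hK (x, y)) (hK_one x)).unique
      ((hasDerivAt_partial_left (hγ (x, y))).neg.congr_of_eventuallyEq
        (Eventually.of_forall fun ξ => hv_rlog ξ y))
  have h_mixed_F : mixedPartial (fun q => oneChart V G (F q)) (x, y) =
      -fderiv ℝ α (x, y) (0, 1) :=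
    (hasDerivAt_velocity_left (hF (x, y)) (hF_one y)).unique
      ((hasDerivAt_partial_right (hα (x, y))).neg.congr_of_eventuallyEq
        (Eventually.of_forall fun η => hu_rlog x η))
  have h_velocity_K : velocity (V := V) (fun η => K (x, η)) y = -γ (x, y) := hv_rlog x y
  have h_velocity_F : velocity (V := V) (fun ξ => F (ξ, y)) x = -α (x, y) := hu_rlog x y
  have h := hasDerivAt_velocity_right (contMDiff_rectangleHolonomy hF hK x y (x, y))
    (rectangleHolonomy_bottom (hK_one x) (hK_one x))
  rw [mixedPartial_rectangleHolonomy hF hK hF_one hK_one, h_mixed_K, h_mixed_F, h_velocity_K,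
    h_velocity_F, map_neg, map_neg, neg_apply, neg_neg, bracketCLM_swap (α (x, y))] at h
  convert h using 1
  rw [curvature]
  abel

theorem hasDerivAt_rlog_rectangleHolonomy (hu : ContMDiff 𝓘(ℝ, ℝ × ℝ) 𝓘(ℝ, V) ∞ u)
    (hv : ContMDiff 𝓘(ℝ, ℝ × ℝ) 𝓘(ℝ, V) ∞ v) (hα : Differentiable ℝ α) (hγ : Differentiable ℝ γ)
    (hu_rlog : ∀ x y, rlog V (fun ξ => u (ξ, y)) x = -α (x, y))
    (hv_rlog : ∀ x y, rlog V (fun η => v (x, η)) y = -γ (x, y)) (x₀ y₀ x y : ℝ) :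
    HasDerivAt (fun ξ => rlog V (fun η => rectangleHolonomy u v x₀ y₀ (ξ, η)) y)
      (-adjoint V ((v (x₀, y))⁻¹ * (u (x, y))⁻¹) (curvature G α γ (x, y))) x := by
  let F : ℝ × ℝ → G := fun q => u q * (u (x, q.2))⁻¹
  let K : ℝ × ℝ → G := fun q => v q * (v (q.1, y))⁻¹
  let S : ℝ × ℝ → G := rectangleHolonomy F K x y
  let k : ℝ → G := fun η => (v (x₀, η))⁻¹ * (u (x, η))⁻¹ * v (x, η) * (v (x, y))⁻¹
  have hF : ContMDiff 𝓘(ℝ, ℝ × ℝ) 𝓘(ℝ, V) ∞ F :=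
    hu.mul (hu.comp (by fun_prop : ContDiff ℝ ∞ fun q : ℝ × ℝ => (x, q.2)).contMDiff).inv
  have hK : ContMDiff 𝓘(ℝ, ℝ × ℝ) 𝓘(ℝ, V) ∞ K :=
    hv.mul (hv.comp (by fun_prop : ContDiff ℝ ∞ fun q : ℝ × ℝ => (q.1, y)).contMDiff).inv
  have hS : ContMDiff 𝓘(ℝ, ℝ × ℝ) 𝓘(ℝ, V) ∞ S := contMDiff_rectangleHolonomy hF hK x y
  have hS_one : ∀ ξ, S (ξ, y) = 1 := fun ξ =>
    rectangleHolonomy_bottom (mul_inv_cancel _) (mul_inv_cancel _)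
  have hk : ContMDiffAt 𝓘(ℝ, ℝ) 𝓘(ℝ, V) ∞ k y :=
    (((contMDiffAt_slice_right (hv (x₀, y))).inv.mul (contMDiffAt_slice_right (hu (x, y))).inv).mul
      (contMDiffAt_slice_right (hv (x, y)))).mul contMDiffAt_const
  have hky : k y = (v (x₀, y))⁻¹ * (u (x, y))⁻¹ := by simp [k]
  have h_factor : ∀ ξ η, rectangleHolonomy u v x₀ y₀ (ξ, η) =
      k η * S (ξ, η) * ((F (ξ, y))⁻¹ * v (ξ, y) * u (ξ, y₀)) := fun ξ η => by
    simp only [k, S, F, K, rectangleHolonomy]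
    group
  have h_rlog : ∀ ξ, rlog V (fun η => rectangleHolonomy u v x₀ y₀ (ξ, η)) y =
      rlog V k y + adjoint V (k y) (velocity (V := V) (fun η => S (ξ, η)) y) := fun ξ => by
    simp only [h_factor]
    rw [rlog_mul_const, rlog_mul hk (contMDiffAt_slice_right (hS (ξ, y))),
      rlog_of_eq_one (c := fun η => S (ξ, η)) (hS_one ξ)]
  simp only [h_rlog, ← hky, ← map_neg]
  exact ((adjoint V (k y)).hasFDerivAt.comp_hasDerivAt x
    (hasDerivAt_velocity_rectangleHolonomy hu hv hα hγ hu_rlog hv_rlog x y)).const_add _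

end Transport

end Holonomy

/-! ### Logarithmic derivatives of families of curves -/

lemma eq_of_hasDerivAt_eq {F : Type*} [NormedAddCommGroup F] [NormedSpace ℝ F] {h k h' : ℝ → F}
    (hh : ∀ x, HasDerivAt h (h' x) x) (hk : ∀ x, HasDerivAt k (h' x) x) {x₀ : ℝ}
    (h_init : h x₀ = k x₀) : h = k :=
  eq_of_fderiv_eq (fun x => (hh x).differentiableAt) (fun x => (hk x).differentiableAt)
    (fun x => (hh x).hasFDerivAt.fderiv.trans (hk x).hasFDerivAt.fderiv.symm) x₀ h_init

section LogDeriv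

variable {V : Type*} [NormedAddCommGroup V] [NormedSpace ℝ V]
  {G : Type*} [TopologicalSpace G] [ChartedSpace V G] [Group G] [LieGroup 𝓘(ℝ, V) ∞ G]

lemma contDiff_rlog_right {w : ℝ × ℝ → G} (hw : ContMDiff 𝓘(ℝ, ℝ × ℝ) 𝓘(ℝ, V) ∞ w) :
    ContDiff ℝ ∞ fun p : ℝ × ℝ => rlog V (fun η => w (p.1, η)) p.2 := by
  have h : ContMDiff 𝓘(ℝ, ℝ × ℝ × ℝ) 𝓘(ℝ, V) ∞
      fun r : ℝ × ℝ × ℝ => w (r.2.1, r.1) * (w r.2)⁻¹ :=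
    (hw.comp (by fun_prop : ContDiff ℝ ∞ fun r : ℝ × ℝ × ℝ => (r.2.1, r.1)).contMDiff).mul
      (hw.comp contDiff_snd.contMDiff).inv
  exact contDiff_iff_contDiffAt.2 fun p => contDiffAt_velocity (σ := Prod.snd)
    (h (p.2, p)) contDiffAt_snd (mul_inv_cancel _)

lemma contDiff_llog_left {w : ℝ × ℝ → G} (hw : ContMDiff 𝓘(ℝ, ℝ × ℝ) 𝓘(ℝ, V) ∞ w) :
    ContDiff ℝ ∞ fun p : ℝ × ℝ => llog V (fun ξ => w (ξ, p.2)) p.1 := by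
  have h : ContMDiff 𝓘(ℝ, ℝ × ℝ × ℝ) 𝓘(ℝ, V) ∞
      fun r : ℝ × ℝ × ℝ => (w r.2)⁻¹ * w (r.1, r.2.2) :=
    (hw.comp contDiff_snd.contMDiff).inv.mul
      (hw.comp (by fun_prop : ContDiff ℝ ∞ fun r : ℝ × ℝ × ℝ => (r.1, r.2.2)).contMDiff)
  exact contDiff_iff_contDiffAt.2 fun p => contDiffAt_velocity (σ := Prod.fst)
    (h (p.1, p)) contDiffAt_fst (inv_mul_cancel _)

lemma differentiable_rlog_right {w : ℝ × ℝ → G} (hw : ContMDiff 𝓘(ℝ, ℝ × ℝ) 𝓘(ℝ, V) ∞ w)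
    (y : ℝ) : Differentiable ℝ fun ξ => rlog V (fun η => w (ξ, η)) y := fun x =>
  (hasDerivAt_partial_left ((contDiff_rlog_right hw).differentiable (by simp)
    (x, y))).differentiableAt

lemma differentiable_llog_left {w : ℝ × ℝ → G} (hw : ContMDiff 𝓘(ℝ, ℝ × ℝ) 𝓘(ℝ, V) ∞ w)
    (x : ℝ) : Differentiable ℝ fun η => llog V (fun ξ => w (ξ, η)) x := fun y =>
  (hasDerivAt_partial_right ((contDiff_llog_left hw).differentiable (by simp)
    (x, y))).differentiableAt

theorem eq_of_hasDerivAt_rlog {E E' : ℝ × ℝ → G} {β : ℝ → ℝ → V} {x₀ y₀ : ℝ}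
    (hE : ContMDiff 𝓘(ℝ, ℝ × ℝ) 𝓘(ℝ, V) ∞ E) (hE' : ContMDiff 𝓘(ℝ, ℝ × ℝ) 𝓘(ℝ, V) ∞ E')
    (h : ∀ x y, HasDerivAt (fun ξ => rlog V (fun η => E (ξ, η)) y) (β x y) x)
    (h' : ∀ x y, HasDerivAt (fun ξ => rlog V (fun η => E' (ξ, η)) y) (β x y) x)
    (h_left : ∀ y, E (x₀, y) = E' (x₀, y)) (h_bottom : ∀ x, E (x, y₀) = E' (x, y₀)) : E = E' := by
  have h_rlog (y : ℝ) : (fun ξ => rlog V (fun η => E (ξ, η)) y) =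
      fun ξ => rlog V (fun η => E' (ξ, η)) y :=
    eq_of_hasDerivAt_eq (fun x => h x y) (fun x => h' x y) (x₀ := x₀) (by simp only [h_left])
  have h_slice (x : ℝ) : (fun y => E (x, y)) = fun y => E' (x, y) :=
    eq_of_rlog_eq (V := V) (fun y => contMDiffAt_slice_right (hE (x, y)))
      (fun y => contMDiffAt_slice_right (hE' (x, y))) (fun y => congrFun (h_rlog y) x) (h_bottom x)
  exact funext fun p => congrFun (h_slice p.1) p.2

theorem eq_of_hasDerivAt_llog {E E' : ℝ × ℝ → G} {β : ℝ → ℝ → V} {x₀ y₀ : ℝ}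
    (hE : ContMDiff 𝓘(ℝ, ℝ × ℝ) 𝓘(ℝ, V) ∞ E) (hE' : ContMDiff 𝓘(ℝ, ℝ × ℝ) 𝓘(ℝ, V) ∞ E')
    (h : ∀ x y, HasDerivAt (fun η => llog V (fun ξ => E (ξ, η)) x) (β x y) y)
    (h' : ∀ x y, HasDerivAt (fun η => llog V (fun ξ => E' (ξ, η)) x) (β x y) y)
    (h_left : ∀ y, E (x₀, y) = E' (x₀, y)) (h_bottom : ∀ x, E (x, y₀) = E' (x, y₀)) : E = E' := by
  have h_llog (x : ℝ) : (fun η => llog V (fun ξ => E (ξ, η)) x) =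
      fun η => llog V (fun ξ => E' (ξ, η)) x :=
    eq_of_hasDerivAt_eq (h x) (h' x) (x₀ := y₀) (by simp only [h_bottom])
  have h_slice (y : ℝ) : (fun x => E (x, y)) = fun x => E' (x, y) :=
    eq_of_llog_eq (V := V) (fun x => contMDiffAt_slice_left (hE (x, y)))
      (fun x => contMDiffAt_slice_left (hE' (x, y))) (fun x => congrFun (h_llog x) y) (h_left y)
  exact funext fun p => congrFun (h_slice p.2) p.1

variable {E : ℝ → ℝ → G}

lemma deriv_rightLogDeriv_eq
    (hE : ContMDiff 𝓘(ℝ, ℝ × ℝ) 𝓘(ℝ, V) ∞ fun p : ℝ × ℝ => E p.1 p.2) (x y : ℝ) :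
    (deriv (fun ξ => rightLogDeriv (V := V) (fun η => E ξ η) y) x : V) =
      deriv (fun ξ => rlog V (fun η => E ξ η) y) x := by
  have h : ((fun ξ => rightLogDeriv (V := V) (fun η => E ξ η) y) : ℝ → V) =
      fun ξ => rlog V (fun η => E ξ η) y := funext fun ξ =>
    rightLogDeriv_eq_velocity ((contMDiffAt_slice_right (hE (ξ, y))).mdifferentiableAt (by simp))
  exact congrArg (fun k : ℝ → V => deriv k x) h

lemma deriv_leftLogDeriv_eq
    (hE : ContMDiff 𝓘(ℝ, ℝ × ℝ) 𝓘(ℝ, V) ∞ fun p : ℝ × ℝ => E p.1 p.2) (x y : ℝ) :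
    (deriv (fun η => leftLogDeriv (V := V) (fun ξ => E ξ η) x) y : V) =
      deriv (fun η => llog V (fun ξ => E ξ η) x) y := by
  have h : ((fun η => leftLogDeriv (V := V) (fun ξ => E ξ η) x) : ℝ → V) =
      fun η => llog V (fun ξ => E ξ η) x := funext fun η =>
    leftLogDeriv_eq_velocity ((contMDiffAt_slice_left (hE (x, η))).mdifferentiableAt (by simp))
  exact congrArg (fun k : ℝ → V => deriv k y) h

end LogDeriv

/-! ### The differentials of a Lie crossed module -/

namespace LieCrossedModule

variable {V U : Type*}
  [NormedAddCommGroup V] [NormedSpace ℝ V] [NormedAddCommGroup U] [NormedSpace ℝ U]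
  {G H : Type*} [TopologicalSpace G] [ChartedSpace V G] [Group G] [LieGroup 𝓘(ℝ, V) ∞ G]
  [TopologicalSpace H] [ChartedSpace U H] [Group H] [LieGroup 𝓘(ℝ, U) ∞ H]

/-- `ṫ` as a continuous linear map between the model spaces. -/
def tDotL (X : LieCrossedModule V U G H) : U →L[ℝ] V :=
  mfderiv 𝓘(ℝ, U) 𝓘(ℝ, V) X.t (1 : H)

/-- `ṁ(a)` as a continuous linear endomorphism of the model space. -/
def mDotL (X : LieCrossedModule V U G H) (a : G) : U →L[ℝ] U :=
  mfderiv 𝓘(ℝ, U) 𝓘(ℝ, U) (X.m a) (1 : H)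

variable (X : LieCrossedModule V U G H)

lemma contMDiffAt_m {E : Type*} [NormedAddCommGroup E] [NormedSpace ℝ E] {a : E → G} {A : E → H}
    {p : E} (ha : ContMDiffAt 𝓘(ℝ, E) 𝓘(ℝ, V) ∞ a p) (hA : ContMDiffAt 𝓘(ℝ, E) 𝓘(ℝ, U) ∞ A p) :
    ContMDiffAt 𝓘(ℝ, E) 𝓘(ℝ, U) ∞ (fun q => X.m (a q) (A q)) p :=
  ContMDiffAt.comp p (f := fun q => (a q, A q)) X.contMDiff_m.contMDiffAt (ha.prodMk hA)

lemma contMDiff_m_const (a : G) : ContMDiff 𝓘(ℝ, U) 𝓘(ℝ, U) ∞ (X.m a) :=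
  X.contMDiff_m.comp (contMDiff_const.prodMk contMDiff_id :
    ContMDiff 𝓘(ℝ, U) (𝓘(ℝ, V).prod 𝓘(ℝ, U)) ∞ fun A : H => (a, A))

section Curve

variable {c : ℝ → H} {s : ℝ}

lemma velocity_m (a : G) (hc : ContMDiffAt 𝓘(ℝ, ℝ) 𝓘(ℝ, U) ∞ c s) (hcs : c s = 1) :
    velocity (V := U) (fun τ => X.m a (c τ)) s = X.mDotL a (velocity (V := U) c s) :=
  velocity_comp ((X.contMDiff_m_const a).mdifferentiable (by simp) 1) (map_one _)
    (hc.mdifferentiableAt (by simp)) hcs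

lemma velocity_t (hc : ContMDiffAt 𝓘(ℝ, ℝ) 𝓘(ℝ, U) ∞ c s) (hcs : c s = 1) :
    velocity (V := V) (fun τ => X.t (c τ)) s = X.tDotL (velocity (V := U) c s) :=
  velocity_comp (X.contMDiff_t.mdifferentiable (by simp) 1) (map_one _)
    (hc.mdifferentiableAt (by simp)) hcs

lemma rlog_t (hc : ContMDiffAt 𝓘(ℝ, ℝ) 𝓘(ℝ, U) ∞ c s) :
    rlog V (fun τ => X.t (c τ)) s = X.tDotL (rlog U c s) := by
  rw [rlog, rlog, ← X.velocity_t (c := fun τ => c τ * (c s)⁻¹) (hc.mul contMDiffAt_const)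
    (mul_inv_cancel (c s))]
  simp only [map_mul, map_inv]

end Curve

lemma mDotL_mul (a b : G) (Z : U) : X.mDotL (a * b) Z = X.mDotL a (X.mDotL b Z) := by
  obtain ⟨c, hc, hc0, rfl⟩ := exists_velocity_eq (G := H) Z
  rw [← X.velocity_m _ hc hc0, ← X.velocity_m _ hc hc0,
    ← X.velocity_m _ (X.contMDiffAt_m contMDiffAt_const hc) (by simp [hc0])]
  simp only [map_mul, MulAut.mul_apply]

@[simp]
lemma mDotL_one (Z : U) : X.mDotL 1 Z = Z := by
  obtain ⟨c, hc, hc0, rfl⟩ := exists_velocity_eq (G := H) Z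
  rw [← X.velocity_m _ hc hc0]
  simp only [map_one, MulAut.one_apply]

lemma tDotL_mDotL (a : G) (Z : U) : X.tDotL (X.mDotL a Z) = adjoint V a (X.tDotL Z) := by
  obtain ⟨c, hc, hc0, rfl⟩ := exists_velocity_eq (G := H) Z
  have h_t : ContMDiffAt 𝓘(ℝ, ℝ) 𝓘(ℝ, V) ∞ (fun τ => X.t (c τ)) 0 :=
    X.contMDiff_t.contMDiffAt.comp 0 hc
  rw [← X.velocity_m _ hc hc0, ← X.velocity_t hc hc0, ← velocity_conj _ h_t (by simp [hc0]),
    ← X.velocity_t (X.contMDiffAt_m contMDiffAt_const hc) (by simp [hc0])]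
  simp only [X.t_m]

lemma contDiff_mDotL {E : Type*} [NormedAddCommGroup E] [NormedSpace ℝ E] {a : E → G} {Z : E → U}
    (ha : ContMDiff 𝓘(ℝ, E) 𝓘(ℝ, V) ∞ a) (hZ : ContDiff ℝ ∞ Z) :
    ContDiff ℝ ∞ fun p => X.mDotL (a p) (Z p) := by
  obtain ⟨C, hC⟩ := exists_contMDiffAt_velocity_eq (G := H) hZ
  have h_velocity : (fun p => X.mDotL (a p) (Z p)) =
      fun p => velocity (V := U) (fun τ => X.m (a p) (C (τ, p))) 0 := funext fun p => by
    rw [X.velocity_m (a p) (contMDiffAt_slice_left (hC p).1) (hC p).2.1, (hC p).2.2]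
  rw [h_velocity, contDiff_iff_contDiffAt]
  intro p
  refine contDiffAt_velocity (C := fun r : ℝ × E => X.m (a r.2) (C r)) (σ := fun _ => 0)
    (X.contMDiffAt_m ?_ (hC p).1) contDiffAt_const (by simp [(hC p).2.1])
  exact (ha p).comp (0, p) contDiffAt_snd.contMDiffAt

end LieCrossedModule

/-! ### Fake flatness and the doublet of a cocycle -/

namespace LieCrossedModule

variable {V U : Type*}
  [NormedAddCommGroup V] [NormedSpace ℝ V] [NormedAddCommGroup U] [NormedSpace ℝ U]
  {G H : Type*} [TopologicalSpace G] [ChartedSpace V G] [Group G] [LieGroup 𝓘(ℝ, V) ∞ G]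
  [TopologicalSpace H] [ChartedSpace U H] [Group H] [LieGroup 𝓘(ℝ, U) ∞ H]
  {X : LieCrossedModule V U G H}

section FakeFlat

variable {a : ℝ × ℝ → (ℝ × ℝ) [⋀^Fin 1]→L[ℝ] V} {B : ℝ × ℝ → (ℝ × ℝ) [⋀^Fin 2]→L[ℝ] U} {p : ℝ × ℝ}

lemma fakeCurvature_apply (ha : DifferentiableAt ℝ a p) (v w : ℝ × ℝ) :
    toLieAlgebra G (extDeriv a p ![v, w])
      + (1 / 2 : ℝ) • (⁅toLieAlgebra G (a p ![v]), toLieAlgebra G (a p ![w])⁆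
        - ⁅toLieAlgebra G (a p ![w]), toLieAlgebra G (a p ![v])⁆)
      - X.tDot (toLieAlgebra H (B p ![v, w])) =
    toLieAlgebra G ((v.1 * w.2 - v.2 * w.1) •
      (curvature G (fun q => a q ![(1, 0)]) (fun q => a q ![(0, 1)]) p -
        X.tDotL (B p ![(1, 0), (0, 1)]))) := by
  rw [bracket_eq_bracketCLM, bracket_eq_bracketCLM]
  change (extDeriv a p ![v, w] + (1 / 2 : ℝ) • (bracketCLM V G (a p ![v]) (a p ![w]) -
    bracketCLM V G (a p ![w]) (a p ![v])) - X.tDotL (B p ![v, w]) : V) = _ • (_ : V)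
  have h_self (A : V) : bracketCLM V G A A = 0 := by simp [bracketCLM]
  rw [bracketCLM_swap (a p ![v]) (a p ![w]), twoForm_apply (extDeriv a p), twoForm_apply (B p) v w,
    extDeriv_oneForm_apply ha, oneForm_apply (a p) v, oneForm_apply (a p) w, map_smul, curvature]
  simp only [map_add, map_smul, add_apply, smul_apply, h_self,
    bracketCLM_swap (a p ![(1, 0)]) (a p ![(0, 1)])]
  module

lemma fake_flat_iff (ha : DifferentiableAt ℝ a p) :
    (∀ v w : ℝ × ℝ, toLieAlgebra G (extDeriv a p ![v, w])
      + (1 / 2 : ℝ) • (⁅toLieAlgebra G (a p ![v]), toLieAlgebra G (a p ![w])⁆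
        - ⁅toLieAlgebra G (a p ![w]), toLieAlgebra G (a p ![v])⁆)
      - X.tDot (toLieAlgebra H (B p ![v, w])) = 0) ↔
    X.tDotL (B p ![(1, 0), (0, 1)]) =
      curvature G (fun q => a q ![(1, 0)]) (fun q => a q ![(0, 1)]) p := by
  simp only [fakeCurvature_apply ha]
  constructor
  · intro h
    have h_basis := h (1, 0) (0, 1)
    simp only [mul_one, mul_zero, sub_zero, one_smul] at h_basis
    exact (sub_eq_zero.1 h_basis).symm
  · intro h v w
    rw [h, sub_self, smul_zero]
    rfl

end FakeFlat

namespace Cocycle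

variable (c : X.Cocycle)

lemma f_self (x y : ℝ) : c.f x x y = 1 :=
  left_eq_mul.1 (c.f_comp x x x y)

lemma g_self (x y : ℝ) : c.g x y y = 1 :=
  left_eq_mul.1 (c.g_comp x y y y)

lemma W_self_x (x y' y : ℝ) : c.W x x y' y = 1 := by
  have h := c.W_comp_x x x x y' y
  rwa [f_self, inv_one, map_one, MulAut.one_apply, left_eq_mul] at h

lemma W_self_y (x' x y : ℝ) : c.W x' x y y = 1 := by
  have h := c.W_comp_y x' x y y y
  rwa [g_self, inv_one, map_one, MulAut.one_apply, left_eq_mul] at h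

section Smooth

variable {E : Type*} [NormedAddCommGroup E] [NormedSpace ℝ E] {α β γ δ : E → ℝ}

lemma contMDiff_f_comp (hα : ContDiff ℝ ∞ α) (hβ : ContDiff ℝ ∞ β) (hγ : ContDiff ℝ ∞ γ) :
    ContMDiff 𝓘(ℝ, E) 𝓘(ℝ, V) ∞ fun p => c.f (α p) (β p) (γ p) :=
  c.contMDiff_f.comp (hα.prodMk (hβ.prodMk hγ)).contMDiff

lemma contMDiff_g_comp (hα : ContDiff ℝ ∞ α) (hβ : ContDiff ℝ ∞ β) (hγ : ContDiff ℝ ∞ γ) :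
    ContMDiff 𝓘(ℝ, E) 𝓘(ℝ, V) ∞ fun p => c.g (α p) (β p) (γ p) :=
  c.contMDiff_g.comp (hα.prodMk (hβ.prodMk hγ)).contMDiff

lemma contMDiff_W_comp (hα : ContDiff ℝ ∞ α) (hβ : ContDiff ℝ ∞ β) (hγ : ContDiff ℝ ∞ γ)
    (hδ : ContDiff ℝ ∞ δ) :
    ContMDiff 𝓘(ℝ, E) 𝓘(ℝ, U) ∞ fun p => c.W (α p) (β p) (γ p) (δ p) :=
  c.contMDiff_W.comp (hα.prodMk (hβ.prodMk (hγ.prodMk hδ))).contMDiff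

lemma contMDiff_f_right (x₀ : ℝ) :
    ContMDiff 𝓘(ℝ, ℝ × ℝ) 𝓘(ℝ, V) ∞ fun q : ℝ × ℝ => c.f q.1 x₀ q.2 :=
  c.contMDiff_f_comp contDiff_fst contDiff_const contDiff_snd

lemma contMDiff_g_right (y₀ : ℝ) :
    ContMDiff 𝓘(ℝ, ℝ × ℝ) 𝓘(ℝ, V) ∞ fun q : ℝ × ℝ => c.g q.1 q.2 y₀ :=
  c.contMDiff_g_comp contDiff_fst contDiff_snd contDiff_const

lemma contMDiff_W_right (x₀ y₀ : ℝ) :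
    ContMDiff 𝓘(ℝ, ℝ × ℝ) 𝓘(ℝ, U) ∞ fun q : ℝ × ℝ => c.W q.1 x₀ q.2 y₀ :=
  c.contMDiff_W_comp contDiff_fst contDiff_const contDiff_snd contDiff_const

end Smooth

/-- The component `a_x = -∂_{x'} f(x', x; y)|_{x' = x}` of the doublet of a cocycle. No right
translation is needed, since `f(x, x; y) = 1`. -/
def ax (p : ℝ × ℝ) : V :=
  -velocity (V := V) (fun x' => c.f x' p.1 p.2) p.1

/-- The component `a_y = -∂_{y'} g(x; y', y)|_{y' = y}` of the doublet of a cocycle. No right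
translation is needed, since `g(x; y, y) = 1`. -/
def ay (p : ℝ × ℝ) : V :=
  -velocity (V := V) (fun y' => c.g p.1 y' p.2) p.2

/-- The component `B_{xy}` of the doublet of a cocycle, as a mixed second derivative of `W` in the
chart at `1`: this agrees with both formulas of the paper because `W(x', x; y', y) = 1` as soon as
`x' = x` or `y' = y`. -/
def Bxy (p : ℝ × ℝ) : U :=
  -mixedPartial (fun q : ℝ × ℝ => oneChart U H (c.W q.1 p.1 q.2 p.2)) p

lemma contDiff_ax : ContDiff ℝ ∞ c.ax :=
  contDiff_iff_contDiffAt.2 fun p => (contDiffAt_velocity (σ := Prod.fst)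
    (c.contMDiff_f (p.1, p)) contDiffAt_fst (c.f_self _ _)).neg

lemma contDiff_ay : ContDiff ℝ ∞ c.ay := by
  have h : ContMDiff 𝓘(ℝ, ℝ × ℝ × ℝ) 𝓘(ℝ, V) ∞ fun r : ℝ × ℝ × ℝ => c.g r.2.1 r.1 r.2.2 :=
    c.contMDiff_g_comp (by fun_prop) (by fun_prop) (by fun_prop)
  exact contDiff_iff_contDiffAt.2 fun p => (contDiffAt_velocity (σ := Prod.snd)
    (h (p.2, p)) contDiffAt_snd (c.g_self _ _)).neg

lemma hasDerivAt_velocity_W_right (x y : ℝ) :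
    HasDerivAt (fun ξ => velocity (V := U) (fun η => c.W ξ x η y) y) (-c.Bxy (x, y)) x := by
  rw [Bxy, neg_neg]
  exact hasDerivAt_velocity_right (c.contMDiff_W_right x y (x, y)) (c.W_self_x x y y)

lemma hasDerivAt_velocity_W_left (x y : ℝ) :
    HasDerivAt (fun η => velocity (V := U) (fun ξ => c.W ξ x η y) x) (-c.Bxy (x, y)) y := by
  rw [Bxy, neg_neg]
  exact hasDerivAt_velocity_left (c.contMDiff_W_right x y (x, y)) (c.W_self_x x y y)

lemma contDiff_velocity_W_right : ContDiff ℝ ∞ fun r : ℝ × ℝ × ℝ =>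
    velocity (V := U) (fun η => c.W r.1 r.2.1 η r.2.2) r.2.2 := by
  have h : ContMDiff 𝓘(ℝ, ℝ × ℝ × ℝ × ℝ) 𝓘(ℝ, U) ∞
      fun s : ℝ × ℝ × ℝ × ℝ => c.W s.2.1 s.2.2.1 s.1 s.2.2.2 :=
    c.contMDiff_W_comp (by fun_prop) (by fun_prop) (by fun_prop) (by fun_prop)
  exact contDiff_iff_contDiffAt.2 fun r => contDiffAt_velocity
    (C := fun s : ℝ × ℝ × ℝ × ℝ => c.W s.2.1 s.2.2.1 s.1 s.2.2.2) (σ := fun r => r.2.2)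
    (h (r.2.2, r)) (by fun_prop) (c.W_self_y _ _ _)

lemma contDiff_Bxy : ContDiff ℝ ∞ c.Bxy := by
  let ν : ℝ × ℝ × ℝ → U := fun r => velocity (V := U) (fun η => c.W r.1 r.2.1 η r.2.2) r.2.2
  have hν : ContDiff ℝ ∞ ν := c.contDiff_velocity_W_right
  have hν_deriv (p : ℝ × ℝ) :
      HasDerivAt (fun ξ : ℝ => ν (ξ, p)) (fderiv ℝ ν (p.1, p) (1, 0)) p.1 :=
    HasFDerivAt.comp_hasDerivAt p.1 (f := fun ξ : ℝ => (ξ, p))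
      (hν.differentiable (by simp) (p.1, p)).hasFDerivAt
      ((hasDerivAt_id p.1).prodMk (hasDerivAt_const p.1 p))
  have h_Bxy : c.Bxy = fun p => -fderiv ℝ ν (p.1, p) (1, 0) := funext fun p => by
    rw [← (c.hasDerivAt_velocity_W_right p.1 p.2).unique (hν_deriv p), neg_neg]
  have h_fderiv : ContDiff ℝ ∞ fun p : ℝ × ℝ => fderiv ℝ ν (p.1, p) :=
    (hν.fderiv_right (m := ∞) (by simp)).comp (contDiff_fst.prodMk contDiff_id)
  exact h_Bxy ▸ (h_fderiv.clm_apply contDiff_const).neg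

lemma rlog_f (x x₀ y : ℝ) : rlog V (fun ξ => c.f ξ x₀ y) x = -c.ax (x, y) := by
  have h (τ : ℝ) : c.f τ x₀ y * (c.f x x₀ y)⁻¹ = c.f τ x y := by
    rw [c.f_comp τ x x₀ y, mul_inv_cancel_right]
  simp only [rlog, ax, neg_neg, h]

lemma rlog_g (x y y₀ : ℝ) : rlog V (fun η => c.g x η y₀) y = -c.ay (x, y) := by
  have h (τ : ℝ) : c.g x τ y₀ * (c.g x y y₀)⁻¹ = c.g x τ y := by
    rw [c.g_comp x τ y y₀, mul_inv_cancel_right]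
  simp only [rlog, ay, neg_neg, h]

lemma t_W (x₀ y₀ : ℝ) (q : ℝ × ℝ) : X.t (c.W q.1 x₀ q.2 y₀) =
    rectangleHolonomy (fun q => c.f q.1 x₀ q.2) (fun q => c.g q.1 q.2 y₀) x₀ y₀ q :=
  c.target q.1 x₀ q.2 y₀

theorem tDotL_Bxy (p : ℝ × ℝ) : X.tDotL (c.Bxy p) = curvature G c.ax c.ay p := by
  obtain ⟨x, y⟩ := p
  have h_holonomy := hasDerivAt_velocity_rectangleHolonomy (c.contMDiff_f_right x)
    (c.contMDiff_g_right y) (c.contDiff_ax.differentiable (by simp))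
    (c.contDiff_ay.differentiable (by simp)) (fun ξ η => c.rlog_f ξ x η)
    (fun ξ η => c.rlog_g ξ η y) x y
  simp only [f_self, g_self, inv_one, mul_one, ← t_W] at h_holonomy
  have h_W := X.tDotL.hasFDerivAt.comp_hasDerivAt x (c.hasDerivAt_velocity_W_right x y)
  have h_velocity (ξ : ℝ) : velocity (V := V) (fun η => X.t (c.W ξ x η y)) y =
      X.tDotL (velocity (V := U) (fun η => c.W ξ x η y) y) :=
    X.velocity_t (contMDiffAt_slice_right (c.contMDiff_W_right x y (ξ, y))) (c.W_self_y _ _ _)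
  simp only [h_velocity] at h_holonomy
  rw [← neg_inj, ← map_neg]
  exact h_W.unique h_holonomy

/-- The `1`-form `a_x dx + a_y dy` of a cocycle. -/
def formA (p : ℝ × ℝ) : (ℝ × ℝ) [⋀^Fin 1]→L[ℝ] V :=
  (ContinuousAlternatingMap.ofSubsingleton ℝ (ℝ × ℝ) ℝ (0 : Fin 1)
      (ContinuousLinearMap.fst ℝ ℝ ℝ)).smulRight (c.ax p) +
    (ContinuousAlternatingMap.ofSubsingleton ℝ (ℝ × ℝ) ℝ (0 : Fin 1)
      (ContinuousLinearMap.snd ℝ ℝ ℝ)).smulRight (c.ay p)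

/-- The `2`-form `B_{xy} dx ∧ dy` of a cocycle. -/
def formB (p : ℝ × ℝ) : (ℝ × ℝ) [⋀^Fin 2]→L[ℝ] U :=
  areaForm.smulRight (c.Bxy p)

lemma formA_x (p : ℝ × ℝ) : c.formA p ![(1, 0)] = c.ax p := by
  simp [formA]

lemma formA_y (p : ℝ × ℝ) : c.formA p ![(0, 1)] = c.ay p := by
  simp [formA]

lemma formB_xy (p : ℝ × ℝ) : c.formB p ![(1, 0), (0, 1)] = c.Bxy p := by
  simp [formB, areaForm_apply]

lemma contDiff_formA : ContDiff ℝ ∞ c.formA :=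
  (contDiff_alternatingMap_smulRight _ c.contDiff_ax).add
    (contDiff_alternatingMap_smulRight _ c.contDiff_ay)

/-- The doublet of a cocycle. -/
def toDoublet : X.ConnectionDoublet where
  a := c.formA
  B := c.formB
  contDiff_a := c.contDiff_formA
  contDiff_B := contDiff_alternatingMap_smulRight _ c.contDiff_Bxy
  fake_flat p := by
    refine (fake_flat_iff (c.contDiff_formA.differentiable (by simp) p)).2 ?_
    simp only [formA_x, formA_y, formB_xy]
    exact c.tDotL_Bxy p

lemma rlog_W (x x₀ y y₀ : ℝ) : rlog U (fun η => c.W x x₀ η y₀) y =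
    X.mDotL (c.g x₀ y y₀)⁻¹ (velocity (V := U) (fun η => c.W x x₀ η y) y) := by
  have h (η : ℝ) : c.W x x₀ η y₀ * (c.W x x₀ y y₀)⁻¹ = X.m (c.g x₀ y y₀)⁻¹ (c.W x x₀ η y) := by
    rw [c.W_comp_y x x₀ η y y₀, mul_inv_cancel_right]
  simp only [rlog, h]
  exact X.velocity_m _ (contMDiffAt_slice_right (c.contMDiff_W_right x₀ y (x, y)))
    (c.W_self_y _ _ _)

lemma velocity_W_comp_x (ξ x x₀ y : ℝ) : velocity (V := U) (fun η => c.W ξ x₀ η y) y =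
    velocity (V := U) (fun η => c.W x x₀ η y) y +
      X.mDotL (c.f x x₀ y)⁻¹ (velocity (V := U) (fun η => c.W ξ x η y) y) := by
  have hW (ξ x : ℝ) : ContMDiffAt 𝓘(ℝ, ℝ) 𝓘(ℝ, U) ∞ (fun η => c.W ξ x η y) y :=
    contMDiffAt_slice_right (c.contMDiff_W_right x y (ξ, y))
  rw [← X.velocity_m _ (hW ξ x) (c.W_self_y _ _ _), ← velocity_mul (hW x x₀)
    (X.contMDiffAt_m contMDiffAt_const (hW ξ x)) (c.W_self_y _ _ _) (by simp [c.W_self_y])]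
  exact congrArg (fun k => velocity (V := U) k y) (funext fun η => c.W_comp_x ξ x x₀ η y)

lemma hasDerivAt_rlog_W (x x₀ y y₀ : ℝ) :
    HasDerivAt (fun ξ => rlog U (fun η => c.W ξ x₀ η y₀) y)
      (-X.mDotL ((c.g x₀ y y₀)⁻¹ * (c.f x x₀ y)⁻¹) (c.Bxy (x, y))) x := by
  simp only [rlog_W]
  rw [funext fun ξ => congrArg (X.mDotL _) (c.velocity_W_comp_x ξ x x₀ y), X.mDotL_mul,
    ← map_neg, ← map_neg]
  exact (X.mDotL (c.g x₀ y y₀)⁻¹).hasFDerivAt.comp_hasDerivAt x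
    (((X.mDotL (c.f x x₀ y)⁻¹).hasFDerivAt.comp_hasDerivAt x
      (c.hasDerivAt_velocity_W_right x y)).const_add _)

lemma llog_W (x x₀ y y₀ : ℝ) : llog U (fun ξ => c.W ξ x₀ y y₀) x =
    X.mDotL (c.f x x₀ y₀)⁻¹ (velocity (V := U) (fun ξ => c.W ξ x y y₀) x) := by
  have h (ξ : ℝ) : (c.W x x₀ y y₀)⁻¹ * c.W ξ x₀ y y₀ = X.m (c.f x x₀ y₀)⁻¹ (c.W ξ x y y₀) := by
    rw [c.W_comp_x ξ x x₀ y y₀, inv_mul_cancel_left]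
  simp only [llog, h]
  exact X.velocity_m _ (contMDiffAt_slice_left (c.contMDiff_W_right x y₀ (x, y)))
    (c.W_self_x _ _ _)

lemma velocity_W_comp_y (x η y y₀ : ℝ) : velocity (V := U) (fun ξ => c.W ξ x η y₀) x =
    X.mDotL (c.g x y y₀)⁻¹ (velocity (V := U) (fun ξ => c.W ξ x η y) x) +
      velocity (V := U) (fun ξ => c.W ξ x y y₀) x := by
  have hW (η y : ℝ) : ContMDiffAt 𝓘(ℝ, ℝ) 𝓘(ℝ, U) ∞ (fun ξ => c.W ξ x η y) x :=
    contMDiffAt_slice_left (c.contMDiff_W_right x y (x, η))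
  rw [← X.velocity_m _ (hW η y) (c.W_self_x _ _ _), ← velocity_mul
    (X.contMDiffAt_m contMDiffAt_const (hW η y)) (hW y y₀) (by simp [c.W_self_x])
    (c.W_self_x _ _ _)]
  exact congrArg (fun k => velocity (V := U) k x) (funext fun ξ => c.W_comp_y ξ x η y y₀)

lemma hasDerivAt_llog_W (x x₀ y y₀ : ℝ) :
    HasDerivAt (fun η => llog U (fun ξ => c.W ξ x₀ η y₀) x)
      (-X.mDotL ((c.f x x₀ y₀)⁻¹ * (c.g x y y₀)⁻¹) (c.Bxy (x, y))) y := by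
  simp only [llog_W]
  rw [funext fun η => congrArg (X.mDotL _) (c.velocity_W_comp_y x η y y₀), X.mDotL_mul,
    ← map_neg, ← map_neg]
  exact (X.mDotL (c.f x x₀ y₀)⁻¹).hasFDerivAt.comp_hasDerivAt y
    (((X.mDotL (c.g x y y₀)⁻¹).hasFDerivAt.comp_hasDerivAt y
      (c.hasDerivAt_velocity_W_left x y)).add_const _)

end Cocycle

end LieCrossedModule

/-! ### Solutions of the differential problems -/

namespace LieCrossedModule

variable {V U : Type*}
  [NormedAddCommGroup V] [NormedSpace ℝ V] [NormedAddCommGroup U] [NormedSpace ℝ U]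
  {G H : Type*} [TopologicalSpace G] [ChartedSpace V G] [Group G] [LieGroup 𝓘(ℝ, V) ∞ G]
  [TopologicalSpace H] [ChartedSpace U H] [Group H] [LieGroup 𝓘(ℝ, U) ∞ H]
  {X : LieCrossedModule V U G H}

namespace ConnectionDoublet

variable {D : X.ConnectionDoublet} {x₀ y₀ : ℝ} {u v u' v' : ℝ → ℝ → G} {E E' : ℝ → ℝ → H}

lemma IsSolutionU.rlog_eq (hu : D.IsSolutionU x₀ u) (y x : ℝ) :
    rlog V (u y) x = -D.a (x, y) ![(1, 0)] :=
  (rightLogDeriv_eq_velocity ((contMDiffAt_slice_right (hu.smooth (y, x))).mdifferentiableAt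
    (by simp))).symm.trans (hu.ode y x)

lemma IsSolutionV.rlog_eq (hv : D.IsSolutionV y₀ v) (x y : ℝ) :
    rlog V (v x) y = -D.a (x, y) ![(0, 1)] :=
  (rightLogDeriv_eq_velocity ((contMDiffAt_slice_right (hv.smooth (x, y))).mdifferentiableAt
    (by simp))).symm.trans (hv.ode x y)

lemma IsSolutionE₁.hasDerivAt_rlog (hE : D.IsSolutionE₁ x₀ y₀ u v E) (x y : ℝ) :
    HasDerivAt (fun ξ => rlog U (fun η => E ξ η) y)
      (-X.mDotL ((v x₀ y)⁻¹ * (u y x)⁻¹) (D.B (x, y) ![(1, 0), (0, 1)])) x :=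
  (differentiable_rlog_right hE.smooth y x).hasDerivAt.congr_deriv
    ((deriv_rightLogDeriv_eq hE.smooth x y).symm.trans (hE.ode x y))

lemma IsSolutionE₂.hasDerivAt_llog (hE : D.IsSolutionE₂ x₀ y₀ u v E) (x y : ℝ) :
    HasDerivAt (fun η => llog U (fun ξ => E ξ η) x)
      (-X.mDotL ((u y₀ x)⁻¹ * (v x y)⁻¹) (D.B (x, y) ![(1, 0), (0, 1)])) y :=
  (differentiable_llog_left hE.smooth x y).hasDerivAt.congr_deriv
    ((deriv_leftLogDeriv_eq hE.smooth x y).symm.trans (hE.ode x y))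

theorem IsSolutionU.unique (hu : D.IsSolutionU x₀ u) (hu' : D.IsSolutionU x₀ u') : u = u' :=
  funext fun y => eq_of_rlog_eq (V := V) (fun x => contMDiffAt_slice_right (hu.smooth (y, x)))
    (fun x => contMDiffAt_slice_right (hu'.smooth (y, x)))
    (fun x => (hu.rlog_eq y x).trans (hu'.rlog_eq y x).symm) ((hu.init y).trans (hu'.init y).symm)

theorem IsSolutionV.unique (hv : D.IsSolutionV y₀ v) (hv' : D.IsSolutionV y₀ v') : v = v' :=
  funext fun x => eq_of_rlog_eq (V := V) (fun y => contMDiffAt_slice_right (hv.smooth (x, y)))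
    (fun y => contMDiffAt_slice_right (hv'.smooth (x, y)))
    (fun y => (hv.rlog_eq x y).trans (hv'.rlog_eq x y).symm) ((hv.init x).trans (hv'.init x).symm)

theorem IsSolutionE₁.unique (hE : D.IsSolutionE₁ x₀ y₀ u v E)
    (hE' : D.IsSolutionE₁ x₀ y₀ u v E') : E = E' :=
  Function.uncurry_injective <| eq_of_hasDerivAt_rlog (V := U) hE.smooth hE'.smooth
    hE.hasDerivAt_rlog hE'.hasDerivAt_rlog (fun y => (hE.init_x y).trans (hE'.init_x y).symm)
    (fun x => (hE.init_y x).trans (hE'.init_y x).symm)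

theorem IsSolutionE₂.unique (hE : D.IsSolutionE₂ x₀ y₀ u v E)
    (hE' : D.IsSolutionE₂ x₀ y₀ u v E') : E = E' :=
  Function.uncurry_injective <| eq_of_hasDerivAt_llog (V := U) hE.smooth hE'.smooth
    hE.hasDerivAt_llog hE'.hasDerivAt_llog (fun y => (hE.init_x y).trans (hE'.init_x y).symm)
    (fun x => (hE.init_y x).trans (hE'.init_y x).symm)

end ConnectionDoublet

namespace Cocycle

variable (c : X.Cocycle)

theorem isSolutionU (x₀ : ℝ) : c.toDoublet.IsSolutionU x₀ (fun y x => c.f x x₀ y) where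
  smooth := c.contMDiff_f_comp contDiff_snd contDiff_const contDiff_fst
  ode y x := (rightLogDeriv_eq_velocity ((contMDiffAt_slice_left
    (c.contMDiff_f_right x₀ (x, y))).mdifferentiableAt (by simp))).trans
      ((c.rlog_f x x₀ y).trans (congrArg Neg.neg (c.formA_x (x, y)).symm))
  init y := c.f_self x₀ y

theorem isSolutionV (y₀ : ℝ) : c.toDoublet.IsSolutionV y₀ (fun x y => c.g x y y₀) where
  smooth := c.contMDiff_g_right y₀
  ode x y := (rightLogDeriv_eq_velocity ((contMDiffAt_slice_right
    (c.contMDiff_g_right y₀ (x, y))).mdifferentiableAt (by simp))).trans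
      ((c.rlog_g x y y₀).trans (congrArg Neg.neg (c.formA_y (x, y)).symm))
  init x := c.g_self x y₀

theorem isSolutionE₁ (x₀ y₀ : ℝ) : c.toDoublet.IsSolutionE₁ x₀ y₀ (fun y x => c.f x x₀ y)
    (fun x y => c.g x y y₀) (fun x y => c.W x x₀ y y₀) where
  smooth := c.contMDiff_W_right x₀ y₀
  ode x y := by
    have h := (deriv_rightLogDeriv_eq (V := U) (E := fun x y => c.W x x₀ y y₀)
      (c.contMDiff_W_right x₀ y₀) x y).trans (c.hasDerivAt_rlog_W x x₀ y y₀).deriv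
    rw [← c.formB_xy] at h
    exact h
  init_x y := c.W_self_x x₀ y y₀
  init_y x := c.W_self_y x x₀ y₀

theorem isSolutionE₂ (x₀ y₀ : ℝ) : c.toDoublet.IsSolutionE₂ x₀ y₀ (fun y x => c.f x x₀ y)
    (fun x y => c.g x y y₀) (fun x y => c.W x x₀ y y₀) where
  smooth := c.contMDiff_W_right x₀ y₀
  ode x y := by
    have h := (deriv_leftLogDeriv_eq (V := U) (E := fun x y => c.W x x₀ y y₀)
      (c.contMDiff_W_right x₀ y₀) x y).trans (c.hasDerivAt_llog_W x x₀ y y₀).deriv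
    rw [← c.formB_xy] at h
    exact h
  init_x y := c.W_self_x x₀ y y₀
  init_y x := c.W_self_y x x₀ y₀

theorem isSolutionU_iff {x₀ : ℝ} {u : ℝ → ℝ → G} :
    c.toDoublet.IsSolutionU x₀ u ↔ u = fun y x => c.f x x₀ y :=
  ⟨fun hu => hu.unique (c.isSolutionU x₀), fun hu => hu ▸ c.isSolutionU x₀⟩

theorem isSolutionV_iff {y₀ : ℝ} {v : ℝ → ℝ → G} :
    c.toDoublet.IsSolutionV y₀ v ↔ v = fun x y => c.g x y y₀ :=
  ⟨fun hv => hv.unique (c.isSolutionV y₀), fun hv => hv ▸ c.isSolutionV y₀⟩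

theorem isSolutionE₁_iff {x₀ y₀ : ℝ} {u v : ℝ → ℝ → G} {E : ℝ → ℝ → H}
    (hu : c.toDoublet.IsSolutionU x₀ u) (hv : c.toDoublet.IsSolutionV y₀ v) :
    c.toDoublet.IsSolutionE₁ x₀ y₀ u v E ↔ E = fun x y => c.W x x₀ y y₀ := by
  obtain rfl := c.isSolutionU_iff.1 hu
  obtain rfl := c.isSolutionV_iff.1 hv
  exact ⟨fun hE => hE.unique (c.isSolutionE₁ x₀ y₀), fun hE => hE ▸ c.isSolutionE₁ x₀ y₀⟩

theorem isSolutionE₂_iff {x₀ y₀ : ℝ} {u v : ℝ → ℝ → G} {E : ℝ → ℝ → H}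
    (hu : c.toDoublet.IsSolutionU x₀ u) (hv : c.toDoublet.IsSolutionV y₀ v) :
    c.toDoublet.IsSolutionE₂ x₀ y₀ u v E ↔ E = fun x y => c.W x x₀ y y₀ := by
  obtain rfl := c.isSolutionU_iff.1 hu
  obtain rfl := c.isSolutionV_iff.1 hv
  exact ⟨fun hE => hE.unique (c.isSolutionE₂ x₀ y₀), fun hE => hE ▸ c.isSolutionE₂ x₀ y₀⟩

theorem toDoublet_injective :
    Function.Injective (toDoublet : X.Cocycle → X.ConnectionDoublet) := by
  intro c c' h
  have hf (x₀ : ℝ) := c'.isSolutionU_iff.1 (h ▸ c.isSolutionU x₀)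
  have hg (y₀ : ℝ) := c'.isSolutionV_iff.1 (h ▸ c.isSolutionV y₀)
  have hW (x₀ y₀ : ℝ) := (c'.isSolutionE₁_iff (h ▸ c.isSolutionU x₀) (h ▸ c.isSolutionV y₀)).1
    (h ▸ c.isSolutionE₁ x₀ y₀)
  refine Cocycle.ext ?_ ?_ ?_
  · funext x' x y
    exact congrFun₂ (hf x) y x'
  · funext x y' y
    exact congrFun₂ (hg y) x y'
  · funext x' x y' y
    exact congrFun₂ (hW x y) x' y'

theorem toDoublet_ax (x y : ℝ) :
    c.toDoublet.ax x y = -rightLogDeriv (V := V) (fun x' => c.f x' x y) x :=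
  neg_eq_iff_eq_neg.1 ((c.isSolutionU x).ode y x).symm

theorem toDoublet_ay (x y : ℝ) :
    c.toDoublet.ay x y = -rightLogDeriv (V := V) (fun y' => c.g x y' y) y :=
  neg_eq_iff_eq_neg.1 ((c.isSolutionV y).ode x y).symm

theorem toDoublet_Bxy_eq_neg_deriv_rightLogDeriv (x y : ℝ) : c.toDoublet.Bxy x y =
    -deriv (fun x' => rightLogDeriv (V := U) (fun y' => c.W x' x y' y) y) x := by
  refine neg_eq_iff_eq_neg.1 (((c.isSolutionE₁ x y).ode x y).trans ?_).symm
  rw [c.g_self, c.f_self, inv_one, mul_one]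
  exact congrArg Neg.neg (X.mDotL_one _)

theorem toDoublet_Bxy_eq_neg_deriv_leftLogDeriv (x y : ℝ) : c.toDoublet.Bxy x y =
    -deriv (fun y' => leftLogDeriv (V := U) (fun x' => c.W x' x y' y) x) y := by
  refine neg_eq_iff_eq_neg.1 (((c.isSolutionE₂ x y).ode x y).trans ?_).symm
  rw [c.g_self, c.f_self, inv_one, mul_one]
  exact congrArg Neg.neg (X.mDotL_one _)

end Cocycle

end LieCrossedModule

/-! ### Existence of transport -/

section Goursat

variable {V : Type*} [NormedAddCommGroup V] [NormedSpace ℝ V] [FiniteDimensional ℝ V]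
  {G : Type*} [TopologicalSpace G] [ChartedSpace V G] [Group G] [LieGroup 𝓘(ℝ, V) ∞ G]

theorem exists_contMDiff_rlog_right_eq {γ : ℝ × ℝ → V} (hγ : ContDiff ℝ ∞ γ) :
    ∃ v : ℝ × ℝ → G, ContMDiff 𝓘(ℝ, ℝ × ℝ) 𝓘(ℝ, V) ∞ v ∧
      (∀ x y, rlog V (fun η => v (x, η)) y = γ (x, y)) ∧ ∀ x, v (x, 0) = 1 := by
  have h_swap : ContDiff ℝ ∞ (Prod.swap : ℝ × ℝ → ℝ × ℝ) := contDiff_snd.prodMk contDiff_fst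
  obtain ⟨u, hu, hu_rlog, hu_one⟩ := exists_contMDiff_rlog_eq (G := G) (hγ.comp h_swap)
  exact ⟨u ∘ Prod.swap, hu.comp h_swap.contMDiff, fun x y => hu_rlog y x, hu_one⟩

theorem exists_contMDiff_hasDerivAt_rlog {β : ℝ × ℝ → V} (hβ : ContDiff ℝ ∞ β) :
    ∃ E : ℝ × ℝ → G, ContMDiff 𝓘(ℝ, ℝ × ℝ) 𝓘(ℝ, V) ∞ E ∧
      (∀ x y, HasDerivAt (fun ξ => rlog V (fun η => E (ξ, η)) y) (β (x, y)) x) ∧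
      (∀ y, E (0, y) = 1) ∧ ∀ x, E (x, 0) = 1 := by
  have : CompleteSpace V := FiniteDimensional.complete ℝ V
  obtain ⟨E, hE, hE_rlog, hE_bottom⟩ :=
    exists_contMDiff_rlog_right_eq (G := G) (contDiff_integral_of_contDiff hβ)
  refine ⟨E, hE, fun x y => ?_, fun y => ?_, hE_bottom⟩
  · have h_cont : Continuous fun ξ => β (ξ, y) := hβ.continuous.comp (by fun_prop)
    simp only [hE_rlog]
    exact intervalIntegral.integral_hasDerivAt_right (h_cont.intervalIntegrable _ _)
      (h_cont.stronglyMeasurableAtFilter _ _) h_cont.continuousAt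
  · have h_const : (fun η => E (0, η)) = fun _ => 1 :=
      eq_of_rlog_eq (V := V) (fun η => contMDiffAt_slice_right (hE (0, η))) contMDiff_const
        (fun η => by simp [hE_rlog, rlog_const]) (hE_bottom 0)
    exact congrFun h_const y

end Goursat

namespace LieCrossedModule

variable {V U : Type*}
  [NormedAddCommGroup V] [NormedSpace ℝ V] [NormedAddCommGroup U] [NormedSpace ℝ U]
  {G H : Type*} [TopologicalSpace G] [ChartedSpace V G] [Group G] [LieGroup 𝓘(ℝ, V) ∞ G]
  [TopologicalSpace H] [ChartedSpace U H] [Group H] [LieGroup 𝓘(ℝ, U) ∞ H]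
  {X : LieCrossedModule V U G H}

namespace ConnectionDoublet

lemma contDiff_a_apply (D : X.ConnectionDoublet) (w : Fin 1 → ℝ × ℝ) :
    ContDiff ℝ ∞ fun p => D.a p w :=
  (ContinuousAlternatingMap.apply ℝ (ℝ × ℝ) V w).contDiff.comp D.contDiff_a

lemma contDiff_B_apply (D : X.ConnectionDoublet) (w : Fin 2 → ℝ × ℝ) :
    ContDiff ℝ ∞ fun p => D.B p w :=
  (ContinuousAlternatingMap.apply ℝ (ℝ × ℝ) U w).contDiff.comp D.contDiff_B

/-- A choice of transports for a connection doublet: `u (x, y)` is the parallel transport from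
`(0, y)` to `(x, y)`, `v (x, y)` the parallel transport from `(x, 0)` to `(x, y)`, and `E (x, y)`
the surface transport over the rectangle with corners `(0, 0)` and `(x, y)`. -/
structure Transport (D : X.ConnectionDoublet) where
  u : ℝ × ℝ → G
  v : ℝ × ℝ → G
  E : ℝ × ℝ → H
  contMDiff_u : ContMDiff 𝓘(ℝ, ℝ × ℝ) 𝓘(ℝ, V) ∞ u
  contMDiff_v : ContMDiff 𝓘(ℝ, ℝ × ℝ) 𝓘(ℝ, V) ∞ v
  contMDiff_E : ContMDiff 𝓘(ℝ, ℝ × ℝ) 𝓘(ℝ, U) ∞ E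
  rlog_u : ∀ x y, rlog V (fun ξ => u (ξ, y)) x = -D.a (x, y) ![(1, 0)]
  rlog_v : ∀ x y, rlog V (fun η => v (x, η)) y = -D.a (x, y) ![(0, 1)]
  hasDerivAt_rlog_E : ∀ x y, HasDerivAt (fun ξ => rlog U (fun η => E (ξ, η)) y)
    (-X.mDotL ((v (0, y))⁻¹ * (u (x, y))⁻¹) (D.B (x, y) ![(1, 0), (0, 1)])) x
  t_E : ∀ q, X.t (E q) = rectangleHolonomy u v 0 0 q

/-- Fake flatness makes both sides solve the same Goursat problem. -/
theorem t_eq_rectangleHolonomy (D : X.ConnectionDoublet) {u v : ℝ × ℝ → G} {E : ℝ × ℝ → H}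
    (hu : ContMDiff 𝓘(ℝ, ℝ × ℝ) 𝓘(ℝ, V) ∞ u) (hv : ContMDiff 𝓘(ℝ, ℝ × ℝ) 𝓘(ℝ, V) ∞ v)
    (hE : ContMDiff 𝓘(ℝ, ℝ × ℝ) 𝓘(ℝ, U) ∞ E)
    (hu_rlog : ∀ x y, rlog V (fun ξ => u (ξ, y)) x = -D.a (x, y) ![(1, 0)])
    (hv_rlog : ∀ x y, rlog V (fun η => v (x, η)) y = -D.a (x, y) ![(0, 1)]) {x₀ y₀ : ℝ}
    (hE_rlog : ∀ x y, HasDerivAt (fun ξ => rlog U (fun η => E (ξ, η)) y)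
      (-X.mDotL ((v (x₀, y))⁻¹ * (u (x, y))⁻¹) (D.B (x, y) ![(1, 0), (0, 1)])) x)
    (hu_one : ∀ y, u (x₀, y) = 1) (hv_one : ∀ x, v (x, y₀) = 1)
    (hE_left : ∀ y, E (x₀, y) = 1) (hE_bottom : ∀ x, E (x, y₀) = 1) :
    (fun q => X.t (E q)) = rectangleHolonomy u v x₀ y₀ := by
  refine eq_of_hasDerivAt_rlog (V := V) (x₀ := x₀) (y₀ := y₀) (X.contMDiff_t.comp hE)
    (contMDiff_rectangleHolonomy hu hv x₀ y₀) (fun x y => ?_)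
    (hasDerivAt_rlog_rectangleHolonomy hu hv
      ((D.contDiff_a_apply ![(1, 0)]).differentiable (by simp))
      ((D.contDiff_a_apply ![(0, 1)]).differentiable (by simp)) hu_rlog hv_rlog x₀ y₀)
    (fun y => ?_) (fun x => ?_)
  · have h_rlog_t (ξ : ℝ) : rlog V (fun η => X.t (E (ξ, η))) y =
        X.tDotL (rlog U (fun η => E (ξ, η)) y) := X.rlog_t (contMDiffAt_slice_right (hE (ξ, y)))
    have h_flat := (fake_flat_iff (D.contDiff_a.differentiable (by simp) (x, y))).1
      (D.fake_flat (x, y))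
    simp only [h_rlog_t]
    rw [← h_flat, ← X.tDotL_mDotL, ← map_neg]
    exact X.tDotL.hasFDerivAt.comp_hasDerivAt x (hE_rlog x y)
  · rw [hE_left, map_one, rectangleHolonomy_left (hu_one y) (hu_one y₀)]
  · rw [hE_bottom, map_one, rectangleHolonomy_bottom (hv_one x₀) (hv_one x)]

theorem nonempty_transport [FiniteDimensional ℝ V] [FiniteDimensional ℝ U]
    (D : X.ConnectionDoublet) : Nonempty D.Transport := by
  obtain ⟨u, hu, hu_rlog, hu_one⟩ :=
    exists_contMDiff_rlog_eq (G := G) (D.contDiff_a_apply ![(1, 0)]).neg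
  obtain ⟨v, hv, hv_rlog, hv_one⟩ :=
    exists_contMDiff_rlog_right_eq (G := G) (D.contDiff_a_apply ![(0, 1)]).neg
  have hv_left : ContMDiff 𝓘(ℝ, ℝ × ℝ) 𝓘(ℝ, V) ∞ fun p : ℝ × ℝ => v (0, p.2) :=
    hv.comp (by fun_prop : ContDiff ℝ ∞ fun p : ℝ × ℝ => ((0 : ℝ), p.2)).contMDiff
  obtain ⟨E, hE, hE_rlog, hE_left, hE_bottom⟩ := exists_contMDiff_hasDerivAt_rlog (G := H)
    (X.contDiff_mDotL (hv_left.inv.mul hu.inv) (D.contDiff_B_apply ![(1, 0), (0, 1)])).neg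
  exact ⟨⟨u, v, E, hu, hv, hE, hu_rlog, hv_rlog, hE_rlog, congrFun <|
    D.t_eq_rectangleHolonomy hu hv hE hu_rlog hv_rlog hE_rlog hu_one hv_one hE_left hE_bottom⟩⟩

namespace Transport

variable {D : X.ConnectionDoublet} (T : D.Transport)

section Smooth

variable {F : Type*} [NormedAddCommGroup F] [NormedSpace ℝ F] {φ : F → ℝ × ℝ}

lemma contMDiff_u_comp (hφ : ContDiff ℝ ∞ φ) :
    ContMDiff 𝓘(ℝ, F) 𝓘(ℝ, V) ∞ fun p => T.u (φ p) :=
  T.contMDiff_u.comp hφ.contMDiff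

lemma contMDiff_v_comp (hφ : ContDiff ℝ ∞ φ) :
    ContMDiff 𝓘(ℝ, F) 𝓘(ℝ, V) ∞ fun p => T.v (φ p) :=
  T.contMDiff_v.comp hφ.contMDiff

lemma contMDiff_E_comp (hφ : ContDiff ℝ ∞ φ) :
    ContMDiff 𝓘(ℝ, F) 𝓘(ℝ, U) ∞ fun p => T.E (φ p) :=
  T.contMDiff_E.comp hφ.contMDiff

end Smooth

/-- The cocycle of parallel and surface transport. Its surface part over the rectangle with corners
`(x, y)` and `(x', y')` combines the surface transports `T.E` over the four rectangles based at the
origin, and moves the base point to `(x, y)` by means of `m`. -/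
def toCocycle : X.Cocycle where
  f x' x y := T.u (x', y) * (T.u (x, y))⁻¹
  g x y' y := T.v (x, y') * (T.v (x, y))⁻¹
  W x' x y' y := X.m (T.u (x, y) * T.v (0, y))
    (T.E (x, y) * (T.E (x, y'))⁻¹ * T.E (x', y') * (T.E (x', y))⁻¹)
  contMDiff_f := (T.contMDiff_u_comp (by fun_prop)).mul (T.contMDiff_u_comp (by fun_prop)).inv
  contMDiff_g := (T.contMDiff_v_comp (by fun_prop)).mul (T.contMDiff_v_comp (by fun_prop)).inv
  contMDiff_W := fun p => X.contMDiffAt_m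
    ((T.contMDiff_u_comp (by fun_prop)).mul (T.contMDiff_v_comp (by fun_prop)) p)
    (((((T.contMDiff_E_comp (by fun_prop)).mul (T.contMDiff_E_comp (by fun_prop)).inv).mul
      (T.contMDiff_E_comp (by fun_prop))).mul (T.contMDiff_E_comp (by fun_prop)).inv) p)
  target x' x y' y := by
    rw [X.t_m]
    simp only [map_mul, map_inv, T.t_E, rectangleHolonomy]
    group
  f_comp x'' x' x y := by group
  g_comp x y'' y' y := by group
  W_comp_x x'' x' x y' y := by
    have h_base : (T.u (x', y) * (T.u (x, y))⁻¹)⁻¹ * (T.u (x', y) * T.v (0, y)) =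
        T.u (x, y) * T.v (0, y) := by group
    rw [← MulAut.mul_apply, ← map_mul, h_base, ← map_mul]
    congr 1
    group
  W_comp_y x' x y'' y' y := by
    have h_base : (T.v (x, y') * (T.v (x, y))⁻¹)⁻¹ * (T.u (x, y') * T.v (0, y')) =
        T.u (x, y) * T.v (0, y) * X.t (T.E (x, y) * (T.E (x, y'))⁻¹) := by
      simp only [map_mul, map_inv, T.t_E, rectangleHolonomy]
      group
    rw [← MulAut.mul_apply, ← map_mul, h_base, map_mul X.m _ (X.t _), MulAut.mul_apply,
      X.peiffer, ← map_mul]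
    congr 1
    group

lemma velocity_toCocycle_W (ξ x y : ℝ) :
    velocity (V := U) (fun η => T.toCocycle.W ξ x η y) y =
      X.mDotL (T.u (x, y) * T.v (0, y))
        (-rlog U (fun η => T.E (x, η)) y + rlog U (fun η => T.E (ξ, η)) y) := by
  let k : ℝ → ℝ → H := fun ξ η => T.E (ξ, η) * (T.E (ξ, y))⁻¹
  have hk (ξ : ℝ) : ContMDiffAt 𝓘(ℝ, ℝ) 𝓘(ℝ, U) ∞ (k ξ) y :=
    (contMDiffAt_slice_right (T.contMDiff_E (ξ, y))).mul contMDiffAt_const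
  have hk_one (ξ : ℝ) : k ξ y = 1 := mul_inv_cancel _
  have h_W : (fun η => T.toCocycle.W ξ x η y) =
      fun η => X.m (T.u (x, y) * T.v (0, y)) ((k x η)⁻¹ * k ξ η) := by
    funext η
    simp [toCocycle, k, mul_assoc]
  rw [h_W, X.velocity_m (c := fun η => (k x η)⁻¹ * k ξ η) _ ((hk x).inv.mul (hk ξ))
      (by simp [hk_one]), velocity_mul (hk x).inv (hk ξ) (by simp [hk_one]) (hk_one ξ),
    velocity_inv (hk x) (hk_one x)]
  rfl

lemma toCocycle_Bxy (x y : ℝ) : T.toCocycle.Bxy (x, y) = D.B (x, y) ![(1, 0), (0, 1)] := by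
  have h := (X.mDotL (T.u (x, y) * T.v (0, y))).hasFDerivAt.comp_hasDerivAt x
    ((T.hasDerivAt_rlog_E x y).const_add (-rlog U (fun η => T.E (x, η)) y))
  have h_base : T.u (x, y) * T.v (0, y) * ((T.v (0, y))⁻¹ * (T.u (x, y))⁻¹) = 1 := by group
  rw [map_neg, ← X.mDotL_mul, h_base, X.mDotL_one] at h
  have h_W := T.toCocycle.hasDerivAt_velocity_W_right x y
  simp only [velocity_toCocycle_W] at h_W
  exact neg_inj.1 (h_W.unique h)

theorem toDoublet_toCocycle : T.toCocycle.toDoublet = D := by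
  refine ConnectionDoublet.ext (funext fun p => oneForm_ext ?_ ?_) (funext fun p => twoForm_ext ?_)
  · exact (T.toCocycle.formA_x p).trans (neg_eq_iff_eq_neg.2 (T.rlog_u p.1 p.2))
  · exact (T.toCocycle.formA_y p).trans (neg_eq_iff_eq_neg.2 (T.rlog_v p.1 p.2))
  · exact (T.toCocycle.formB_xy p).trans (T.toCocycle_Bxy p.1 p.2)

end Transport

end ConnectionDoublet

theorem Cocycle.toDoublet_surjective [FiniteDimensional ℝ V] [FiniteDimensional ℝ U] :
    Function.Surjective (toDoublet : X.Cocycle → X.ConnectionDoublet) := fun D =>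
  let ⟨T⟩ := D.nonempty_transport
  ⟨T.toCocycle, T.toDoublet_toCocycle⟩

end LieCrossedModule

end

theorem mainTheorem1 {V U : Type*}
    [NormedAddCommGroup V] [NormedSpace ℝ V] [FiniteDimensional ℝ V]
    [NormedAddCommGroup U] [NormedSpace ℝ U] [FiniteDimensional ℝ U]
    {G H : Type*} [TopologicalSpace G] [ChartedSpace V G] [Group G] [LieGroup 𝓘(ℝ, V) ∞ G]
    [TopologicalSpace H] [ChartedSpace U H] [Group H] [LieGroup 𝓘(ℝ, U) ∞ H]
    (X : LieCrossedModule V U G H) :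
    ∃ Φ : X.Cocycle ≃ X.ConnectionDoublet,
      -- the doublet of a cocycle
      (∀ (c : X.Cocycle) (x y : ℝ),
        (Φ c).ax x y = -rightLogDeriv (V := V) (fun x' => c.f x' x y) x ∧
        (Φ c).ay x y = -rightLogDeriv (V := V) (fun y' => c.g x y' y) y ∧
        (Φ c).Bxy x y =
          -deriv (fun x' => rightLogDeriv (V := U) (fun y' => c.W x' x y' y) y) x ∧
        (Φ c).Bxy x y =
          -deriv (fun y' => leftLogDeriv (V := U) (fun x' => c.W x' x y' y) x) y) ∧
      -- the cocycle of a doublet is given by the unique solutions of the differential problems,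
      -- the two forms of the second order problem being equivalent
      (∀ D : X.ConnectionDoublet,
        (∀ (x₀ : ℝ) (u : ℝ → ℝ → G),
          D.IsSolutionU x₀ u ↔ u = fun y x => (Φ.symm D).f x x₀ y) ∧
        (∀ (y₀ : ℝ) (v : ℝ → ℝ → G),
          D.IsSolutionV y₀ v ↔ v = fun x y => (Φ.symm D).g x y y₀) ∧
        (∀ (x₀ y₀ : ℝ) (u v : ℝ → ℝ → G), D.IsSolutionU x₀ u → D.IsSolutionV y₀ v →
          ∀ E : ℝ → ℝ → H,
            (D.IsSolutionE₁ x₀ y₀ u v E ↔ E = fun x y => (Φ.symm D).W x x₀ y y₀) ∧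
            (D.IsSolutionE₂ x₀ y₀ u v E ↔ E = fun x y => (Φ.symm D).W x x₀ y y₀) ∧
            (D.IsSolutionE₁ x₀ y₀ u v E ↔ D.IsSolutionE₂ x₀ y₀ u v E))) := by
  let Φ : X.Cocycle ≃ X.ConnectionDoublet := Equiv.ofBijective LieCrossedModule.Cocycle.toDoublet
    ⟨LieCrossedModule.Cocycle.toDoublet_injective, LieCrossedModule.Cocycle.toDoublet_surjective⟩
  refine ⟨Φ, fun c x y => ⟨c.toDoublet_ax x y, c.toDoublet_ay x y,
    c.toDoublet_Bxy_eq_neg_deriv_rightLogDeriv x y,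
    c.toDoublet_Bxy_eq_neg_deriv_leftLogDeriv x y⟩, fun D => ?_⟩
  obtain ⟨c, rfl⟩ := Φ.surjective D
  rw [Φ.symm_apply_apply]
  exact ⟨fun _ _ => c.isSolutionU_iff, fun _ _ => c.isSolutionV_iff, fun _ _ _ _ hu hv _ =>
    ⟨c.isSolutionE₁_iff hu hv, c.isSolutionE₂_iff hu hv,
      (c.isSolutionE₁_iff hu hv).trans (c.isSolutionE₂_iff hu hv).symm⟩⟩
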